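/- **Setting.** Let $k$ be a field of characteristic $0$, let $(X,\mathcal O_X)$ be a ringed site (a small site with a sheaf of commutative $k$-algebras), and let $\mathcal L$ be a Lie algebroid on $X$ over $k$, that is, a sheaf of $k$-Lie algebras which is also an $\mathcal O_X$-module and acts on $\mathcal O_X$ by $k$-derivations, with $(fl)(g)=f\,l(g)$ and $[l,fm]=l(f)m+f[l,m]$. Assume that $\mathcal L$ is locally free of finite constant rank $d$ over $\mathcal O_X$. Let $\mathrm U_X\mathcal L$ be the enveloping algebra of $\mathcal L$, generated by $\mathcal O_X$ and $\mathcal L$ subject to $f\cdot l=fl$, $l\cdot f-f\cdot l=l(f)$, $l\cdot m-m\cdot l=[l,m]$ (with the multiplication and unit of $\mathcal O_X$), and with its cocommutative $\mathcal O_X$-coalgebra structure $\Delta(1)=1\otimes 1$, $\Delta(fD)=f\Delta(D)$, $\Delta(lD)=(l\otimes 1+1\otimes l)\Delta(D)$. Let $\mathrm J_X\mathcal L=\mathcal{H}om_{\mathcal O_X}(\mathrm U_X\mathcal L,\mathcal O_X)$ be the sheaf of jets, a commutative $\mathcal O_X$-algebra with product $(\alpha\beta)(D)=\sum\alpha(D_{(1)})\beta(D_{(2)})$,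 counit $\epsilon:\mathrm J_X\mathcal L\to\mathcal O_X$, $\epsilon(\alpha)=\alpha(1)$, and Grothendieck connection ${}^G\nabla_l(\alpha)(D)=l(\alpha(D))-\alpha(lD)$. For $n\ge 0$ let $$(\mathrm J_X\mathcal L)^{\widehat\otimes_X n}=\varprojlim_m\;(\mathrm J_X\mathcal L)^{\otimes_X n}/I_n^m,$$ a limit of sheaves of $k$-modules, where $I_n$ is the kernel of $\alpha_1\otimes\cdots\otimes\alpha_n\mapsto\epsilon(\alpha_1)\cdots\epsilon(\alpha_n)$. The connection ${}^G\nabla$ extends to it by the Leibniz rule and continuity. Let $\widehat{\mathrm{HC}}_{X,\bullet}(\mathrm J_X\mathcal L)$ be the chain complex with $\widehat{\mathrm{HC}}_{X,p}(\mathrm J_X\mathcal L)=(\mathrm J_X\mathcal L)^{\widehat\otimes_X (p+1)}$, $p\ge 0$, and the Hochschild differential $$\mathrm b_H(\alpha_0\otimes\cdots\otimes\alpha_p)=\sum_{i=0}^{p-1}(-1)^i\,\alpha_0\otimes\cdots\otimes\alpha_i\alpha_{i+1}\otimes\cdots\otimes\alpha_p+(-1)^p\,\alpha_p\alpha_0\otimes\alpha_1\otimes\cdots\otimes\alpha_{p-1}.$$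 It commutes with ${}^G\nabla$. Let $\mathrm{HC}^{\mathcal L}_{X,\bullet}$ be the subcomplex of ${}^G\nabla$-invariants: its sections over $U$ are the sections $\alpha$ of $\widehat{\mathrm{HC}}_{X,\bullet}(\mathrm J_X\mathcal L)$ over $U$ such that ${}^G\nabla_l(\alpha|_V)=0$ for all $V\to U$ and all $l\in\mathcal L(V)$. **Proposition 6.1.** (1) The sheaves $(\mathrm J_X\mathcal L)^{\widehat\otimes_X p}$ in degrees $p\ge 0$ form a chain complex with the differential which is $0$ in degree $0$ and in degree $p\ge 1$ is given by $$\mathrm b_H(\alpha_1\otimes\cdots\otimes\alpha_p)=\epsilon(\alpha_1)\alpha_2\otimes\cdots\otimes\alpha_p+\sum_{i=1}^{p-1}(-1)^i\,\alpha_1\otimes\cdots\otimes\alpha_i\alpha_{i+1}\otimes\cdots\otimes\alpha_p+(-1)^p\,\alpha_1\otimes\cdots\otimes\alpha_{p-1}\,\epsilon(\alpha_p).$$ (2) The (continuous) maps $$\widehat{\mathrm{HC}}_{X,p}(\mathrm J_X\mathcal L)\to(\mathrm J_X\mathcal L)^{\widehat\otimes_X p},\qquad \alpha_0\otimes\alpha_1\otimes\cdots\otimes\alpha_p\mapsto\epsilon(\alpha_0)\,\alpha_1\otimes\cdots\otimes\alpha_p,$$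 commute with the differentials. (3) The restriction of this morphism to the invariants is an isomorphism of complexes of sheaves of $k$-modules $$\mathrm{HC}^{\mathcal L}_{X,\bullet}\;\cong\;\bigoplus_{p\ge 0}(\mathrm J_X\mathcal L)^{\widehat\otimes_X p}.$$ -/

import Mathlib

open CategoryTheory Opposite TensorProduct Limits

universe u v w

set_option linter.unusedSectionVars false

noncomputable section

namespace LieJets

lemma lie_one {A : Type v} {L : Type w} [CommRing A] [LieRing L] [Module A L] [LieRingModule L A]
    [LieRinehartRing A L] (l : L) : ⁅l, (1 : A)⁆ = 0 := by
  simpa using LieRinehartRing.leibniz_mul_right l (1 : A) 1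

/-- The connection `∇_l (m ⊗ n) = ∇_l m ⊗ n + m ⊗ ∇_l n` on a tensor product. -/
def tensorConn {A : Type v} {L : Type w} [CommRing A] [LieRing L] [LieRingModule L A] (l : L)
    {M N : Type*} [AddCommMonoid M] [Module A M] [AddCommMonoid N] [Module A N]
    (δ : M →+ M) (δ' : N →+ N) (h : ∀ (a : A) m, δ (a • m) = ⁅l, a⁆ • m + a • δ m)
    (h' : ∀ (a : A) n, δ' (a • n) = ⁅l, a⁆ • n + a • δ' n) : M ⊗[A] N →+ M ⊗[A] N :=
  TensorProduct.liftAddHom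
    { toFun := fun m ↦
        { toFun := fun n ↦ δ m ⊗ₜ[A] n + m ⊗ₜ[A] δ' n
          map_zero' := by simp
          map_add' := fun n₁ n₂ ↦ by simp only [map_add, tmul_add]; abel }
      map_zero' := by ext; simp
      map_add' := fun m₁ m₂ ↦ by
        ext n
        simp only [map_add, add_tmul, AddMonoidHom.add_apply, AddMonoidHom.coe_mk, ZeroHom.coe_mk]
        abel }
    (fun a m n ↦ by
      simp only [AddMonoidHom.coe_mk, ZeroHom.coe_mk, h, h', add_tmul, tmul_add, smul_tmul]
      abel)

section tensorConn

variable {A : Type v} {L : Type w} [CommRing A] [LieRing L] [LieRingModule L A] (l : L)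
    {M N : Type*} [AddCommMonoid M] [Module A M] [AddCommMonoid N] [Module A N]
    (δ : M →+ M) (δ' : N →+ N) (h : ∀ (a : A) m, δ (a • m) = ⁅l, a⁆ • m + a • δ m)
    (h' : ∀ (a : A) n, δ' (a • n) = ⁅l, a⁆ • n + a • δ' n)

@[simp] lemma tensorConn_tmul (m : M) (n : N) :
    tensorConn l δ δ' h h' (m ⊗ₜ n) = δ m ⊗ₜ n + m ⊗ₜ δ' n := rfl

lemma tensorConn_smul (a : A) (t : M ⊗[A] N) : tensorConn l δ δ' h h' (a • t) =
    ⁅l, a⁆ • t + a • tensorConn l δ δ' h h' t := by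
  induction t using TensorProduct.induction_on with
  | zero => simp
  | tmul m n => rw [smul_tmul', tensorConn_tmul, h, tensorConn_tmul, add_tmul, smul_add,
      smul_tmul', smul_tmul', smul_tmul', add_assoc]
  | add x y hx hy => simp only [smul_add, map_add, hx, hy]; abel

end tensorConn

section Envelope

variable (k : Type u) (A : Type v) (L : Type w) [CommRing k] [CommRing A] [Algebra k A]
  [LieRing L] [LieAlgebra k L] [Module A L] [LieRingModule L A] [LieRinehartRing A L]
  [LieRinehartAlgebra k A L]

/-- The relations of the universal enveloping algebra of a Lie-Rinehart algebra `(A, L)`, imposed on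
the tensor algebra of `A × L`: the unit of `A` becomes the unit, `f · (g, l) = (f g, f l)`, and
commutators are given by the Lie bracket `[(f, l), (g, m)] = (l(g) - m(f), [l, m])`. -/
inductive EnvRel : TensorAlgebra k (A × L) → TensorAlgebra k (A × L) → Prop
  | one : EnvRel (TensorAlgebra.ι k ((1 : A), (0 : L))) 1
  | smul (f g : A) (l : L) :
      EnvRel (TensorAlgebra.ι k (f, (0 : L)) * TensorAlgebra.ι k (g, l))
        (TensorAlgebra.ι k (f * g, f • l))
  | lie (f g : A) (l m : L) :
      EnvRel (TensorAlgebra.ι k (f, l) * TensorAlgebra.ι k (g, m))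
        (TensorAlgebra.ι k (g, m) * TensorAlgebra.ι k (f, l) +
          TensorAlgebra.ι k (⁅l, g⁆ - ⁅m, f⁆, ⁅l, m⁆))

/-- The universal enveloping algebra `U(A, L)` of a Lie-Rinehart algebra. -/
def Env : Type (max u v w) := RingQuot (EnvRel k A L)

namespace Env

instance : Ring (Env k A L) := inferInstanceAs (Ring (RingQuot (EnvRel k A L)))
instance : Algebra k (Env k A L) := inferInstanceAs (Algebra k (RingQuot (EnvRel k A L)))

/-- The quotient map from the tensor algebra. -/
def mk : TensorAlgebra k (A × L) →ₐ[k] Env k A L := RingQuot.mkAlgHom k (EnvRel k A L)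

variable {k A L} in
lemma mk_rel {x y : TensorAlgebra k (A × L)} (h : EnvRel k A L x y) : mk k A L x = mk k A L y :=
  RingQuot.mkAlgHom_rel k h

lemma mk_surjective : Function.Surjective (mk k A L) :=
  RingQuot.mkAlgHom_surjective k (EnvRel k A L)

/-- The canonical map `A × L → U(A, L)`. -/
def ι : A × L →ₗ[k] Env k A L := (mk k A L).toLinearMap ∘ₗ TensorAlgebra.ι k

lemma mk_ι (x : A × L) : mk k A L (TensorAlgebra.ι k x) = ι k A L x := rfl

variable {k A L}

lemma ι_one : ι k A L (1, 0) = 1 := by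
  have := mk_rel (EnvRel.one (k := k) (A := A) (L := L))
  rwa [mk_ι, map_one] at this

lemma ι_smul (f g : A) (l : L) : ι k A L (f, 0) * ι k A L (g, l) = ι k A L (f * g, f • l) := by
  have := mk_rel (EnvRel.smul (k := k) (A := A) (L := L) f g l)
  rwa [map_mul, mk_ι, mk_ι, mk_ι] at this

lemma ι_lie (f g : A) (l m : L) : ι k A L (f, l) * ι k A L (g, m) =
    ι k A L (g, m) * ι k A L (f, l) + ι k A L (⁅l, g⁆ - ⁅m, f⁆, ⁅l, m⁆) := by
  have := mk_rel (EnvRel.lie (k := k) (A := A) (L := L) f g l m)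
  rwa [map_add, map_mul, map_mul, mk_ι, mk_ι, mk_ι] at this

variable (k A L)

/-- The canonical algebra homomorphism `A → U(A, L)`. -/
def fn : A →ₐ[k] Env k A L :=
  AlgHom.ofLinearMap (ι k A L ∘ₗ LinearMap.inl k A L) ι_one
    (fun x y ↦ by simp [ι_smul])

/-- The canonical map `L → U(A, L)`. -/
def vf : L →ₗ[k] Env k A L := ι k A L ∘ₗ LinearMap.inr k A L

variable {k A L}

lemma fn_apply (a : A) : fn k A L a = ι k A L (a, 0) := rfl

lemma vf_apply (l : L) : vf k A L l = ι k A L (0, l) := rfl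

lemma ι_eq (a : A) (l : L) : ι k A L (a, l) = fn k A L a + vf k A L l := by
  rw [fn_apply, vf_apply, ← map_add, Prod.mk_add_mk, add_zero, zero_add]

lemma fn_mul_vf (a : A) (l : L) : fn k A L a * vf k A L l = vf k A L (a • l) := by
  rw [fn_apply, vf_apply, ι_smul, mul_zero, vf_apply]

lemma vf_mul_fn (a : A) (l : L) :
    vf k A L l * fn k A L a = fn k A L a * vf k A L l + fn k A L ⁅l, a⁆ := by
  simpa [fn_apply, vf_apply] using ι_lie (k := k) (0 : A) a l 0

lemma vf_lie (l m : L) :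
    vf k A L ⁅l, m⁆ = vf k A L l * vf k A L m - vf k A L m * vf k A L l := by
  have := ι_lie (k := k) (0 : A) 0 l m
  simp only [lie_zero, sub_zero] at this
  simp [vf_apply, this]

/-- The universal property of `U(A, L)`. -/
def lift {B : Type*} [Ring B] [Algebra k B] (φ : A →ₐ[k] B) (ψ : L →ₗ[k] B)
    (h₁ : ∀ a l, φ a * ψ l = ψ (a • l)) (h₂ : ∀ l a, ψ l * φ a = φ a * ψ l + φ ⁅l, a⁆)
    (h₃ : ∀ l m, ψ ⁅l, m⁆ = ψ l * ψ m - ψ m * ψ l) : Env k A L →ₐ[k] B :=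
  RingQuot.liftAlgHom k ⟨TensorAlgebra.lift k (φ.toLinearMap.coprod ψ), by
    intro x y h
    cases h with
    | one => simp
    | smul f g l => simp [mul_add, h₁]
    | lie f g l m =>
      have hc : φ g * φ f = φ f * φ g := by rw [← map_mul, mul_comm, map_mul]
      simp only [map_mul, map_add, TensorAlgebra.lift_ι_apply, LinearMap.coprod_apply,
        AlgHom.toLinearMap_apply, map_sub, h₃, mul_add, add_mul, h₂, hc]
      abel⟩

section lift
variable {B : Type*} [Ring B] [Algebra k B] (φ : A →ₐ[k] B) (ψ : L →ₗ[k] B)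
    (h₁ : ∀ a l, φ a * ψ l = ψ (a • l)) (h₂ : ∀ l a, ψ l * φ a = φ a * ψ l + φ ⁅l, a⁆)
    (h₃ : ∀ l m, ψ ⁅l, m⁆ = ψ l * ψ m - ψ m * ψ l)

lemma lift_ι (a : A) (l : L) : lift φ ψ h₁ h₂ h₃ (ι k A L (a, l)) = φ a + ψ l := by
  refine (RingQuot.liftAlgHom_mkAlgHom_apply (S := k) _ _ _).trans ?_
  simp

@[simp] lemma lift_fn (a : A) : lift φ ψ h₁ h₂ h₃ (fn k A L a) = φ a := by
  rw [fn_apply, lift_ι, map_zero, add_zero]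

@[simp] lemma lift_vf (l : L) : lift φ ψ h₁ h₂ h₃ (vf k A L l) = ψ l := by
  rw [vf_apply, lift_ι, map_zero, zero_add]

end lift

lemma algebraMap_eq (r : k) : algebraMap k (Env k A L) r = fn k A L (algebraMap k A r) :=
  ((fn k A L).commutes r).symm

/-- Every element of `U(A, L)` is obtained from `1` by sums and left multiplications by elements of
`A` and of `L`. -/
lemma induction {p : Env k A L → Prop} (h1 : p 1) (hadd : ∀ x y, p x → p y → p (x + y))
    (hfn : ∀ a x, p x → p (fn k A L a * x)) (hvf : ∀ l x, p x → p (vf k A L l * x))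
    (x : Env k A L) : p x := by
  obtain ⟨t, rfl⟩ := mk_surjective k A L x
  suffices ∀ D, p D → p (mk k A L t * D) by simpa using this 1 h1
  induction t using TensorAlgebra.induction with
  | algebraMap r => intro D hD; rw [AlgHom.commutes, algebraMap_eq]; exact hfn _ _ hD
  | ι z =>
    intro D hD
    obtain ⟨a, l⟩ := z
    rw [mk_ι, ι_eq, add_mul]
    exact hadd _ _ (hfn _ _ hD) (hvf _ _ hD)
  | mul x y hx hy => intro D hD; rw [map_mul, mul_assoc]; exact hx _ (hy _ hD)
  | add x y hx hy => intro D hD; rw [map_add, add_mul]; exact hadd _ _ (hx _ hD) (hy _ hD)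

/-- `U(A, L)` as a left `A`-module. -/
instance : Module A (Env k A L) := Module.compHom _ (fn k A L).toRingHom

lemma smul_def (a : A) (x : Env k A L) : a • x = fn k A L a * x := rfl

instance : IsScalarTower k A (Env k A L) where
  smul_assoc r a x := by simp [smul_def]

instance : SMulCommClass A k (Env k A L) := IsScalarTower.to_smulCommClass'

lemma vf_mul_smul (l : L) (a : A) (x : Env k A L) :
    vf k A L l * a • x = ⁅l, a⁆ • x + a • (vf k A L l * x) := by
  simp only [smul_def, ← mul_assoc, vf_mul_fn, add_mul]
  abel

/-- The action of `U(A, L)` on `A`. -/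
def act : Env k A L →ₐ[k] Module.End k A :=
  lift (Algebra.lmul k A) (LieModule.toEnd k L A : L →ₗ[k] Module.End k A)
    (fun a l ↦ by ext; simp) (fun l a ↦ by ext; simp) (fun l m ↦ by ext; simp)

@[simp] lemma act_fn (a b : A) : act (fn k A L a) b = a * b := by simp [act]
@[simp] lemma act_vf (l : L) (b : A) : act (vf k A L l) b = ⁅l, b⁆ := by simp [act]

end Env


namespace Env

/-- The canonical flat connection `∇_l D = l D` on `U(A, L)`. -/
def conn (l : L) : Env k A L →+ Env k A L := AddMonoidHom.mulLeft (vf k A L l)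

@[simp] lemma conn_apply (l : L) (x : Env k A L) : conn k A L l x = vf k A L l * x := rfl

/-- The induced flat connection on `U(A, L) ⊗ U(A, L)`. -/
def conn₂ (l : L) : Env k A L ⊗[A] Env k A L →+ Env k A L ⊗[A] Env k A L :=
  tensorConn l (conn k A L l) (conn k A L l) (vf_mul_smul l) (vf_mul_smul l)

variable {k A L}

@[simp] lemma conn₂_tmul (l : L) (x y : Env k A L) : conn₂ k A L l (x ⊗ₜ y) =
    (vf k A L l * x) ⊗ₜ y + x ⊗ₜ (vf k A L l * y) := rfl

lemma conn₂_smul (l : L) (a : A) (t : Env k A L ⊗[A] Env k A L) :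
    conn₂ k A L l (a • t) = ⁅l, a⁆ • t + a • conn₂ k A L l t := tensorConn_smul ..

lemma conn₂_ksmul (l : L) (r : k) (t : Env k A L ⊗[A] Env k A L) :
    conn₂ k A L l (r • t) = r • conn₂ k A L l t := by
  have : ⁅l, algebraMap k A r⁆ = 0 := by
    rw [Algebra.algebraMap_eq_smul_one, LieModule.lie_smul r l (1 : A), lie_one, smul_zero]
  rw [← algebraMap_smul A r t, conn₂_smul, algebraMap_smul, this, zero_smul, zero_add]

variable (k A L)

/-- The connection on `U(A, L) ⊗ U(A, L)` as a linear map in `l`. -/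
def conn₂Hom : L →ₗ[k] Module.End k (Env k A L ⊗[A] Env k A L) :=
    { toFun := fun l ↦ { toFun := conn₂ k A L l
                         map_add' := map_add _
                         map_smul' := conn₂_ksmul l }
      map_add' := fun l m ↦ by
        ext t
        simp only [LinearMap.coe_mk, AddHom.coe_mk, LinearMap.add_apply]
        induction t using TensorProduct.induction_on with
        | zero => simp
        | tmul x y => simp only [conn₂_tmul, map_add, add_mul, add_tmul, tmul_add]; abel
        | add x y hx hy => simp only [map_add, hx, hy]; abel
      map_smul' := fun r l ↦ by
        ext t
        simp only [LinearMap.coe_mk, AddHom.coe_mk, LinearMap.smul_apply, RingHom.id_apply]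
        induction t using TensorProduct.induction_on with
        | zero => simp
        | tmul x y => simp [smul_tmul']
        | add x y hx hy => simp only [map_add, hx, hy, smul_add] }

lemma conn₂Hom_apply (l : L) (t : Env k A L ⊗[A] Env k A L) :
    conn₂Hom k A L l t = conn₂ k A L l t := rfl

/-- The left action of `U(A, L)` on `U(A, L) ⊗ U(A, L)` in which elements of `L` act by the
Leibniz rule. -/
def act₂ : Env k A L →ₐ[k] Module.End k (Env k A L ⊗[A] Env k A L) :=
  lift (B := Module.End k (Env k A L ⊗[A] Env k A L))
    (Algebra.lsmul k k (Env k A L ⊗[A] Env k A L))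
    (conn₂Hom k A L)
    (fun a l ↦ by
      ext t
      simp only [conn₂Hom_apply, Module.End.mul_apply, Algebra.lsmul_coe]
      induction t using TensorProduct.induction_on with
      | zero => simp
      | tmul x y =>
        rw [conn₂_tmul, smul_add, conn₂_tmul, ← fn_mul_vf, mul_assoc, mul_assoc, ← smul_def,
          ← smul_def, smul_tmul', tmul_smul, smul_tmul']
      | add x y hx hy => simp only [map_add, smul_add, hx, hy])
    (fun l a ↦ by
      ext t
      simp only [conn₂Hom_apply, Module.End.mul_apply, Algebra.lsmul_coe,
        LinearMap.add_apply, conn₂_smul]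
      abel)
    (fun l m ↦ by
      ext t
      simp only [conn₂Hom_apply, Module.End.mul_apply, LinearMap.sub_apply]
      induction t using TensorProduct.induction_on with
      | zero => simp
      | tmul x y =>
        simp only [conn₂_tmul, map_add, vf_lie, sub_mul, sub_tmul, tmul_sub, mul_assoc]; abel
      | add x y hx hy => simp only [map_add, hx, hy]; abel)

/-- The comultiplication of `U(A, L)`. It is determined by `Δ(1) = 1 ⊗ 1`, `Δ(f D) = f Δ(D)` and
`Δ(l D) = (l ⊗ 1 + 1 ⊗ l) Δ(D)`. -/
def comul : Env k A L →ₗ[A] Env k A L ⊗[A] Env k A L where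
  toFun D := act₂ k A L D (1 ⊗ₜ 1)
  map_add' x y := by simp
  map_smul' a x := by simp [smul_def, act₂]

/-- The counit `D ↦ D(1)` of `U(A, L)`. -/
def counit : Env k A L →ₗ[A] A where
  toFun D := act D 1
  map_add' x y := by simp
  map_smul' a x := by simp [smul_def]

variable {k A L}

lemma comul_one : comul k A L 1 = 1 ⊗ₜ 1 := by
  change act₂ k A L 1 (1 ⊗ₜ 1) = _
  simp

lemma comul_fn_mul (a : A) (x : Env k A L) :
    comul k A L (fn k A L a * x) = a • comul k A L x := (comul k A L).map_smul a x

lemma comul_vf_mul (l : L) (x : Env k A L) :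
    comul k A L (vf k A L l * x) = conn₂ k A L l (comul k A L x) := by
  simp [comul, act₂, conn₂Hom_apply]

lemma counit_one : counit k A L 1 = 1 := by simp [counit]

lemma counit_fn_mul (a : A) (x : Env k A L) :
    counit k A L (fn k A L a * x) = a * counit k A L x := (counit k A L).map_smul a x

lemma counit_vf_mul (l : L) (x : Env k A L) :
    counit k A L (vf k A L l * x) = ⁅l, counit k A L x⁆ := by
  simp [counit]

lemma lie_leibniz (l : L) (a b : A) : ⁅l, a • b⁆ = ⁅l, a⁆ • b + a • ⁅l, b⁆ := by
  simp only [smul_eq_mul, LieRinehartRing.leibniz_mul_right]; abel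

/-- The action of `L` on `A`. -/
def lieA (l : L) : A →+ A := AddMonoidHom.mk' (fun a ↦ ⁅l, a⁆) (lie_add l)

lemma lieA_apply (l : L) (a : A) : lieA l a = ⁅l, a⁆ := rfl

/-- The cocommutative coalgebra structure of `U(A, L)`. -/
instance : Coalgebra A (Env k A L) where
  comul := comul k A L
  counit := counit k A L
  coassoc := by
    ext x
    simp only [LinearMap.comp_apply, LinearEquiv.coe_coe]
    induction x using Env.induction with
    | h1 => simp [comul_one]
    | hadd x y hx hy => simp only [map_add, hx, hy]
    | hfn a x hx => simp only [comul_fn_mul, map_smul, hx]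
    | hvf l x hx =>
      let c := tensorConn l (conn k A L l) (conn₂ k A L l) (vf_mul_smul l) (conn₂_smul l)
      have hc (x : Env k A L) (t : Env k A L ⊗[A] Env k A L) :
          c (x ⊗ₜ t) = (vf k A L l * x) ⊗ₜ t + x ⊗ₜ conn₂ k A L l t := rfl
      have e₁ (t : Env k A L ⊗[A] Env k A L) : (comul k A L).lTensor _ (conn₂ k A L l t) =
          c ((comul k A L).lTensor _ t) := by
        induction t using TensorProduct.induction_on with
        | zero => simp
        | tmul x y =>
          rw [LinearMap.lTensor_tmul, hc]; simp [comul_vf_mul]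
        | add x y hx hy => simp only [map_add, hx, hy]
      have e₂ (t : Env k A L ⊗[A] Env k A L) (y : Env k A L) :
          TensorProduct.assoc A _ _ _ (conn₂ k A L l t ⊗ₜ y + t ⊗ₜ (vf k A L l * y)) =
          c (TensorProduct.assoc A _ _ _ (t ⊗ₜ y)) := by
        induction t using TensorProduct.induction_on with
        | zero => simp
        | tmul x z => simp [hc, add_tmul, tmul_add, add_assoc]
        | add x y hx hy =>
          simp only [map_add, add_tmul, ← hx, ← hy]
          abel
      have e₃ (t : Env k A L ⊗[A] Env k A L) :
          TensorProduct.assoc A _ _ _ ((comul k A L).rTensor _ (conn₂ k A L l t)) =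
          c (TensorProduct.assoc A _ _ _ ((comul k A L).rTensor _ t)) := by
        induction t using TensorProduct.induction_on with
        | zero => simp
        | tmul x y => 
          rw [LinearMap.rTensor_tmul, ← e₂, conn₂_tmul, map_add, LinearMap.rTensor_tmul,
            LinearMap.rTensor_tmul, comul_vf_mul]
        | add x y hx hy => simp only [map_add, hx, hy]
      rw [comul_vf_mul, e₁, e₃, hx]
  rTensor_counit_comp_comul := by
    ext x
    simp only [LinearMap.comp_apply]
    induction x using Env.induction with
    | h1 => simp [comul_one, counit_one]
    | hadd x y hx hy => simp only [map_add, hx, hy]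
    | hfn a x hx => rw [comul_fn_mul, map_smul, hx, ← map_smul, smul_def]
    | hvf l x hx =>
      let c := tensorConn l (lieA l) (conn k A L l) (lie_leibniz l) (vf_mul_smul l)
      have hc (a : A) (x : Env k A L) : c (a ⊗ₜ x) = ⁅l, a⁆ ⊗ₜ x + a ⊗ₜ (vf k A L l * x) := rfl
      have e (t : Env k A L ⊗[A] Env k A L) : (counit k A L).rTensor _ (conn₂ k A L l t) =
          c ((counit k A L).rTensor _ t) := by
        induction t using TensorProduct.induction_on with
        | zero => simp
        | tmul x y => simp [counit_vf_mul, hc]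
        | add x y hx hy => simp only [map_add, hx, hy]
      rw [comul_vf_mul, e, hx]
      simp [hc, lie_one]
  lTensor_counit_comp_comul := by
    ext x
    simp only [LinearMap.comp_apply]
    induction x using Env.induction with
    | h1 => simp [comul_one, counit_one]
    | hadd x y hx hy => simp only [map_add, hx, hy]
    | hfn a x hx => rw [comul_fn_mul, map_smul, hx, ← map_smul, smul_def]
    | hvf l x hx =>
      let c := tensorConn l (conn k A L l) (lieA l) (vf_mul_smul l) (lie_leibniz l)
      have hc (x : Env k A L) (a : A) : c (x ⊗ₜ a) = (vf k A L l * x) ⊗ₜ a + x ⊗ₜ ⁅l, a⁆ := rfl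
      have e (t : Env k A L ⊗[A] Env k A L) : (counit k A L).lTensor _ (conn₂ k A L l t) =
          c ((counit k A L).lTensor _ t) := by
        induction t using TensorProduct.induction_on with
        | zero => simp
        | tmul x y => simp [counit_vf_mul, hc]
        | add x y hx hy => simp only [map_add, hx, hy]
      rw [comul_vf_mul, e, hx]
      simp [hc, lie_one]

instance : Coalgebra.IsCocomm A (Env k A L) where
  comm_comp_comul := by
    ext x
    simp only [LinearMap.comp_apply, LinearEquiv.coe_coe]
    change TensorProduct.comm A _ _ (comul k A L x) = comul k A L x
    induction x using Env.induction with
    | h1 => simp [comul_one]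
    | hadd x y hx hy => simp only [map_add, hx, hy]
    | hfn a x hx => simp only [comul_fn_mul, map_smul, hx]
    | hvf l x hx =>
      have e (t : Env k A L ⊗[A] Env k A L) : TensorProduct.comm A _ _ (conn₂ k A L l t) =
          conn₂ k A L l (TensorProduct.comm A _ _ t) := by
        induction t using TensorProduct.induction_on with
        | zero => simp
        | tmul x y => simp [add_comm]
        | add x y hx hy => simp only [map_add, hx, hy]
      rw [comul_vf_mul, e, hx]

end Env

end Envelope

section Jet

variable (k : Type u) (A : Type v) (L : Type w) [CommRing k] [CommRing A] [Algebra k A]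
  [LieRing L] [LieAlgebra k L] [Module A L] [LieRingModule L A] [LieRinehartRing A L]
  [LieRinehartAlgebra k A L]

/-- The `A`-linear dual of `U(A, L)`, with the convolution product
`(α β)(D) = ∑ α(D₁) β(D₂)`. This is a commutative `A`-algebra, with unit the counit of
`U(A, L)`. -/
abbrev Jet : Type (max u v w) := WithConv (Env k A L →ₗ[A] A)

namespace Jet

variable {k A L}

/-- The pairing of `α ⊗ β` with an element of `U(A, L) ⊗ U(A, L)`. -/
def pair (α β : Jet k A L) : Env k A L ⊗[A] Env k A L →ₗ[A] A :=
  LinearMap.mul' A A ∘ₗ TensorProduct.map α.ofConv β.ofConv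

lemma mul_apply (α β : Jet k A L) (D : Env k A L) :
    (α * β).ofConv D = pair α β (Env.comul k A L D) := rfl

@[simp] lemma pair_tmul (α β : Jet k A L) (D E : Env k A L) :
    pair α β (D ⊗ₜ E) = α.ofConv D * β.ofConv E := rfl

lemma one_apply (D : Env k A L) : (1 : Jet k A L).ofConv D = Env.counit k A L D := rfl

lemma algebraMap_apply (a : A) (D : Env k A L) :
    (algebraMap A (Jet k A L) a).ofConv D = a * Env.counit k A L D := rfl

lemma add_apply (α β : Jet k A L) (D : Env k A L) :
    (α + β).ofConv D = α.ofConv D + β.ofConv D := rfl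

lemma map_fn_mul (α : Jet k A L) (a : A) (D : Env k A L) :
    α.ofConv (Env.fn k A L a * D) = a * α.ofConv D := α.ofConv.map_smul a D

/-- The Grothendieck connection `(∇_l α)(D) = l(α(D)) - α(l D)`. -/
def conn (l : L) (α : Jet k A L) : Jet k A L := .toConv
  { toFun := fun D ↦ ⁅l, α.ofConv D⁆ - α.ofConv (Env.vf k A L l * D)
    map_add' := fun D E ↦ by simp only [map_add, lie_add, mul_add]; abel
    map_smul' := fun a D ↦ by
      simp only [map_smul, Env.vf_mul_smul, map_add, smul_eq_mul,
        LieRinehartRing.leibniz_mul_right, RingHom.id_apply]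
      ring }

@[simp] lemma conn_apply (l : L) (α : Jet k A L) (D : Env k A L) :
    (conn l α).ofConv D = ⁅l, α.ofConv D⁆ - α.ofConv (Env.vf k A L l * D) := rfl

lemma conn_add (l : L) (α β : Jet k A L) : conn l (α + β) = conn l α + conn l β := by
  ext D
  change (conn l (α + β)).ofConv D = (conn l α).ofConv D + (conn l β).ofConv D
  simp only [conn_apply, add_apply, lie_add]
  abel

lemma conn_mul (l : L) (α β : Jet k A L) : conn l (α * β) = conn l α * β + α * conn l β := by
  ext D
  change (conn l (α * β)).ofConv D = (conn l α * β).ofConv D + (α * conn l β).ofConv D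
  rw [conn_apply]
  simp only [mul_apply, Env.comul_vf_mul]
  induction Env.comul k A L D using TensorProduct.induction_on with
  | zero => simp
  | tmul x y =>
    simp only [Env.conn₂_tmul, map_add, pair_tmul, conn_apply, LieRinehartRing.leibniz_mul_right,
      smul_eq_mul]
    ring
  | add x y hx hy =>
    simp only [map_add, lie_add]
    linear_combination hx + hy

lemma conn_algebraMap (l : L) (a : A) :
    conn l (algebraMap A (Jet k A L) a) = algebraMap A (Jet k A L) ⁅l, a⁆ := by
  ext D
  change (conn l (algebraMap A (Jet k A L) a)).ofConv D = (algebraMap A (Jet k A L) ⁅l, a⁆).ofConv D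
  simp only [conn_apply, algebraMap_apply, Env.counit_vf_mul, LieRinehartRing.leibniz_mul_right,
      smul_eq_mul]
  ring

lemma conn_smul_left (l : L) (a : A) (α : Jet k A L) : conn (a • l) α = a • conn l α := by
  ext D
  change (conn (a • l) α).ofConv D = a * (conn l α).ofConv D
  simp only [conn_apply, LieRinehartRing.lie_smul_eq_mul, ← Env.fn_mul_vf, mul_assoc, map_fn_mul]
  ring

lemma conn_add_left (l m : L) (α : Jet k A L) : conn (l + m) α = conn l α + conn m α := by
  ext D
  change (conn (l + m) α).ofConv D = (conn l α).ofConv D + (conn m α).ofConv D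
  simp only [conn_apply, add_lie, map_add, add_mul]
  ring

end Jet

end Jet

section Functoriality

variable {k : Type u} [CommRing k] {A A' : Type v} {L L' : Type w} [CommRing A] [Algebra k A]
  [LieRing L] [LieAlgebra k L] [Module A L] [LieRingModule L A] [LieRinehartRing A L]
  [LieRinehartAlgebra k A L] [CommRing A'] [Algebra k A']
  [LieRing L'] [LieAlgebra k L'] [Module A' L'] [LieRingModule L' A'] [LieRinehartRing A' L']
  [LieRinehartAlgebra k A' L']

/-- The map of enveloping algebras induced by a morphism of Lie-Rinehart algebras. -/
def Env.map {φ : A →ₐ[k] A'} (F : LieRinehartAlgebra.Hom φ L L') : Env k A L →ₐ[k] Env k A' L' :=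
  Env.lift ((Env.fn k A' L').comp φ) (Env.vf k A' L' ∘ₗ (F.toLieHom : L →ₗ[k] L'))
    (fun a l ↦ by simp [Env.fn_mul_vf, F.map_smul_apply])
    (fun l a ↦ by simp [Env.vf_mul_fn, F.apply_lie])
    (fun l m ↦ by simp [Env.vf_lie])

@[simp] lemma Env.map_fn {φ : A →ₐ[k] A'} (F : LieRinehartAlgebra.Hom φ L L') (a : A) :
    Env.map F (Env.fn k A L a) = Env.fn k A' L' (φ a) := by simp [Env.map]

@[simp] lemma Env.map_vf {φ : A →ₐ[k] A'} (F : LieRinehartAlgebra.Hom φ L L') (l : L) :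
    Env.map F (Env.vf k A L l) = Env.vf k A' L' (F l) := by simp [Env.map]

/-- The map induced by `Env.map` on `U ⊗ U`. -/
def Env.map₂ {φ : A →ₐ[k] A'} (F : LieRinehartAlgebra.Hom φ L L') :
    Env k A L ⊗[A] Env k A L →+ Env k A' L' ⊗[A'] Env k A' L' :=
  TensorProduct.liftAddHom
    { toFun := fun m ↦
        { toFun := fun n ↦ Env.map F m ⊗ₜ[A'] Env.map F n
          map_zero' := by simp
          map_add' := fun n₁ n₂ ↦ by simp only [map_add, tmul_add] }
      map_zero' := by ext; simp
      map_add' := fun m₁ m₂ ↦ by ext n; simp [add_tmul] }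
    (fun a m n ↦ by
      simp only [AddMonoidHom.coe_mk, ZeroHom.coe_mk, Env.smul_def, map_mul, Env.map_fn]
      simp only [← Env.smul_def, smul_tmul])

lemma Env.map₂_tmul {φ : A →ₐ[k] A'} (F : LieRinehartAlgebra.Hom φ L L') (x y : Env k A L) :
    Env.map₂ F (x ⊗ₜ y) = Env.map F x ⊗ₜ Env.map F y := rfl

lemma Env.comul_map {φ : A →ₐ[k] A'} (F : LieRinehartAlgebra.Hom φ L L') (D : Env k A L) :
    Env.comul k A' L' (Env.map F D) = Env.map₂ F (Env.comul k A L D) := by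
  induction D using Env.induction with
  | h1 => simp [Env.comul_one, Env.map₂_tmul]
  | hadd x y hx hy => simp only [map_add, hx, hy]
  | hfn a x hx =>
    rw [map_mul, Env.map_fn, Env.comul_fn_mul, Env.comul_fn_mul, hx]
    induction Env.comul k A L x using TensorProduct.induction_on with
    | zero => simp
    | tmul x y => simp [smul_tmul', Env.map₂_tmul, Env.smul_def]
    | add x y hx hy => simp only [map_add, smul_add, hx, hy]
  | hvf l x hx =>
    rw [map_mul, Env.map_vf, Env.comul_vf_mul, Env.comul_vf_mul, hx]
    induction Env.comul k A L x using TensorProduct.induction_on with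
    | zero => simp
    | tmul x y => simp [Env.map₂_tmul]
    | add x y hx hy => simp only [map_add, hx, hy]

lemma Env.counit_map {φ : A →ₐ[k] A'} (F : LieRinehartAlgebra.Hom φ L L') (D : Env k A L) :
    Env.counit k A' L' (Env.map F D) = φ (Env.counit k A L D) := by
  induction D using Env.induction with
  | h1 => simp [Env.counit_one]
  | hadd x y hx hy => simp only [map_add, hx, hy]
  | hfn a x hx => simp [Env.counit_fn_mul, hx]
  | hvf l x hx => simp [Env.counit_vf_mul, hx, F.apply_lie]

/-- Two jets over `A` and over `A'` are compatible if they form a commutative square with the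
maps `U(A, L) → U(A', L')` and `A → A'`. -/
def Jet.Compat {φ : A →ₐ[k] A'} (F : LieRinehartAlgebra.Hom φ L L') (α : Jet k A L)
    (α' : Jet k A' L') : Prop :=
  ∀ D, φ (α.ofConv D) = α'.ofConv (Env.map F D)

namespace Jet.Compat

variable {φ : A →ₐ[k] A'} {F : LieRinehartAlgebra.Hom φ L L'} {α β : Jet k A L}
  {α' β' : Jet k A' L'}

lemma add (h : Compat F α α') (h' : Compat F β β') : Compat F (α + β) (α' + β') := fun D ↦ by
  rw [add_apply, add_apply, map_add, h D, h' D]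

lemma neg (h : Compat F α α') : Compat F (-α) (-α') := fun D ↦ by
  change φ (-(α.ofConv D)) = -(α'.ofConv (Env.map F D))
  rw [map_neg, h D]

lemma zero : Compat F (0 : Jet k A L) (0 : Jet k A' L') := fun _ ↦ map_zero φ

lemma of_algebraMap (a : A) :
    Compat F (algebraMap A (Jet k A L) a) (algebraMap A' (Jet k A' L') (φ a)) := fun D ↦ by
  rw [algebraMap_apply, algebraMap_apply, Env.counit_map, map_mul]

lemma one : Compat F (1 : Jet k A L) (1 : Jet k A' L') := fun D ↦ by
  rw [one_apply, one_apply, Env.counit_map]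

lemma mul (h : Compat F α α') (h' : Compat F β β') : Compat F (α * β) (α' * β') := fun D ↦ by
  rw [mul_apply, mul_apply, Env.comul_map]
  induction Env.comul k A L D using TensorProduct.induction_on with
  | zero => simp
  | tmul x y => rw [pair_tmul, Env.map₂_tmul, pair_tmul, map_mul, h x, h' y]
  | add x y hx hy => simp only [map_add, hx, hy]

lemma conn (h : Compat F α α') (l : L) : Compat F (conn l α) (Jet.conn (F l) α') := fun D ↦ by
  rw [conn_apply, conn_apply, map_sub, F.apply_lie, h D, h, map_mul, Env.map_vf]

end Jet.Compat

end Functoriality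

section Presheaf

variable {k : Type u} [Field k] {C : Type u} [SmallCategory C]

/-- A presheaf of Lie-Rinehart algebras over a presheaf of commutative `k`-algebras `O`: every
`L(U)` is a `k`-Lie algebra acting on `O(U)` and an `O(U)`-module, such that
`(f l)(g) = f l(g)`, `l(f g) = l(f) g + f l(g)`, `[l, m](f) = l(m(f)) - m(l(f))` and
`[l, f m] = l(f) m + f [l, m]`, and all of this is compatible with restriction. -/
structure LieAlgebroidPresheaf (O : Cᵒᵖ ⥤ CommAlgCat.{u} k) where
  /-- sections -/
  sec : Cᵒᵖ → Type u
  [lieRing : ∀ U, LieRing (sec U)]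
  [lieAlgebra : ∀ U, LieAlgebra k (sec U)]
  [module : ∀ U, Module (O.obj U) (sec U)]
  [action : ∀ U, LieRingModule (sec U) (O.obj U)]
  [rinehartRing : ∀ U, LieRinehartRing (O.obj U) (sec U)]
  [rinehartAlgebra : ∀ U, LieRinehartAlgebra k (O.obj U) (sec U)]
  /-- restriction maps -/
  res {U V : Cᵒᵖ} (f : U ⟶ V) : LieRinehartAlgebra.Hom (O.map f).hom (sec U) (sec V)
  res_id (U : Cᵒᵖ) (l : sec U) : res (𝟙 U) l = l
  res_comp {U V W : Cᵒᵖ} (f : U ⟶ V) (g : V ⟶ W) (l : sec U) : res (f ≫ g) l = res g (res f l)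

namespace LieAlgebroidPresheaf

attribute [instance] lieRing lieAlgebra module action rinehartRing rinehartAlgebra

variable {O : Cᵒᵖ ⥤ CommAlgCat.{u} k} (P : LieAlgebroidPresheaf O)

/-- The underlying presheaf of `k`-modules. -/
def toPresheaf : Cᵒᵖ ⥤ ModuleCat.{u} k where
  obj U := ModuleCat.of k (P.sec U)
  map f := ModuleCat.ofHom ((P.res f).toLieHom : P.sec _ →ₗ[k] P.sec _)
  map_id U := by ext l; exact P.res_id U l
  map_comp f g := by ext l; exact P.res_comp f g l

/-- The subring of compatible families of `O(V)`-linear maps `U(O(V), L(V)) → O(V)`, one for each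
`V → U`. -/
def jetSubring (U : Cᵒᵖ) :
    Subring ((V : Cᵒᵖ) → (U ⟶ V) → Jet k (O.obj V) (P.sec V)) where
  carrier := {α | ∀ ⦃V W : Cᵒᵖ⦄ (f : U ⟶ V) (g : V ⟶ W),
    Jet.Compat (P.res g) (α V f) (α W (f ≫ g))}
  mul_mem' h h' _ _ f g := (h f g).mul (h' f g)
  one_mem' _ _ _ _ := Jet.Compat.one
  add_mem' h h' _ _ f g := (h f g).add (h' f g)
  zero_mem' _ _ _ _ := Jet.Compat.zero
  neg_mem' h _ _ f g := (h f g).neg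

/-- The sections over `U` of the jet algebra `Hom_O(U L, O)`: morphisms of (pre)sheaves of
`O`-modules, defined over `U`, from the enveloping algebra to `O`. As `O` is a sheaf, it makes no
difference whether the presheaf `V ↦ U(O(V), L(V))` or its associated sheaf is used here. -/
def Jets (U : Cᵒᵖ) : Type u := P.jetSubring U

namespace Jets

variable {P}

instance (U : Cᵒᵖ) : CommRing (P.Jets U) := inferInstanceAs (CommRing (P.jetSubring U))

/-- The component at `f : V → U` of a jet over `U`. -/
def comp {U V : Cᵒᵖ} (α : P.Jets U) (f : U ⟶ V) : Jet k (O.obj V) (P.sec V) := α.1 V f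

@[ext] lemma ext {U : Cᵒᵖ} {α β : P.Jets U} (h : ∀ (V : Cᵒᵖ) (f : U ⟶ V), α.comp f = β.comp f) :
    α = β := Subtype.ext (by ext1 V; ext1 f; exact h V f)

variable {U V W : Cᵒᵖ}

lemma compat (α : P.Jets U) (f : U ⟶ V) (g : V ⟶ W) :
    Jet.Compat (P.res g) (α.comp f) (α.comp (f ≫ g)) := α.2 f g

@[simp] lemma comp_add (α β : P.Jets U) (f : U ⟶ V) : (α + β).comp f = α.comp f + β.comp f := rfl
@[simp] lemma comp_mul (α β : P.Jets U) (f : U ⟶ V) : (α * β).comp f = α.comp f * β.comp f := rfl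
@[simp] lemma comp_one (f : U ⟶ V) : (1 : P.Jets U).comp f = 1 := rfl
@[simp] lemma comp_zero (f : U ⟶ V) : (0 : P.Jets U).comp f = 0 := rfl

variable (P U) in
/-- The map `f ↦ f · 1` from functions to jets. -/
def unit : O.obj U →+* P.Jets U where
  toFun a := ⟨fun V f ↦ algebraMap (O.obj V) (Jet k (O.obj V) (P.sec V)) ((O.map f).hom a), by
    intro V W f g
    simp only [CategoryTheory.Functor.map_comp, CommAlgCat.hom_comp, AlgHom.comp_apply]
    exact Jet.Compat.of_algebraMap _⟩
  map_one' := by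
    refine ext fun V f ↦ ?_
    change algebraMap (O.obj V) (Jet k (O.obj V) (P.sec V)) _ = _
    rw [map_one, map_one]; rfl
  map_mul' a b := by
    refine ext fun V f ↦ ?_
    change algebraMap (O.obj V) (Jet k (O.obj V) (P.sec V)) _ = _
    rw [map_mul, map_mul]; rfl
  map_zero' := by
    refine ext fun V f ↦ ?_
    change algebraMap (O.obj V) (Jet k (O.obj V) (P.sec V)) _ = _
    rw [map_zero, map_zero]; rfl
  map_add' a b := by
    refine ext fun V f ↦ ?_
    change algebraMap (O.obj V) (Jet k (O.obj V) (P.sec V)) _ = _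
    rw [map_add, map_add]; rfl

instance : Algebra (O.obj U) (P.Jets U) := (unit P U).toAlgebra

instance : Algebra k (P.Jets U) := ((unit P U).comp (algebraMap k (O.obj U))).toAlgebra

instance : IsScalarTower k (O.obj U) (P.Jets U) := IsScalarTower.of_algebraMap_eq fun _ ↦ rfl

lemma comp_algebraMap (a : O.obj U) (f : U ⟶ V) : (algebraMap (O.obj U) (P.Jets U) a).comp f =
    algebraMap (O.obj V) (Jet k (O.obj V) (P.sec V)) ((O.map f).hom a) := rfl

/-- Restriction of jets. -/
def res (g : U ⟶ V) : P.Jets U →+* P.Jets V where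
  toFun α := ⟨fun W f ↦ α.comp (g ≫ f), fun W W' f f' ↦ by
    have := α.compat (g ≫ f) f'
    rwa [Category.assoc] at this⟩
  map_one' := rfl
  map_mul' _ _ := rfl
  map_zero' := rfl
  map_add' _ _ := rfl

@[simp] lemma comp_res (g : U ⟶ V) (f : V ⟶ W) (α : P.Jets U) :
    (res g α).comp f = α.comp (g ≫ f) := rfl

lemma res_algebraMap (g : U ⟶ V) (a : O.obj U) :
    res g (algebraMap (O.obj U) (P.Jets U) a) = algebraMap _ _ ((O.map g).hom a) := by
  refine ext fun W f ↦ ?_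
  rw [comp_res, comp_algebraMap, comp_algebraMap, CategoryTheory.Functor.map_comp]
  rfl

lemma res_id (α : P.Jets U) : res (𝟙 U) α = α := by
  refine ext fun W f ↦ ?_
  rw [comp_res, Category.id_comp]

lemma res_comp (f : U ⟶ V) (g : V ⟶ W) (α : P.Jets U) : res (f ≫ g) α = res g (res f α) := by
  refine ext fun W f ↦ ?_
  rw [comp_res, comp_res, comp_res, Category.assoc]

variable (P U) in
/-- The counit `ε(α) = α(1)`. -/
def counit : P.Jets U →ₐ[O.obj U] O.obj U where
  toFun α := (α.comp (𝟙 U)).ofConv 1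
  map_one' := Env.counit_one
  map_mul' α β := by rw [comp_mul, Jet.mul_apply, Env.comul_one, Jet.pair_tmul]
  map_zero' := rfl
  map_add' _ _ := rfl
  commutes' a := by
    rw [comp_algebraMap, Jet.algebraMap_apply, Env.counit_one, CategoryTheory.Functor.map_id, mul_one]
    rfl

lemma counit_apply (α : P.Jets U) : counit P U α = (α.comp (𝟙 U)).ofConv 1 := rfl

lemma counit_res (g : U ⟶ V) (α : P.Jets U) :
    counit P V (res g α) = (O.map g).hom (counit P U α) := by
  have := α.compat (𝟙 U) g 1
  rw [Category.id_comp] at this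
  rw [counit_apply, comp_res, Category.comp_id, counit_apply, this, map_one (Env.map (P.res g))]

/-- The Grothendieck connection on jets, `(∇_l α)(D) = l(α(D)) - α(l D)`. -/
def conn (l : P.sec U) : P.Jets U →+ P.Jets U where
  toFun α := ⟨fun V f ↦ Jet.conn (P.res f l) (α.comp f), fun V W f g ↦ by
    change Jet.Compat _ (Jet.conn (P.res f l) (α.comp f))
      (Jet.conn (P.res (f ≫ g) l) (α.comp (f ≫ g)))
    rw [P.res_comp]
    exact (α.compat f g).conn (P.res f l)⟩
  map_zero' := by
    refine ext fun V f ↦ ?_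
    have := Jet.conn_add (P.res f l) (0 : Jet k (O.obj V) (P.sec V)) 0
    rw [add_zero, left_eq_add] at this
    exact this
  map_add' α β := by refine ext fun V f ↦ ?_; exact Jet.conn_add ..

@[simp] lemma comp_conn (l : P.sec U) (f : U ⟶ V) (α : P.Jets U) :
    (conn l α).comp f = Jet.conn (P.res f l) (α.comp f) := rfl

lemma conn_mul (l : P.sec U) (α β : P.Jets U) :
    conn l (α * β) = conn l α * β + α * conn l β := by
  refine ext fun V f ↦ ?_; exact Jet.conn_mul ..

lemma conn_algebraMap (l : P.sec U) (a : O.obj U) :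
    conn l (algebraMap (O.obj U) (P.Jets U) a) = algebraMap (O.obj U) (P.Jets U) ⁅l, a⁆ := by
  refine ext fun V f ↦ ?_
  rw [comp_conn, comp_algebraMap, comp_algebraMap, Jet.conn_algebraMap]
  exact congrArg _ ((P.res f).apply_lie a l).symm

lemma conn_add_left (l m : P.sec U) (α : P.Jets U) : conn (l + m) α = conn l α + conn m α := by
  refine ext fun V f ↦ ?_
  rw [comp_conn, comp_add, map_add, Jet.conn_add_left]
  rfl

lemma conn_smul_left (a : O.obj U) (l : P.sec U) (α : P.Jets U) :
    conn (a • l) α = algebraMap (O.obj U) (P.Jets U) a * conn l α := by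
  refine ext fun V f ↦ ?_
  rw [comp_conn, comp_mul, comp_algebraMap, (P.res f).map_smul_apply, Jet.conn_smul_left,
    Algebra.smul_def]
  rfl

lemma res_conn (g : U ⟶ V) (l : P.sec U) (α : P.Jets U) :
    res g (conn l α) = conn (P.res g l) (res g α) := by
  refine ext fun W f ↦ ?_
  rw [comp_res, comp_conn, comp_conn, comp_res, P.res_comp]

end Jets

end LieAlgebroidPresheaf

end Presheaf

section TensorPower

variable (A R : Type u) [CommRing A] [CommRing R] [Algebra A R]

/-- The `n`-th tensor power over `A` of a commutative `A`-algebra `R`, as a commutative ring. -/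
abbrev TPow (n : ℕ) : Type u := ⨂[A] (_ : Fin n), R

namespace TPow

variable {A R} {n : ℕ}

/-- The map `r ↦ 1 ⊗ ⋯ ⊗ r ⊗ ⋯ ⊗ 1`. -/
def single (i : Fin n) : R →ₐ[A] TPow A R n :=
  PiTensorProduct.singleAlgHom (R := A) (A := fun _ : Fin n ↦ R) i

lemma single_apply (i : Fin n) (r : R) : (single i r : TPow A R n) =
    PiTensorProduct.tprod A (Pi.mulSingle i r) := rfl

lemma tprod_eq_prod (α : Fin n → R) :
    PiTensorProduct.tprod A α = ∏ i, (single i (α i) : TPow A R n) := by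
  simp only [single_apply]
  rw [← PiTensorProduct.tprod_prod]
  congr 1
  exact (Finset.univ_prod_mulSingle α).symm

/-- Ring homomorphisms out of a tensor power are given by ring homomorphisms out of the factors
that agree on `A`. -/
def lift {S : Type*} [CommRing S] (φ : A →+* S) (ψ : Fin n → R →+* S)
    (h : ∀ i a, ψ i (algebraMap A R a) = φ a) : TPow A R n →+* S :=
  letI := φ.toAlgebra
  (PiTensorProduct.liftAlgHom (R := A) (S := S)
    ((MultilinearMap.mkPiAlgebra A (Fin n) S).compLinearMap
      (fun i ↦ ({ ψ i with commutes' := h i } : R →ₐ[A] S).toLinearMap))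
    (by simp) (fun x y ↦ by simp [Finset.prod_mul_distrib])).toRingHom

lemma lift_tprod {S : Type*} [CommRing S] (φ : A →+* S) (ψ : Fin n → R →+* S)
    (h : ∀ i a, ψ i (algebraMap A R a) = φ a) (α : Fin n → R) :
    lift φ ψ h (PiTensorProduct.tprod A α) = ∏ i, ψ i (α i) := by
  let := φ.toAlgebra
  exact (PiTensorProduct.lift.tprod _).trans (by simp)

@[simp] lemma lift_algebraMap {S : Type*} [CommRing S] (φ : A →+* S) (ψ : Fin n → R →+* S)
    (h : ∀ i a, ψ i (algebraMap A R a) = φ a) (a : A) :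
    lift φ ψ h (algebraMap A (TPow A R n) a) = φ a := by
  let := φ.toAlgebra
  exact AlgHom.commutes (PiTensorProduct.liftAlgHom (R := A) (S := S) _ _ _) a

@[simp] lemma lift_single {S : Type*} [CommRing S] (φ : A →+* S) (ψ : Fin n → R →+* S)
    (h : ∀ i a, ψ i (algebraMap A R a) = φ a) (i : Fin n) (r : R) :
    lift φ ψ h (single (A := A) i r) = ψ i r := by
  rw [single_apply, lift_tprod, Finset.prod_eq_single i]
  · simp
  · intro j _ hj
    simp [hj]
  · simp

lemma hom_ext {S : Type*} [CommRing S] {f g : TPow A R n →+* S}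
    (h₀ : ∀ a, f (algebraMap A _ a) = g (algebraMap A _ a))
    (h₁ : ∀ i r, f (single (A := A) i r) = g (single (A := A) i r)) : f = g := by
  let := (f.comp (algebraMap A (TPow A R n))).toAlgebra
  let f' : TPow A R n →ₐ[A] S := { f with commutes' := fun _ ↦ rfl }
  let g' : TPow A R n →ₐ[A] S := { g with commutes' := fun a ↦ (h₀ a).symm }
  have : f' = g' := PiTensorProduct.algHom_ext fun i ↦ AlgHom.ext (h₁ i)
  exact RingHom.ext fun x ↦ DFunLike.congr_fun this x

section aug

variable (ε : R →ₐ[A] A)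

variable (n) in
/-- The augmentation `α₁ ⊗ ⋯ ⊗ αₙ ↦ ε(α₁) ⋯ ε(αₙ)`. -/
def aug : TPow A R n →+* A := lift (RingHom.id A) (fun _ ↦ ε) (fun _ a ↦ ε.commutes a)

@[simp] lemma aug_algebraMap (a : A) : aug n ε (algebraMap A (TPow A R n) a) = a :=
  lift_algebraMap ..

@[simp] lemma aug_single (i : Fin n) (r : R) : aug n ε (single (A := A) i r) = ε r :=
  lift_single ..

variable (n) in
/-- The augmentation ideal of the tensor power, that is, the ideal
`∑ᵢ R ⊗ ⋯ ⊗ ker ε ⊗ ⋯ ⊗ R`. -/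
def augIdeal : Ideal (TPow A R n) := RingHom.ker (aug n ε)

/-- For a map `σ : {1, …, a} → {1, …, b} ∪ {none}`, the ring homomorphism which multiplies the
factors `αᵢ` with `σ i = j` into the `j`-th factor and replaces every `αᵢ` with `σ i = none` by
the scalar `ε(αᵢ)`. -/
def map {a b : ℕ} (σ : Fin a → Option (Fin b)) : TPow A R a →+* TPow A R b :=
  lift (algebraMap A _)
    (fun i ↦ (σ i).elim ((algebraMap A (TPow A R b)).comp ε.toRingHom)
      (fun j ↦ (single (A := A) j).toRingHom))
    (fun i a ↦ by
      cases σ i with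
      | none => simp
      | some j => exact (single j).commutes a)

lemma map_algebraMap {a b : ℕ} (σ : Fin a → Option (Fin b)) (x : A) :
    map ε σ (algebraMap A _ x) = algebraMap A _ x := lift_algebraMap ..

lemma map_single {a b : ℕ} (σ : Fin a → Option (Fin b)) (i : Fin a) (r : R) :
    map ε σ (single (A := A) i r) =
      (σ i).elim (algebraMap A (TPow A R b) (ε r)) (fun j ↦ single (A := A) j r) := by
  rw [map, lift_single]
  cases σ i <;> rfl

/-- The effect of `map ε σ` on pure tensors. -/
lemma map_tprod {a b : ℕ} (σ : Fin a → Option (Fin b)) (α : Fin a → R) :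
    map ε σ (PiTensorProduct.tprod A α) =
      (∏ i with σ i = none, ε (α i)) •
        PiTensorProduct.tprod A (fun j ↦ ∏ i with σ i = some j, α i) := by
  rw [tprod_eq_prod, map_prod, tprod_eq_prod, Algebra.smul_def]
  simp only [map_single, map_prod]
  simp only [Finset.prod_filter]
  rw [Finset.prod_comm, ← Finset.prod_mul_distrib]
  refine Finset.prod_congr rfl fun i _ ↦ ?_
  cases h : σ i with
  | none => simp
  | some j => simp

lemma map_comp {a b c : ℕ} (σ : Fin a → Option (Fin b)) (τ : Fin b → Option (Fin c)) :
    (map ε τ).comp (map ε σ) = map ε (fun i ↦ (σ i).bind τ) := by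
  refine hom_ext (fun x ↦ ?_) fun i r ↦ ?_
  · simp only [RingHom.comp_apply, map_algebraMap]
  · simp only [RingHom.comp_apply, map_single]
    cases h : σ i with
    | none => simp [map_algebraMap]
    | some j => simp only [Option.elim_some, Option.bind_some, map_single]

lemma aug_map {a b : ℕ} (σ : Fin a → Option (Fin b)) : (aug b ε).comp (map ε σ) = aug a ε := by
  refine hom_ext (fun x ↦ ?_) fun i r ↦ ?_
  · simp only [RingHom.comp_apply, map_algebraMap, aug_algebraMap]
  · simp only [RingHom.comp_apply, map_single]
    cases h : σ i with
    | none => simp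
    | some j => simp

lemma augIdeal_le_map {a b : ℕ} (σ : Fin a → Option (Fin b)) :
    augIdeal a ε ≤ (augIdeal b ε).comap (map ε σ) := fun x hx ↦ by
  have := RingHom.congr_fun (aug_map ε σ) x
  exact this.trans hx

end aug

section res

variable {A' R' : Type u} [CommRing A'] [CommRing R'] [Algebra A' R'] (ρ : A →+* A') (r : R →+* R')
  (h : ∀ a, r (algebraMap A R a) = algebraMap A' R' (ρ a))

variable (n) in
/-- The map of tensor powers induced by a map of algebras. -/
def res : TPow A R n →+* TPow A' R' n :=
  lift ((algebraMap A' (TPow A' R' n)).comp ρ) (fun i ↦ (single (A := A') i).toRingHom.comp r)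
    (fun i a ↦ by
      change single (A := A') i (r _) = algebraMap A' _ (ρ a)
      rw [h]
      exact (single i).commutes _)

@[simp] lemma res_algebraMap (a : A) :
    res n ρ r h (algebraMap A _ a) = algebraMap A' _ (ρ a) := lift_algebraMap ..

@[simp] lemma res_single (i : Fin n) (x : R) :
    res n ρ r h (single (A := A) i x) = single (A := A') i (r x) := lift_single ..

lemma aug_res (ε : R →ₐ[A] A) (ε' : R' →ₐ[A'] A') (hε : ∀ x, ε' (r x) = ρ (ε x)) :
    (aug n ε').comp (res n ρ r h) = ρ.comp (aug n ε) := by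
  refine hom_ext (fun x ↦ ?_) fun i r ↦ ?_
  · simp
  · simp [hε]

lemma augIdeal_le_res (ε : R →ₐ[A] A) (ε' : R' →ₐ[A'] A') (hε : ∀ x, ε' (r x) = ρ (ε x)) :
    augIdeal n ε ≤ (augIdeal n ε').comap (res n ρ r h) := fun x hx ↦ by
  have h' := RingHom.congr_fun (aug_res (n := n) ρ r h ε ε' hε) x
  rw [RingHom.comp_apply, RingHom.comp_apply, (RingHom.mem_ker).mp hx, map_zero] at h'
  exact h'

lemma res_map (ε : R →ₐ[A] A) (ε' : R' →ₐ[A'] A') (hε : ∀ x, ε' (r x) = ρ (ε x)) {a b : ℕ}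
    (σ : Fin a → Option (Fin b)) :
    (res b ρ r h).comp (map ε σ) = (map ε' σ).comp (res a ρ r h) := by
  refine hom_ext (fun x ↦ ?_) fun i r ↦ ?_
  · simp [map_algebraMap]
  · simp only [RingHom.comp_apply, res_single, map_single]
    cases h : σ i with
    | none => simp [hε]
    | some j => simp only [Option.elim_some, res_single]

end res

section deriv

/-- A derivation along a ring homomorphism, as a ring homomorphism to the dual numbers. -/
def dualHom {B T : Type*} [CommRing B] [CommRing T] (f : B →+* T) (d : B →+ T)
    (h : ∀ x y, d (x * y) = d x * f y + f x * d y) : B →+* TrivSqZeroExt T T where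
  toFun x := .inl (f x) + .inr (d x)
  map_one' := by
    have : d 1 = 0 := by simpa using h 1 1
    simp [this]
  map_mul' x y := by
    ext
    · simp
    · simp [h]; ring
  map_zero' := by simp
  map_add' x y := by
    ext <;> simp

lemma fst_dualHom {B T : Type*} [CommRing B] [CommRing T] (f : B →+* T) (d : B →+ T)
    (h : ∀ x y, d (x * y) = d x * f y + f x * d y) (x : B) : (dualHom f d h x).fst = f x := by
  simp [dualHom]

lemma snd_dualHom {B T : Type*} [CommRing B] [CommRing T] (f : B →+* T) (d : B →+ T)
    (h : ∀ x y, d (x * y) = d x * f y + f x * d y) (x : B) : (dualHom f d h x).snd = d x := by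
  simp [dualHom]

lemma single_leibniz (d : R →+ R) (hd : ∀ x y, d (x * y) = d x * y + x * d y) (i : Fin n)
    (x y : R) : (single (A := A) i).toRingHom.toAddMonoidHom.comp d (x * y) =
      (single (A := A) i).toRingHom.toAddMonoidHom.comp d x * (single (A := A) i).toRingHom y +
      (single (A := A) i).toRingHom x * (single (A := A) i).toRingHom.toAddMonoidHom.comp d y := by
  change single (A := A) i _ = single (A := A) i _ * single (A := A) i _ +
    single (A := A) i _ * single (A := A) i _
  rw [hd, map_add, map_mul, map_mul]

variable (δ : A →+ A) (d : R →+ R) (hδ : ∀ x y, δ (x * y) = δ x * y + x * δ y)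
  (hd : ∀ x y, d (x * y) = d x * y + x * d y)
  (h : ∀ a, d (algebraMap A R a) = algebraMap A R (δ a))

variable (n) in
/-- The ring homomorphism `x ↦ x + η D(x)` to the dual numbers, where `D` is the derivation of the
tensor power induced by `d`. -/
def derivHom : TPow A R n →+* TrivSqZeroExt (TPow A R n) (TPow A R n) :=
  lift (dualHom (algebraMap A (TPow A R n)) ((algebraMap A (TPow A R n)).toAddMonoidHom.comp δ)
      (fun x y ↦ by simp [hδ]))
    (fun i ↦ dualHom (single (A := A) i).toRingHom
      ((single (A := A) i).toRingHom.toAddMonoidHom.comp d)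
      (single_leibniz d hd i))
    (fun i a ↦ by
      ext
      · simp only [fst_dualHom]; exact (single i).commutes a
      · simp only [snd_dualHom]
        change single (A := A) i (d _) = algebraMap A _ (δ a)
        rw [h]
        exact (single i).commutes _)

lemma fst_derivHom (x : TPow A R n) : (derivHom n δ d hδ hd h x).fst = x := by
  have : (TrivSqZeroExt.fstHom (TPow A R n) (TPow A R n) (TPow A R n)).toRingHom.comp
      (derivHom n δ d hδ hd h) = RingHom.id _ := by
    refine hom_ext (fun x ↦ ?_) fun i r ↦ ?_
    · simp only [RingHom.comp_apply, derivHom, lift_algebraMap]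
      exact fst_dualHom (algebraMap A (TPow A R n)) _ (fun x y ↦ by simp [hδ]) x
    · simp only [RingHom.comp_apply, derivHom, lift_single]
      exact fst_dualHom (single (A := A) i).toRingHom _ (single_leibniz d hd i) r
  exact RingHom.congr_fun this x

variable (n) in
/-- The derivation of the tensor power induced by `d` by the Leibniz rule. -/
def deriv : TPow A R n →+ TPow A R n where
  toFun x := (derivHom n δ d hδ hd h x).snd
  map_zero' := by simp
  map_add' x y := by simp

lemma deriv_mul (x y : TPow A R n) : deriv n δ d hδ hd h (x * y) =
    deriv n δ d hδ hd h x * y + x * deriv n δ d hδ hd h y := by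
  simp only [deriv, AddMonoidHom.coe_mk, ZeroHom.coe_mk, map_mul, TrivSqZeroExt.snd_mul,
    fst_derivHom, smul_eq_mul, MulOpposite.smul_eq_mul_unop, MulOpposite.unop_op]
  ring

lemma deriv_algebraMap (a : A) : deriv n δ d hδ hd h (algebraMap A _ a) =
    algebraMap A _ (δ a) := by
  simp only [deriv, AddMonoidHom.coe_mk, ZeroHom.coe_mk, derivHom, lift_algebraMap]
  exact snd_dualHom ..

lemma deriv_single (i : Fin n) (r : R) : deriv n δ d hδ hd h (single (A := A) i r) =
    single (A := A) i (d r) := by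
  simp only [deriv, AddMonoidHom.coe_mk, ZeroHom.coe_mk, derivHom, lift_single]
  exact snd_dualHom ..

lemma deriv_ext {S : Type*} [CommRing S] (f : TPow A R n →+* S) {D E : TPow A R n →+ S}
    (hD : ∀ x y, D (x * y) = D x * f y + f x * D y) (hE : ∀ x y, E (x * y) = E x * f y + f x * E y)
    (h₀ : ∀ a, D (algebraMap A _ a) = E (algebraMap A _ a))
    (h₁ : ∀ i r, D (single (A := A) i r) = E (single (A := A) i r)) : D = E := by
  have : dualHom f D hD = dualHom f E hE := by
    refine hom_ext (fun x ↦ ?_) fun i r ↦ ?_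
    · ext
      · simp only [fst_dualHom]
      · simp only [snd_dualHom, h₀]
    · ext
      · simp only [fst_dualHom]
      · simp only [snd_dualHom, h₁]
  ext x
  rw [← snd_dualHom f D hD, this, snd_dualHom]

lemma deriv_prod {ι : Type*} [DecidableEq ι] (s : Finset ι) (x : ι → TPow A R n) :
    deriv n δ d hδ hd h (∏ i ∈ s, x i) =
      ∑ i ∈ s, (∏ j ∈ s.erase i, x j) * deriv n δ d hδ hd h (x i) := by
  induction s using Finset.induction_on with
  | empty =>
    have := deriv_mul δ d hδ hd h (1 : TPow A R n) 1
    simpa using this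
  | insert a s ha ih =>
    rw [Finset.prod_insert ha, deriv_mul, Finset.sum_insert ha, ih, Finset.erase_insert ha,
      mul_comm, Finset.mul_sum]
    congr 1
    refine Finset.sum_congr rfl fun i hi ↦ ?_
    have hne : a ≠ i := fun e ↦ ha (e ▸ hi)
    rw [Finset.erase_insert_of_ne hne, Finset.prod_insert (fun e ↦ ha (Finset.mem_of_mem_erase e)),
      mul_assoc]

/-- The Leibniz rule on pure tensors. -/
lemma deriv_tprod (α : Fin n → R) :
    deriv n δ d hδ hd h (PiTensorProduct.tprod A α) =
      ∑ i, PiTensorProduct.tprod A (Function.update α i (d (α i))) := by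
  rw [tprod_eq_prod, deriv_prod]
  refine Finset.sum_congr rfl fun i _ ↦ ?_
  rw [deriv_single, tprod_eq_prod, ← Finset.prod_erase_mul _ _ (Finset.mem_univ i)]
  congr 1
  · refine Finset.prod_congr rfl fun j hj ↦ ?_
    rw [Function.update_of_ne (Finset.ne_of_mem_erase hj)]
  · rw [Function.update_self]

lemma deriv_mem (I : Ideal (TPow A R n)) (m : ℕ) {x : TPow A R n} (hx : x ∈ I ^ (m + 1)) :
    deriv n δ d hδ hd h x ∈ I ^ m := by
  induction m generalizing x with
  | zero => simp
  | succ m ih =>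
    rw [pow_succ] at hx
    refine Submodule.mul_induction_on hx (fun a ha b hb ↦ ?_) (fun a b ha hb ↦ ?_)
    · rw [deriv_mul]
      refine Ideal.add_mem _ ?_ (Ideal.mul_mem_right _ _ ha)
      rw [pow_succ]
      exact Ideal.mul_mem_mul (ih ha) hb
    · rw [map_add]
      exact Ideal.add_mem _ ha hb

end deriv

end TPow

end TensorPower

section Truncation

variable {k : Type u} [Field k] {C : Type u} [SmallCategory C]
  {O : Cᵒᵖ ⥤ CommAlgCat.{u} k} (P : LieAlgebroidPresheaf O)

namespace LieAlgebroidPresheaf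

/-- The `n`-th tensor power over `O(U)` of the jet algebra. -/
abbrev PolyJets (n : ℕ) (U : Cᵒᵖ) : Type u := TPow (O.obj U) (P.Jets U) n

namespace PolyJets

variable {U V : Cᵒᵖ}

lemma algebraMap_eq (n : ℕ) (c : k) :
    algebraMap k (P.PolyJets n U) c = algebraMap (O.obj U) _ (algebraMap k (O.obj U) c) :=
  IsScalarTower.algebraMap_apply k (O.obj U) (P.PolyJets n U) c

/-- The augmentation ideal: the kernel of `α₁ ⊗ ⋯ ⊗ αₙ ↦ ε(α₁) ⋯ ε(αₙ)`. -/
def ideal (n : ℕ) (U : Cᵒᵖ) : Ideal (P.PolyJets n U) := TPow.augIdeal n (Jets.counit P U)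

/-- Restriction `α₁ ⊗ ⋯ ⊗ αₙ ↦ α₁|_V ⊗ ⋯ ⊗ αₙ|_V`. -/
def res (n : ℕ) (g : U ⟶ V) : P.PolyJets n U →ₐ[k] P.PolyJets n V :=
  { TPow.res n (O.map g).hom.toRingHom (Jets.res (P := P) g) (Jets.res_algebraMap g) with
    commutes' := fun c ↦ by
      rw [algebraMap_eq, algebraMap_eq]
      refine (TPow.res_algebraMap ..).trans ?_
      exact congrArg _ ((O.map g).hom.commutes c) }

lemma res_algebraMap (n : ℕ) (g : U ⟶ V) (a : O.obj U) :
    res P n g (algebraMap (O.obj U) _ a) = algebraMap (O.obj V) _ ((O.map g).hom a) :=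
  TPow.res_algebraMap (h := Jets.res_algebraMap g) ..

lemma res_single (n : ℕ) (g : U ⟶ V) (i : Fin n) (α : P.Jets U) :
    res P n g (TPow.single (A := O.obj U) i α) = TPow.single (A := O.obj V) i (Jets.res g α) :=
  TPow.res_single (h := Jets.res_algebraMap g) ..

lemma ideal_le_res (n : ℕ) (g : U ⟶ V) : ideal P n U ≤ (ideal P n V).comap (res P n g) :=
  TPow.augIdeal_le_res (O.map g).hom.toRingHom (Jets.res (P := P) g) (Jets.res_algebraMap g)
    (Jets.counit P U) (Jets.counit P V) (Jets.counit_res g)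

/-- Contraction of tensor factors along a map `σ : {1, …, a} → {1, …, b} ∪ {none}`: the factors
`αᵢ` with `σ i = j` are multiplied into the `j`-th factor, and the factors `αᵢ` with
`σ i = none` are replaced by the scalars `ε(αᵢ)`. -/
def contract {a b : ℕ} (σ : Fin a → Option (Fin b)) (U : Cᵒᵖ) :
    P.PolyJets a U →ₐ[k] P.PolyJets b U :=
  { TPow.map (Jets.counit P U) σ with
    commutes' := fun c ↦ by
      rw [algebraMap_eq, algebraMap_eq]
      exact TPow.map_algebraMap .. }

lemma contract_tprod {a b : ℕ} (σ : Fin a → Option (Fin b)) (U : Cᵒᵖ) (α : Fin a → P.Jets U) :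
    contract P σ U (PiTensorProduct.tprod (O.obj U) α) =
      algebraMap (O.obj U) _ (∏ i with σ i = none, Jets.counit P U (α i)) *
        PiTensorProduct.tprod (O.obj U) (fun j ↦ ∏ i with σ i = some j, α i) := by
  rw [← Algebra.smul_def]
  exact TPow.map_tprod (Jets.counit P U) σ α

lemma contract_contract {a b c : ℕ} (σ : Fin a → Option (Fin b)) (τ : Fin b → Option (Fin c))
    (x : P.PolyJets a U) :
    contract P τ U (contract P σ U x) = contract P (fun i ↦ (σ i).bind τ) U x :=
  RingHom.congr_fun (TPow.map_comp (Jets.counit P U) σ τ) x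

lemma ideal_le_contract {a b : ℕ} (σ : Fin a → Option (Fin b)) (U : Cᵒᵖ) :
    ideal P a U ≤ (ideal P b U).comap (contract P σ U) := TPow.augIdeal_le_map _ σ

lemma res_contract {a b : ℕ} (σ : Fin a → Option (Fin b)) (g : U ⟶ V) (x : P.PolyJets a U) :
    res P b g (contract P σ U x) = contract P σ V (res P a g x) :=
  RingHom.congr_fun (TPow.res_map (O.map g).hom.toRingHom (Jets.res (P := P) g)
    (Jets.res_algebraMap g) (Jets.counit P U) (Jets.counit P V) (Jets.counit_res g) σ) x

/-- The Grothendieck connection on tensor powers, defined by the Leibniz rule. -/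
def conn (n : ℕ) (l : P.sec U) : P.PolyJets n U →+ P.PolyJets n U :=
  TPow.deriv n (Env.lieA l) (Jets.conn l)
    (fun x y ↦ by
      simp only [Env.lieA_apply, LieRinehartRing.leibniz_mul_right, smul_eq_mul]; ring)
    (Jets.conn_mul l) (Jets.conn_algebraMap l)

lemma conn_tprod (n : ℕ) (l : P.sec U) (α : Fin n → P.Jets U) :
    conn P n l (PiTensorProduct.tprod (O.obj U) α) =
      ∑ i, PiTensorProduct.tprod (O.obj U) (Function.update α i (Jets.conn l (α i))) :=
  TPow.deriv_tprod ..

lemma conn_mul (n : ℕ) (l : P.sec U) (x y : P.PolyJets n U) :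
    conn P n l (x * y) = conn P n l x * y + x * conn P n l y := TPow.deriv_mul ..

lemma conn_algebraMap (n : ℕ) (l : P.sec U) (a : O.obj U) :
    conn P n l (algebraMap (O.obj U) _ a) = algebraMap (O.obj U) _ ⁅l, a⁆ :=
  TPow.deriv_algebraMap ..

lemma conn_single (n : ℕ) (l : P.sec U) (i : Fin n) (α : P.Jets U) :
    conn P n l (TPow.single (A := O.obj U) i α) = TPow.single (A := O.obj U) i (Jets.conn l α) :=
  TPow.deriv_single ..

lemma conn_smul (n : ℕ) (l : P.sec U) (c : k) (x : P.PolyJets n U) :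
    conn P n l (c • x) = c • conn P n l x := by
  have : ⁅l, algebraMap k (O.obj U) c⁆ = 0 := by
    rw [Algebra.algebraMap_eq_smul_one, LieModule.lie_smul c l (1 : O.obj U), lie_one, smul_zero]
  rw [Algebra.smul_def, conn_mul, algebraMap_eq, conn_algebraMap, this, map_zero, zero_mul,
    zero_add, ← algebraMap_eq, ← Algebra.smul_def]

lemma conn_add_left (n : ℕ) (l m : P.sec U) (x : P.PolyJets n U) :
    conn P n (l + m) x = conn P n l x + conn P n m x := by
  refine DFunLike.congr_fun (TPow.deriv_ext (RingHom.id _) (D := conn P n (l + m))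
    (E := conn P n l + conn P n m) (conn_mul P n (l + m)) (fun x y ↦ ?_) (fun a ↦ ?_)
    fun i r ↦ ?_) x
  · simp only [AddMonoidHom.add_apply, conn_mul, RingHom.id_apply]; ring
  · simp only [AddMonoidHom.add_apply, conn_algebraMap, ← map_add, add_lie]
  · simp only [AddMonoidHom.add_apply, conn_single, ← map_add, Jets.conn_add_left]

lemma conn_smul_left (n : ℕ) (c : k) (l : P.sec U) (x : P.PolyJets n U) :
    conn P n (c • l) x = c • conn P n l x := by
  refine DFunLike.congr_fun (TPow.deriv_ext (RingHom.id _) (D := conn P n (c • l))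
    (E := (DistribSMul.toAddMonoidHom _ c).comp (conn P n l)) (conn_mul P n (c • l)) 
    (fun x y ↦ ?_) (fun a ↦ ?_) fun i r ↦ ?_) x
  · simp only [AddMonoidHom.comp_apply, DistribSMul.toAddMonoidHom_apply, conn_mul,
      RingHom.id_apply, smul_add, smul_mul_assoc, mul_smul_comm]
  · simp only [AddMonoidHom.comp_apply, DistribSMul.toAddMonoidHom_apply, conn_algebraMap]
    rw [LieModule.smul_lie c l (a : O.obj U), Algebra.smul_def, Algebra.smul_def, map_mul,
      algebraMap_eq]
  · simp only [AddMonoidHom.comp_apply, DistribSMul.toAddMonoidHom_apply, conn_single]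
    rw [← algebraMap_smul (O.obj U) c l, Jets.conn_smul_left, map_mul, Algebra.smul_def,
      algebraMap_eq]
    congr 1
    exact (TPow.single i).commutes _

lemma res_conn (n : ℕ) (g : U ⟶ V) (l : P.sec U) (x : P.PolyJets n U) :
    res P n g (conn P n l x) = conn P n (P.res g l) (res P n g x) := by
  refine DFunLike.congr_fun (TPow.deriv_ext (res P n g).toRingHom
    (D := (res P n g).toRingHom.toAddMonoidHom.comp (conn P n l))
    (E := (conn P n (P.res g l)).comp (res P n g).toRingHom.toAddMonoidHom)
    (fun x y ↦ ?_) (fun x y ↦ ?_) (fun a ↦ ?_) fun i r ↦ ?_) x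
  · change res P n g (conn P n l (x * y)) = res P n g (conn P n l x) * res P n g y +
      res P n g x * res P n g (conn P n l y)
    rw [conn_mul, map_add, map_mul, map_mul]
  · change conn P n (P.res g l) (res P n g (x * y)) = 
      conn P n (P.res g l) (res P n g x) * res P n g y +
      res P n g x * conn P n (P.res g l) (res P n g y)
    rw [map_mul, conn_mul]
  · change res P n g (conn P n l _) = conn P n (P.res g l) (res P n g _)
    rw [conn_algebraMap, res_algebraMap, res_algebraMap, conn_algebraMap]
    exact congrArg _ ((P.res g).apply_lie a l)
  · change res P n g (conn P n l _) = conn P n (P.res g l) (res P n g _)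
    rw [conn_single, res_single, res_single, conn_single, Jets.res_conn]

/-- The Grothendieck connection commutes with multiplication of tensor factors. -/
lemma contract_conn {a b : ℕ} (σ : Fin a → Fin b) (l : P.sec U) (x : P.PolyJets a U) :
    contract P (fun i ↦ some (σ i)) U (conn P a l x) =
      conn P b l (contract P (fun i ↦ some (σ i)) U x) := by
  set f := contract P (fun i ↦ some (σ i)) U with hf
  have h₁ (a' : O.obj U) : f (algebraMap (O.obj U) _ a') = algebraMap (O.obj U) _ a' :=
    TPow.map_algebraMap (Jets.counit P U) (fun i ↦ some (σ i)) a'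
  have h₂ (i : Fin a) (r : P.Jets U) : f (TPow.single (A := O.obj U) i r) =
    TPow.single (A := O.obj U) (σ i) r :=
    TPow.map_single (Jets.counit P U) (fun i ↦ some (σ i)) i r
  refine DFunLike.congr_fun (TPow.deriv_ext f.toRingHom
    (D := f.toRingHom.toAddMonoidHom.comp (conn P a l))
    (E := (conn P b l).comp f.toRingHom.toAddMonoidHom)
    (fun x y ↦ ?_) (fun x y ↦ ?_) (fun a ↦ ?_) fun i r ↦ ?_) x
  · change f (conn P a l (x * y)) = f (conn P a l x) * f y + f x * f (conn P a l y)
    rw [conn_mul, map_add, map_mul, map_mul]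
  · change conn P b l (f (x * y)) = conn P b l (f x) * f y + f x * conn P b l (f y)
    rw [map_mul, conn_mul]
  · change f (conn P _ l _) = conn P b l (f _)
    rw [conn_algebraMap, h₁, h₁, conn_algebraMap]
  · change f (conn P _ l _) = conn P b l (f _)
    rw [conn_single, h₂, h₂, conn_single]

lemma conn_mem (n m : ℕ) (l : P.sec U) {x : P.PolyJets n U} (hx : x ∈ ideal P n U ^ (m + 1)) :
    conn P n l x ∈ ideal P n U ^ m := TPow.deriv_mem _ _ _ _ _ _ _ hx

lemma res_id (n : ℕ) (x : P.PolyJets n U) : res P n (𝟙 U) x = x := by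
  have : (res P n (𝟙 U)).toRingHom = RingHom.id _ := by
    refine TPow.hom_ext (fun a ↦ ?_) fun i r ↦ ?_
    · refine (res_algebraMap ..).trans ?_
      rw [CategoryTheory.Functor.map_id]
      rfl
    · refine (res_single ..).trans ?_
      rw [Jets.res_id]
      rfl
  exact RingHom.congr_fun this x

lemma res_comp (n : ℕ) {W : Cᵒᵖ} (f : U ⟶ V) (g : V ⟶ W) (x : P.PolyJets n U) :
    res P n (f ≫ g) x = res P n g (res P n f x) := by
  have : (res P n (f ≫ g)).toRingHom = (res P n g).toRingHom.comp (res P n f).toRingHom := by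
    refine TPow.hom_ext (fun a ↦ ?_) fun i r ↦ ?_
    · refine (res_algebraMap ..).trans ?_
      change _ = res P n g (res P n f _)
      rw [res_algebraMap, res_algebraMap, CategoryTheory.Functor.map_comp]
      rfl
    · refine (res_single ..).trans ?_
      change _ = res P n g (res P n f _)
      rw [res_single, res_single, Jets.res_comp]
  exact RingHom.congr_fun this x

end PolyJets

end LieAlgebroidPresheaf

end Truncation

section Sheaves

variable {k : Type u} [Field k] {C : Type u} [SmallCategory C]

/-- The presheaf of morphisms from `F` to `G` with its `k`-module structure: its sections over `U`
are the natural transformations between the restrictions of `F` and `G` to the slice over `U`. -/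
def ihom (F G : Cᵒᵖ ⥤ ModuleCat.{u} k) : Cᵒᵖ ⥤ ModuleCat.{u} k where
  obj U := ModuleCat.of k
    ((Over.forget U.unop).op ⋙ F ⟶ (Over.forget U.unop).op ⋙ G)
  map f := ModuleCat.ofHom
    { toFun := fun φ ↦ (presheafHom F G).map f φ
      map_add' := fun _ _ ↦ rfl
      map_smul' := fun _ _ ↦ rfl }
  map_id U := by
    ext φ : 2
    exact ConcreteCategory.congr_hom ((presheafHom F G).map_id U) φ
  map_comp f g := by
    ext φ : 2
    exact ConcreteCategory.congr_hom ((presheafHom F G).map_comp f g) φ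

lemma ihom_isSheaf {J : GrothendieckTopology C} (F G : Cᵒᵖ ⥤ ModuleCat.{u} k)
    (hG : Presheaf.IsSheaf J G) : Presheaf.IsSheaf J (ihom F G) := by
  rw [Presheaf.isSheaf_iff_isSheaf_forget J _ (forget (ModuleCat.{u} k))]
  exact Presheaf.IsSheaf.hom F G hG

/-- Functoriality of `ihom` in the target. -/
def ihomMap (F : Cᵒᵖ ⥤ ModuleCat.{u} k) {G G' : Cᵒᵖ ⥤ ModuleCat.{u} k} (η : G ⟶ G') :
    ihom F G ⟶ ihom F G' where
  app U := ModuleCat.ofHom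
    { toFun := fun φ ↦ φ ≫ Functor.whiskerLeft _ η
      map_add' := fun _ _ ↦ Preadditive.add_comp ..
      map_smul' := fun _ _ ↦ Linear.smul_comp .. }
  naturality U V f := by
    ext φ : 2
    rfl

lemma ihomMap_comp (F : Cᵒᵖ ⥤ ModuleCat.{u} k) {G G' G'' : Cᵒᵖ ⥤ ModuleCat.{u} k} (η : G ⟶ G')
    (θ : G' ⟶ G'') : ihomMap F η ≫ ihomMap F θ = ihomMap F (η ≫ θ) := rfl

/-- The sheaf of morphisms from a presheaf to a sheaf. -/
def sheafIhom (J : GrothendieckTopology C) (F : Cᵒᵖ ⥤ ModuleCat.{u} k)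
    (G : Sheaf J (ModuleCat.{u} k)) : Sheaf J (ModuleCat.{u} k) :=
  ⟨ihom F G.obj, ihom_isSheaf F G.obj G.property⟩

variable {O : Cᵒᵖ ⥤ CommAlgCat.{u} k} (P : LieAlgebroidPresheaf O)

namespace LieAlgebroidPresheaf

/-- The quotient `J(U)^{⊗ n} / I^m`, where `I` is the augmentation ideal. -/
def TruncJets (n m : ℕ) (U : Cᵒᵖ) : Type u := P.PolyJets n U ⧸ PolyJets.ideal P n U ^ m

namespace TruncJets

instance (n m : ℕ) (U : Cᵒᵖ) : AddCommGroup (P.TruncJets n m U) :=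
  inferInstanceAs (AddCommGroup (P.PolyJets n U ⧸ PolyJets.ideal P n U ^ m))

instance (n m : ℕ) (U : Cᵒᵖ) : Module k (P.TruncJets n m U) :=
  inferInstanceAs (Module k (P.PolyJets n U ⧸ PolyJets.ideal P n U ^ m))

/-- The class of an element of `J(U)^{⊗ n}`. -/
def mk (n m : ℕ) (U : Cᵒᵖ) : P.PolyJets n U →ₗ[k] P.TruncJets n m U :=
  (Ideal.Quotient.mkₐ k (PolyJets.ideal P n U ^ m)).toLinearMap

/-- Restriction. -/
def res (n m : ℕ) {U V : Cᵒᵖ} (g : U ⟶ V) : P.TruncJets n m U →ₗ[k] P.TruncJets n m V :=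
  (Ideal.quotientMapₐ (PolyJets.ideal P n V ^ m) (PolyJets.res P n g)
    ((Ideal.pow_right_mono (PolyJets.ideal_le_res P n g) m).trans
      (Ideal.le_comap_pow _ m))).toLinearMap

lemma res_mk (n m : ℕ) {U V : Cᵒᵖ} (g : U ⟶ V) (x : P.PolyJets n U) :
    res P n m g (mk P n m U x) = mk P n m V (PolyJets.res P n g x) := rfl

/-- Contraction of tensor factors. -/
def contract {a b : ℕ} (m : ℕ) (σ : Fin a → Option (Fin b)) (U : Cᵒᵖ) :
    P.TruncJets a m U →ₗ[k] P.TruncJets b m U :=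
  (Ideal.quotientMapₐ (PolyJets.ideal P b U ^ m) (PolyJets.contract P σ U)
    ((Ideal.pow_right_mono (PolyJets.ideal_le_contract P σ U) m).trans
      (Ideal.le_comap_pow _ m))).toLinearMap

lemma contract_mk {a b : ℕ} (m : ℕ) (σ : Fin a → Option (Fin b)) (U : Cᵒᵖ)
    (x : P.PolyJets a U) :
    contract P m σ U (mk P a m U x) = mk P b m U (PolyJets.contract P σ U x) := rfl

/-- The projection from level `m` to a lower level `m'`. -/
def factor (n : ℕ) {m m' : ℕ} (h : m' ≤ m) (U : Cᵒᵖ) :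
    P.TruncJets n m U →ₗ[k] P.TruncJets n m' U :=
  (Ideal.Quotient.factorₐ k (Ideal.pow_le_pow_right h :
    PolyJets.ideal P n U ^ m ≤ PolyJets.ideal P n U ^ m')).toLinearMap

lemma factor_mk (n : ℕ) {m m' : ℕ} (h : m' ≤ m) (U : Cᵒᵖ) (x : P.PolyJets n U) :
    factor P n h U (mk P n m U x) = mk P n m' U x := rfl

lemma mk_surjective (n m : ℕ) (U : Cᵒᵖ) : Function.Surjective (mk P n m U) :=
  Ideal.Quotient.mk_surjective

lemma mk_eq_mk (n m : ℕ) (U : Cᵒᵖ) {x y : P.PolyJets n U} :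
    mk P n m U x = mk P n m U y ↔ x - y ∈ PolyJets.ideal P n U ^ m := Ideal.Quotient.eq

/-- The Grothendieck connection as a map `J^{⊗ n} / I^{m+1} → J^{⊗ n} / I^m`. -/
def conn (n m : ℕ) (U : Cᵒᵖ) (l : P.sec U) :
    P.TruncJets n (m + 1) U →ₗ[k] P.TruncJets n m U where
  toFun := Quotient.lift (fun x ↦ mk P n m U (PolyJets.conn P n l x))
    (fun x y h ↦ by
      have h' : x - y ∈ PolyJets.ideal P n U ^ (m + 1) := (Submodule.quotientRel_def _).mp h
      rw [mk_eq_mk, ← map_sub]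
      exact PolyJets.conn_mem P n m l h')
  map_add' x y := by
    obtain ⟨x, rfl⟩ := mk_surjective P n (m + 1) U x
    obtain ⟨y, rfl⟩ := mk_surjective P n (m + 1) U y
    exact (congrArg (mk P n m U) (map_add (PolyJets.conn P n l) x y)).trans (map_add _ _ _)
  map_smul' c x := by
    obtain ⟨x, rfl⟩ := mk_surjective P n (m + 1) U x
    exact (congrArg (mk P n m U) (PolyJets.conn_smul P n l c x)).trans (map_smul _ _ _)

lemma conn_mk (n m : ℕ) (U : Cᵒᵖ) (l : P.sec U) (x : P.PolyJets n U) :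
    conn P n m U l (mk P n (m + 1) U x) = mk P n m U (PolyJets.conn P n l x) := rfl

variable {U V W : Cᵒᵖ}

lemma res_id (n m : ℕ) (x : P.TruncJets n m U) : res P n m (𝟙 U) x = x := by
  obtain ⟨x, rfl⟩ := mk_surjective P n m U x
  rw [res_mk, PolyJets.res_id]

lemma res_comp (n m : ℕ) (f : U ⟶ V) (g : V ⟶ W) (x : P.TruncJets n m U) :
    res P n m (f ≫ g) x = res P n m g (res P n m f x) := by
  obtain ⟨x, rfl⟩ := mk_surjective P n m U x
  rw [res_mk, res_mk, res_mk, PolyJets.res_comp]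

lemma res_factor (n : ℕ) {m m' : ℕ} (h : m' ≤ m) (g : U ⟶ V) (x : P.TruncJets n m U) :
    res P n m' g (factor P n h U x) = factor P n h V (res P n m g x) := by
  obtain ⟨x, rfl⟩ := mk_surjective P n m U x
  rw [res_mk, factor_mk, factor_mk, res_mk]

lemma factor_self (n m : ℕ) (x : P.TruncJets n m U) : factor P n le_rfl U x = x := by
  obtain ⟨x, rfl⟩ := mk_surjective P n m U x
  rw [factor_mk]

lemma factor_factor (n : ℕ) {m m' m'' : ℕ} (h : m' ≤ m) (h' : m'' ≤ m') (x : P.TruncJets n m U) :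
    factor P n h' U (factor P n h U x) = factor P n (h'.trans h) U x := by
  obtain ⟨x, rfl⟩ := mk_surjective P n m U x
  rw [factor_mk, factor_mk, factor_mk]

variable {a b c : ℕ}

lemma res_contract (m : ℕ) (σ : Fin a → Option (Fin b)) (g : U ⟶ V) (x : P.TruncJets a m U) :
    res P b m g (contract P m σ U x) = contract P m σ V (res P a m g x) := by
  obtain ⟨x, rfl⟩ := mk_surjective P a m U x
  rw [res_mk, contract_mk, contract_mk, res_mk, PolyJets.res_contract]

lemma factor_contract {m m' : ℕ} (h : m' ≤ m) (σ : Fin a → Option (Fin b))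
    (x : P.TruncJets a m U) :
    factor P b h U (contract P m σ U x) = contract P m' σ U (factor P a h U x) := by
  obtain ⟨x, rfl⟩ := mk_surjective P a m U x
  rw [factor_mk, contract_mk, contract_mk, factor_mk]

lemma contract_contract (m : ℕ) (σ : Fin a → Option (Fin b)) (τ : Fin b → Option (Fin c))
    (x : P.TruncJets a m U) :
    contract P m τ U (contract P m σ U x) = contract P m (fun i ↦ (σ i).bind τ) U x := by
  obtain ⟨x, rfl⟩ := mk_surjective P a m U x
  rw [contract_mk, contract_mk, contract_mk, PolyJets.contract_contract]

lemma conn_add_left (n m : ℕ) (l l' : P.sec U) (x : P.TruncJets n (m + 1) U) :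
    conn P n m U (l + l') x = conn P n m U l x + conn P n m U l' x := by
  obtain ⟨x, rfl⟩ := mk_surjective P n (m + 1) U x
  rw [conn_mk, conn_mk, conn_mk, PolyJets.conn_add_left, map_add]

lemma conn_smul_left (n m : ℕ) (c : k) (l : P.sec U) (x : P.TruncJets n (m + 1) U) :
    conn P n m U (c • l) x = c • conn P n m U l x := by
  obtain ⟨x, rfl⟩ := mk_surjective P n (m + 1) U x
  rw [conn_mk, conn_mk, PolyJets.conn_smul_left, map_smul]

lemma res_conn (n m : ℕ) (g : U ⟶ V) (l : P.sec U) (x : P.TruncJets n (m + 1) U) :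
    res P n m g (conn P n m U l x) = conn P n m V (P.res g l) (res P n (m + 1) g x) := by
  obtain ⟨x, rfl⟩ := mk_surjective P n (m + 1) U x
  rw [res_mk, conn_mk, conn_mk, res_mk, PolyJets.res_conn]

lemma contract_conn (m : ℕ) (σ : Fin a → Fin b) (l : P.sec U) (x : P.TruncJets a (m + 1) U) :
    contract P m (fun i ↦ some (σ i)) U (conn P a m U l x) =
      conn P b m U l (contract P (m + 1) (fun i ↦ some (σ i)) U x) := by
  obtain ⟨x, rfl⟩ := mk_surjective P a (m + 1) U x
  rw [conn_mk, contract_mk, contract_mk, conn_mk, PolyJets.contract_conn]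

end TruncJets

/-- The presheaf `U ↦ J(U)^{⊗ n} / I^m`. -/
def trunc (n m : ℕ) : Cᵒᵖ ⥤ ModuleCat.{u} k where
  obj U := ModuleCat.of k (P.TruncJets n m U)
  map g := ModuleCat.ofHom (TruncJets.res P n m g)
  map_id U := ModuleCat.hom_ext (LinearMap.ext fun x ↦ TruncJets.res_id P n m x)
  map_comp f g := ModuleCat.hom_ext (LinearMap.ext fun x ↦ TruncJets.res_comp P n m f g x)

/-- The tower `⋯ → J^{⊗ n} / I² → J^{⊗ n} / I → 0`. -/
def tower (n : ℕ) : ℕᵒᵖ ⥤ (Cᵒᵖ ⥤ ModuleCat.{u} k) where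
  obj m := P.trunc n m.unop
  map f :=
    { app := fun U ↦ ModuleCat.ofHom (TruncJets.factor P n (leOfHom f.unop) U)
      naturality := fun U V g ↦ ModuleCat.hom_ext (LinearMap.ext fun x ↦
        (TruncJets.res_factor P n (leOfHom f.unop) g x).symm) }
  map_id m := NatTrans.ext (funext fun U ↦ ModuleCat.hom_ext (LinearMap.ext fun x ↦
    TruncJets.factor_self P n m.unop x))
  map_comp f g := NatTrans.ext (funext fun U ↦ ModuleCat.hom_ext (LinearMap.ext fun x ↦
    (TruncJets.factor_factor P n (leOfHom f.unop) (leOfHom g.unop) x).symm))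

/-- The map of towers induced by a contraction of tensor factors. -/
def towerMap {a b : ℕ} (σ : Fin a → Option (Fin b)) : P.tower a ⟶ P.tower b where
  app m :=
    { app := fun U ↦ ModuleCat.ofHom (TruncJets.contract P m.unop σ U)
      naturality := fun U V g ↦ ModuleCat.hom_ext (LinearMap.ext fun x ↦
        (TruncJets.res_contract P m.unop σ g x).symm) }
  naturality m m' f := NatTrans.ext (funext fun U ↦ ModuleCat.hom_ext (LinearMap.ext fun x ↦
    (TruncJets.factor_contract P (leOfHom f.unop) σ x).symm))

lemma towerMap_comp {a b c : ℕ} (σ : Fin a → Option (Fin b)) (τ : Fin b → Option (Fin c)) :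
    P.towerMap σ ≫ P.towerMap τ = P.towerMap (fun i ↦ (σ i).bind τ) :=
  NatTrans.ext (funext fun m ↦ NatTrans.ext (funext fun U ↦ ModuleCat.hom_ext
    (LinearMap.ext fun x ↦ TruncJets.contract_contract P m.unop σ τ x)))

/-- The map `l ↦ ∇_l x` for a fixed `x`. -/
def nablaAt (n m : ℕ) (U : Cᵒᵖ) (x : P.TruncJets n (m + 1) U) :
    P.sec U →ₗ[k] P.TruncJets n m U where
  toFun l := TruncJets.conn P n m U l x
  map_add' l l' := TruncJets.conn_add_left P n m l l' x
  map_smul' c l := TruncJets.conn_smul_left P n m c l x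

/-- The Grothendieck connection as a map of presheaves
`J^{⊗ n} / I^{m+1} → Hom_k(L, J^{⊗ n} / I^m)`, `α ↦ (l ↦ ∇_l α)`. -/
def nabla (n m : ℕ) : P.trunc n (m + 1) ⟶ ihom P.toPresheaf (P.trunc n m) where
  app U := ModuleCat.ofHom
    { toFun := fun x ↦
        { app := fun V ↦ ModuleCat.ofHom (P.nablaAt n m (op V.unop.left)
            (TruncJets.res P n (m + 1) V.unop.hom.op x))
          naturality := fun V W f ↦ ModuleCat.hom_ext (LinearMap.ext fun l ↦ by
            have h : W.unop.hom.op = V.unop.hom.op ≫ f.unop.left.op :=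
              congrArg Quiver.Hom.op (Over.w f.unop).symm
            have h₁ := TruncJets.res_comp P n (m + 1) V.unop.hom.op f.unop.left.op x
            have h₂ := TruncJets.res_conn P n m f.unop.left.op l
              (TruncJets.res P n (m + 1) V.unop.hom.op x)
            rw [← h₁, ← h] at h₂
            exact h₂.symm) }
      map_add' := fun x y ↦ NatTrans.ext (funext fun V ↦ ModuleCat.hom_ext (LinearMap.ext
        fun l ↦ (congrArg (TruncJets.conn P n m (op V.unop.left) l)
          (map_add (TruncJets.res P n (m + 1) V.unop.hom.op) x y)).trans (map_add _ _ _)))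
      map_smul' := fun c x ↦ NatTrans.ext (funext fun V ↦ ModuleCat.hom_ext (LinearMap.ext
        fun l ↦ (congrArg (TruncJets.conn P n m (op V.unop.left) l)
          (map_smul (TruncJets.res P n (m + 1) V.unop.hom.op) c x)).trans (map_smul _ _ _))) }
  naturality U V g := ModuleCat.hom_ext (LinearMap.ext fun x ↦
    NatTrans.ext (funext fun W ↦ ModuleCat.hom_ext (LinearMap.ext fun l ↦
      congrArg (TruncJets.conn P n m (op W.unop.left) l)
        (TruncJets.res_comp P n (m + 1) g W.unop.hom.op x).symm)))

lemma towerMap_nabla {a b : ℕ} (σ : Fin a → Fin b) (m : ℕ) :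
    (P.towerMap (fun i ↦ some (σ i))).app (op (m + 1)) ≫ P.nabla b m =
      P.nabla a m ≫ ihomMap P.toPresheaf ((P.towerMap (fun i ↦ some (σ i))).app (op m)) :=
  NatTrans.ext (funext fun U ↦ ModuleCat.hom_ext (LinearMap.ext fun x ↦
    NatTrans.ext (funext fun W ↦ ModuleCat.hom_ext (LinearMap.ext fun l ↦
      ((TruncJets.contract_conn P m σ l (TruncJets.res P a (m + 1) W.unop.hom.op x)).trans
        (congrArg (TruncJets.conn P b m (op W.unop.left) l)
          (TruncJets.res_contract P (m + 1) (fun i ↦ some (σ i)) W.unop.hom.op x).symm)).symm))))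

end LieAlgebroidPresheaf

end Sheaves

section FaceComplex

variable {D : Type*} [Category* D] [Preadditive D] (X : ℕ → D)
  (δ : ∀ p, Fin (p + 2) → (X (p + 1) ⟶ X p))

/-- The differential `∑ᵢ (-1)^i δᵢ`. -/
def faceD (p : ℕ) : X (p + 1) ⟶ X p := ∑ i : Fin (p + 2), (-1 : ℤ) ^ (i : ℕ) • δ p i

lemma faceD_comp_faceD
    (h : ∀ (p : ℕ) (i : Fin (p + 2)) (j : Fin (p + 3)) (hij : (j : ℕ) ≤ i),
      δ (p + 1) i.succ ≫ δ p (j.castLT (lt_of_le_of_lt hij i.2)) = δ (p + 1) j ≫ δ p i) (p : ℕ) :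
    faceD X δ (p + 1) ≫ faceD X δ p = 0 := by
  simp only [faceD, Preadditive.comp_sum, Preadditive.sum_comp, ← Finset.sum_product']
  let P := Fin (p + 2) × Fin (p + 3)
  let S : Finset P := {ij : P | (ij.2 : ℕ) ≤ (ij.1 : ℕ)}
  rw [Finset.univ_product_univ, ← Finset.sum_add_sum_compl S, ← eq_neg_iff_add_eq_zero,
    ← Finset.sum_neg_distrib]
  let φ : ∀ ij : P, ij ∈ S → P := fun ij hij =>
    (Fin.castLT ij.2 (lt_of_le_of_lt (Finset.mem_filter.mp hij).right (Fin.is_lt ij.1)), ij.1.succ)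
  apply Finset.sum_bij φ
  · intro ij hij
    simp_rw [S, φ, Finset.compl_filter, Finset.mem_filter_univ, Fin.val_succ,
      Fin.val_castLT] at hij ⊢
    lia
  · rintro ⟨i, j⟩ hij ⟨i', j'⟩ hij' h
    rw [Prod.mk_inj]
    exact ⟨by simpa [φ] using! congr_arg Prod.snd h,
      by simpa [φ, Fin.castSucc_castLT] using! congr_arg Fin.castSucc (congr_arg Prod.fst h)⟩
  · rintro ⟨i', j'⟩ hij'
    simp_rw [S, Finset.compl_filter, Finset.mem_filter_univ, not_le] at hij'
    refine ⟨(j'.pred <| ?_, Fin.castSucc i'), ?_, ?_⟩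
    · rintro rfl
      simp only [Fin.val_zero, not_lt_zero] at hij'
    · simpa [S] using! Nat.le_sub_one_of_lt hij'
    · simp only [φ, Fin.castLT_castSucc, Fin.succ_pred]
  · rintro ⟨i, j⟩ hij
    dsimp
    simp only [Preadditive.zsmul_comp, Preadditive.comp_zsmul, smul_smul, ← neg_smul]
    congr 1
    · simp only [φ, Fin.val_succ, pow_add, pow_one, mul_neg, neg_neg, mul_one]
      apply mul_comm
    · exact (h p i j (by simpa [S] using! hij)).symm

/-- The chain complex with differential `∑ᵢ (-1)^i δᵢ`. -/
def faceComplex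
    (h : ∀ (p : ℕ) (i : Fin (p + 2)) (j : Fin (p + 3)) (hij : (j : ℕ) ≤ i),
      δ (p + 1) i.succ ≫ δ p (j.castLT (lt_of_le_of_lt hij i.2)) = δ (p + 1) j ≫ δ p i) :
    ChainComplex D ℕ :=
  ChainComplex.of X (faceD X δ) (faceD_comp_faceD X δ h)

end FaceComplex

section Faces

/-- The map of indices for the `i`-th summand of the Hochschild differential
`α₀ ⊗ ⋯ ⊗ αₚ₊₁ ↦ ∑_{i ≤ p} (-1)^i α₀ ⊗ ⋯ ⊗ αᵢ αᵢ₊₁ ⊗ ⋯ ⊗ αₚ₊₁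
  + (-1)^(p+1) αₚ₊₁ α₀ ⊗ α₁ ⊗ ⋯ ⊗ αₚ`:
the factor number `j` of the source is multiplied into the factor number `hochFace p i j`. -/
def hochFace (p : ℕ) (i : Fin (p + 2)) (j : Fin (p + 2)) : Fin (p + 1) :=
  ⟨(if (j : ℕ) ≤ i then (j : ℕ) else j - 1) % (p + 1), Nat.mod_lt _ p.succ_pos⟩

/-- The map of indices for the `i`-th summand of the differential
`α₁ ⊗ ⋯ ⊗ αₚ₊₁ ↦ ε(α₁) α₂ ⊗ ⋯ ⊗ αₚ₊₁
  + ∑_{1 ≤ i ≤ p} (-1)^i α₁ ⊗ ⋯ ⊗ αᵢ αᵢ₊₁ ⊗ ⋯ ⊗ αₚ₊₁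
  + (-1)^(p+1) α₁ ⊗ ⋯ ⊗ αₚ ε(αₚ₊₁)`.
Here the factors are numbered from `0`, so `αⱼ` is the factor number `j - 1`, and `none` marks
the factor that is replaced by its value under `ε`. -/
def redFace (p : ℕ) (i : Fin (p + 2)) (j : Fin (p + 1)) : Option (Fin p) :=
  if h : (j : ℕ) < i then
    if h' : (j : ℕ) < p then some ⟨j, h'⟩ else none
  else
    if h' : (j : ℕ) = 0 then none else some ⟨j - 1, by omega⟩

lemma hochFace_hochFace (p : ℕ) (i : Fin (p + 2)) (j : Fin (p + 3)) (hij : (j : ℕ) ≤ i)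
    (a : Fin (p + 3)) :
    hochFace p (j.castLT (lt_of_le_of_lt hij i.2)) (hochFace (p + 1) i.succ a) =
      hochFace p i (hochFace (p + 1) j a) := by
  obtain ⟨i, hi⟩ := i
  obtain ⟨j, hj⟩ := j
  obtain ⟨a, ha⟩ := a
  have key (x n : ℕ) (h : x ≤ n + 1) : x % (n + 1) = if x = n + 1 then 0 else x := by
    split_ifs with h'
    · rw [h', Nat.mod_self]
    · exact Nat.mod_eq_of_lt (by omega)
  have e₁ (n y z : ℕ) (h : z ≤ n + 1) : (if z ≤ y then z else z - 1) % (n + 1) =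
      if z ≤ y then (if z = n + 1 then 0 else z) else z - 1 := by
    rw [key _ _ (by split_ifs <;> omega)]
    split_ifs <;> omega
  simp only [hochFace, Fin.val_succ, Fin.val_castLT, Fin.mk.injEq] at hij ⊢
  rw [e₁ (p + 1) (i + 1) a (by omega), e₁ (p + 1) j a (by omega), e₁ p j _ (by split_ifs <;> omega),
    e₁ p i _ (by split_ifs <;> omega)]
  split_ifs <;> omega

lemma redFace_redFace (p : ℕ) (i : Fin (p + 2)) (j : Fin (p + 3)) (hij : (j : ℕ) ≤ i)
    (a : Fin (p + 2)) :
    (redFace (p + 1) i.succ a).bind (redFace p (j.castLT (lt_of_le_of_lt hij i.2))) =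
      (redFace (p + 1) j a).bind (redFace p i) := by
  obtain ⟨i, hi⟩ := i
  obtain ⟨j, hj⟩ := j
  obtain ⟨a, ha⟩ := a
  simp only [redFace, Fin.succ_mk, Fin.castLT_mk] at hij ⊢
  split_ifs <;> simp only [Option.bind_some, Option.bind_none, redFace] <;> split_ifs <;>
    first | rfl | omega

end Faces

section Algebroid

variable {k : Type u} [Field k] {C : Type u} [SmallCategory C] {J : GrothendieckTopology C}

/-- A Lie algebroid on the ringed site `(C, J, O)`: a sheaf of Lie-Rinehart algebras. -/
structure LieAlgebroid (O : Sheaf J (CommAlgCat.{u} k)) extends LieAlgebroidPresheaf O.obj where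
  isSheaf : Presheaf.IsSheaf J toLieAlgebroidPresheaf.toPresheaf

namespace LieAlgebroid

variable {O : Sheaf J (CommAlgCat.{u} k)} (L : LieAlgebroid O)

/-- The Lie algebroid is locally free of constant rank `d`: every object has a cover by objects
`Y` over which there are `d` sections that form a basis on every object over `Y`. -/
def IsLocallyFree (d : ℕ) : Prop :=
  ∀ X : C, ∃ S ∈ J X, ∀ ⦃Y : C⦄ (f : Y ⟶ X), S f → ∃ e : Fin d → L.sec (op Y),
    ∀ ⦃Z : C⦄ (g : Z ⟶ Y),
      LinearIndependent (O.obj.obj (op Z)) (fun i ↦ L.res g.op (e i)) ∧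
        Submodule.span (O.obj.obj (op Z)) (Set.range fun i ↦ L.res g.op (e i)) = ⊤

/-- The tower of sheaves `⋯ → J^{⊗ n} / I² → J^{⊗ n} / I → 0`. -/
def sheafTower (n : ℕ) : ℕᵒᵖ ⥤ Sheaf J (ModuleCat.{u} k) :=
  L.tower n ⋙ presheafToSheaf J (ModuleCat.{u} k)

/-- The map of towers induced by a contraction of tensor factors. -/
def sheafTowerMap {a b : ℕ} (σ : Fin a → Option (Fin b)) : L.sheafTower a ⟶ L.sheafTower b :=
  Functor.whiskerRight (L.towerMap σ) (presheafToSheaf J (ModuleCat.{u} k))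

lemma sheafTowerMap_comp {a b c : ℕ} (σ : Fin a → Option (Fin b)) (τ : Fin b → Option (Fin c)) :
    L.sheafTowerMap σ ≫ L.sheafTowerMap τ = L.sheafTowerMap (fun i ↦ (σ i).bind τ) := by
  simp only [sheafTowerMap, ← L.towerMap_comp, Functor.whiskerRight_comp]
  rfl

/-- The completed tensor power `J^{⊗̂ n} = lim_m J^{⊗ n} / I^m`, a sheaf of `k`-modules. -/
def completed (n : ℕ) : Sheaf J (ModuleCat.{u} k) := limit (L.sheafTower n)

/-- The projection to `J^{⊗ n} / I^m`. -/
def proj (n m : ℕ) : L.completed n ⟶ (L.sheafTower n).obj (op m) := limit.π (L.sheafTower n) (op m)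

/-- The continuous extension to completed tensor powers of a contraction of tensor factors. -/
def contractHat {a b : ℕ} (σ : Fin a → Option (Fin b)) : L.completed a ⟶ L.completed b :=
  limMap (L.sheafTowerMap σ)

lemma contractHat_proj {a b : ℕ} (σ : Fin a → Option (Fin b)) (m : ℕ) :
    L.contractHat σ ≫ L.proj b m = L.proj a m ≫ (L.sheafTowerMap σ).app (op m) :=
  limMap_π (L.sheafTowerMap σ) (op m)

lemma contractHat_comp {a b c : ℕ} (σ : Fin a → Option (Fin b)) (τ : Fin b → Option (Fin c)) :
    L.contractHat σ ≫ L.contractHat τ = L.contractHat (fun i ↦ (σ i).bind τ) := by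
  refine limit.hom_ext fun m ↦ ?_
  change (_ ≫ _) ≫ L.proj c m.unop = _ ≫ L.proj c m.unop
  rw [Category.assoc, contractHat_proj, contractHat_proj, ← Category.assoc, contractHat_proj,
    Category.assoc, ← sheafTowerMap_comp, NatTrans.comp_app]

/-- The completed Hochschild chain complex of the jet algebra: in degree `p` it is
`J^{⊗̂ (p+1)}`, with the Hochschild differential. -/
def hochschild : ChainComplex (Sheaf J (ModuleCat.{u} k)) ℕ :=
  faceComplex (fun p ↦ L.completed (p + 1))
    (fun p i ↦ L.contractHat (fun j ↦ some (hochFace p i j)))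
    (fun p i j hij ↦ by
      rw [contractHat_comp, contractHat_comp]
      congr 1
      funext a
      exact congrArg some (hochFace_hochFace p i j hij a))

/-- The complex which in degree `p` is `J^{⊗̂ p}`, with the differential
`α₁ ⊗ ⋯ ⊗ αₚ ↦ ε(α₁) α₂ ⊗ ⋯ ⊗ αₚ - α₁ α₂ ⊗ ⋯ ⊗ αₚ + ⋯ + (-1)^p α₁ ⊗ ⋯ ⊗ αₚ₋₁ ε(αₚ)`. -/
def reduced : ChainComplex (Sheaf J (ModuleCat.{u} k)) ℕ :=
  faceComplex L.completed (fun p i ↦ L.contractHat (redFace p i))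
    (fun p i j hij ↦ by
      rw [contractHat_comp, contractHat_comp]
      congr 1
      funext a
      exact redFace_redFace p i j hij a)

/-- The map `α₀ ⊗ ⋯ ⊗ αₚ ↦ ε(α₀) α₁ ⊗ ⋯ ⊗ αₚ`. -/
def epsMap (p : ℕ) : L.hochschild.X p ⟶ L.reduced.X p :=
  L.contractHat (a := p + 1) (b := p) (Fin.cases none some)

/-- The Grothendieck connection as a map of sheaves
`J^{⊗ n} / I^{m+1} → Hom_k(L, J^{⊗ n} / I^m)`, `α ↦ (l ↦ ∇_l α)`. -/
def nablaSheaf (n m : ℕ) : (L.sheafTower n).obj (op (m + 1)) ⟶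
    sheafIhom J L.toPresheaf ((L.sheafTower n).obj (op m)) :=
  (((sheafificationAdjunction J (ModuleCat.{u} k)).homEquiv (L.trunc n (m + 1))
    (sheafIhom J L.toPresheaf ((L.sheafTower n).obj (op m)))).symm
      (L.nabla n m ≫ ihomMap L.toPresheaf
        ((sheafificationAdjunction J (ModuleCat.{u} k)).unit.app (L.trunc n m))))

lemma sheafTowerMap_nablaSheaf {a b : ℕ} (σ : Fin a → Fin b) (m : ℕ) :
    (L.sheafTowerMap (fun i ↦ some (σ i))).app (op (m + 1)) ≫ L.nablaSheaf b m =
      L.nablaSheaf a m ≫ (ObjectProperty.homMk (ihomMap L.toPresheaf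
        ((L.sheafTowerMap (fun i ↦ some (σ i))).app (op m)).hom) :
          sheafIhom J L.toPresheaf _ ⟶ sheafIhom J L.toPresheaf _) := by
  let adj := sheafificationAdjunction J (ModuleCat.{u} k)
  refine (adj.homEquiv (L.trunc a (m + 1)) _).injective ?_
  have e (n : ℕ) : adj.homEquiv (L.trunc n (m + 1)) _ (L.nablaSheaf n m) =
      L.nabla n m ≫ ihomMap L.toPresheaf (adj.unit.app (L.trunc n m)) :=
    Equiv.apply_symm_apply ..
  refine (adj.homEquiv_naturality_left _ (L.nablaSheaf b m)).trans ?_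
  refine Eq.trans ?_ (adj.homEquiv_naturality_right (L.nablaSheaf a m) _).symm
  let t (n : ℕ) : L.trunc a n ⟶ L.trunc b n := (L.towerMap (fun i ↦ some (σ i))).app (op n)
  have hu : t m ≫ adj.unit.app (L.trunc b m) = adj.unit.app (L.trunc a m) ≫
      ((presheafToSheaf J (ModuleCat.{u} k)).map (t m)).hom := adj.unit.naturality (t m)
  have ht : t (m + 1) ≫ L.nabla b m = L.nabla a m ≫ ihomMap L.toPresheaf (t m) :=
    L.towerMap_nabla σ m
  have key : t (m + 1) ≫ L.nabla b m ≫ ihomMap L.toPresheaf (adj.unit.app (L.trunc b m)) =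
      (L.nabla a m ≫ ihomMap L.toPresheaf (adj.unit.app (L.trunc a m))) ≫
        ihomMap L.toPresheaf ((presheafToSheaf J (ModuleCat.{u} k)).map (t m)).hom := by
    rw [← Category.assoc, ht, Category.assoc, Category.assoc]
    exact congrArg (fun z ↦ L.nabla a m ≫ ihomMap L.toPresheaf z) hu
  exact (congrArg (fun z ↦ t (m + 1) ≫ z) (e b)).trans (key.trans (congrArg (fun z ↦ z ≫
    ihomMap L.toPresheaf ((presheafToSheaf J (ModuleCat.{u} k)).map (t m)).hom) (e a)).symm)

/-- The Grothendieck connection on `J^{⊗̂ n}`: the family of the maps `α ↦ (l ↦ ∇_l α mod I^m)`. -/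
def nablaHat (n : ℕ) : L.completed n ⟶
    ∏ᶜ fun m : ℕ ↦ sheafIhom J L.toPresheaf ((L.sheafTower n).obj (op m)) :=
  Pi.lift fun m ↦ L.proj n (m + 1) ≫ L.nablaSheaf n m

/-- The subsheaf of `J^{⊗̂ n}` of the sections that are invariant under the Grothendieck
connection: its sections over `U` are the sections `α` over `U` such that `∇_l (α|_V) = 0` for all
`V → U` and all `l ∈ L(V)`. -/
def invariants (n : ℕ) : Sheaf J (ModuleCat.{u} k) := kernel (L.nablaHat n)

/-- The inclusion of the invariants. -/
def inclusion (n : ℕ) : L.invariants n ⟶ L.completed n := kernel.ι (L.nablaHat n)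

instance (n : ℕ) : Mono (L.inclusion n) := inferInstanceAs (Mono (kernel.ι _))

lemma inclusion_nablaHat (n : ℕ) : L.inclusion n ≫ L.nablaHat n = 0 := kernel.condition _

lemma inclusion_nabla (n m : ℕ) : L.inclusion n ≫ L.proj n (m + 1) ≫ L.nablaSheaf n m = 0 := by
  have h : L.nablaHat n ≫ Pi.π _ m = L.proj n (m + 1) ≫ L.nablaSheaf n m := by simp [nablaHat]
  rw [← h, ← Category.assoc, inclusion_nablaHat, zero_comp]

lemma inclusion_comp_eq_zero {a b : ℕ} (σ : Fin a → Fin b) :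
    L.inclusion a ≫ L.contractHat (fun i ↦ some (σ i)) ≫ L.nablaHat b = 0 := by
  refine Pi.hom_ext _ _ fun m ↦ ?_
  have h : L.nablaHat b ≫ Pi.π _ m = L.proj b (m + 1) ≫ L.nablaSheaf b m := by simp [nablaHat]
  rw [Category.assoc, Category.assoc, h, ← Category.assoc (L.contractHat _), contractHat_proj,
    Category.assoc, sheafTowerMap_nablaSheaf, ← Category.assoc (L.proj a _),
    ← Category.assoc, inclusion_nabla, zero_comp, zero_comp]

/-- Contraction along a map of index sets preserves the invariants. -/
def contractInv {a b : ℕ} (σ : Fin a → Fin b) : L.invariants a ⟶ L.invariants b :=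
  kernel.lift (L.nablaHat b) (L.inclusion a ≫ L.contractHat (fun i ↦ some (σ i)))
    (by rw [Category.assoc, inclusion_comp_eq_zero])

lemma contractInv_inclusion {a b : ℕ} (σ : Fin a → Fin b) :
    L.contractInv σ ≫ L.inclusion b = L.inclusion a ≫ L.contractHat (fun i ↦ some (σ i)) :=
  kernel.lift_ι _ _ _

/-- The complex of `∇`-invariants in the completed Hochschild chain complex. -/
def invHochschild : ChainComplex (Sheaf J (ModuleCat.{u} k)) ℕ :=
  faceComplex (fun p ↦ L.invariants (p + 1)) (fun p i ↦ L.contractInv (hochFace p i))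
    (fun p i j hij ↦ by
      rw [← cancel_mono (L.inclusion (p + 1)), Category.assoc, Category.assoc,
        contractInv_inclusion, contractInv_inclusion, ← Category.assoc, ← Category.assoc,
        contractInv_inclusion, contractInv_inclusion, Category.assoc, Category.assoc,
        contractHat_comp, contractHat_comp]
      congr 2
      funext a
      exact congrArg some (hochFace_hochFace p i j hij a))

/-- The inclusion of the complex of invariants into the completed Hochschild chain complex. -/
def invInclusion : L.invHochschild ⟶ L.hochschild where
  f p := L.inclusion (p + 1)
  comm' := by
    rintro i p (rfl : p + 1 = i)
    simp only [invHochschild, hochschild, faceComplex, ChainComplex.of_d, faceD,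
      Preadditive.comp_sum, Preadditive.sum_comp, Preadditive.comp_zsmul, Preadditive.zsmul_comp,
      contractInv_inclusion]

end LieAlgebroid

end Algebroid

end LieJets

end

/-! The complexes are built from maps of index sets, so compatibility of `α₀ ⊗ ⋯ ⊗ αₚ ↦ ε(α₀) α₁ ⊗ ⋯
⊗ αₚ` with the differentials holds face by face and is a statement about finite sets
(`hochFace_bind_cases`). The content is that this map becomes bijective on invariants.
Geometrically, a horizontal function is determined by its restriction to the locus where the first
variable is the unit, and every function on that locus extends by parallel transport.

Locally `L` has a frame `e₁, …, e_d`. By Poincaré-Birkhoff-Witt (`coord_mono`, `span_mono_eq_top`)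
the ordered monomials are a basis of the enveloping algebra, so a jet is an arbitrary function on
multisets of indices (`value_jet`, `jets_ext`). The jets `xᵢ` dual to the monomials `eᵢ` generate
`ker ε`, because the coproduct of monomials is the splitting of multisets and the characteristic is
zero (`exists_eq_sum_coordinate_mul`); moreover `∇_{eⱼ} xᵢ` is `-δᵢⱼ` modulo `ker ε`.

Let `T = J^{⊗ (n+1)}`, let `I` be its augmentation ideal and `X` the ideal generated by the `xᵢ` in
the first factor, which is the kernel of `ε ⊗ id`. The Euler derivation `E = -∑ xⱼ ∇_{eⱼ}` acts on
`X^r / X^{r+1}` as multiplication by `r` (`euler_sub_mem`). If the derivatives of an element of `X +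
I^{m+1}` lie in `I^m`, then `E` sends it to `I^{m+1}`, and dividing by `r = 1, 2, …` pushes it into
`X^r + I^{m+1}` for all `r`, hence into `I^{m+1}`: this is injectivity (`mem_pow_of_deriv_mem`). For
surjectivity, flatness shows that replacing `t` by `t - E t / (r + 1)` improves the derivatives of
`t` from `X^r + I^m` to `X^{r+1} + I^m` (`exists_deriv_mem`). Since `∇` lowers the `I`-adic order by
one, horizontality of a class modulo `I^{m+1}` is a condition modulo `I^m`.

Thus at each level horizontal classes in `J^{⊗ (n+1)} / I^{m+1}` correspond to classes in `J^{⊗ n} /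
I^{m+1}`, first over frames and then for the associated sheaves (`isIso_kernel_epsTower`). The
inverses are unique, hence compatible between levels, and they assemble to an inverse on the limits
(`exists_horizontal_lift_completed`); no exactness of inverse limits is involved. -/

noncomputable section

namespace LieJets

/-! ### Poincaré-Birkhoff-Witt for a Lie-Rinehart algebra with a finite basis. -/

namespace PBW

section Representation

variable (k : Type u) {A : Type v} {L : Type w} [CommRing k] [CommRing A] [Algebra k A]
  [LieRing L] [LieAlgebra k L] [Module A L] [LieRingModule L A] [LieRinehartRing A L]
  [LieRinehartAlgebra k A L]

/-- The connection along `l` on the free module on `X` with `∇_l x = W x` for `x` in `X`. -/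
def semiConn {X : Type*} (l : L) (W : X → X →₀ A) : (X →₀ A) →ₗ[k] (X →₀ A) :=
  Finsupp.mapRange.linearMap (LieModule.toEnd k L A l : A →ₗ[k] A) +
    (Finsupp.linearCombination A W).restrictScalars k

lemma semiConn_single {X : Type*} (l : L) (W : X → X →₀ A) (x : X) (a : A) :
    semiConn k l W (Finsupp.single x a) = Finsupp.single x ⁅l, a⁆ + a • W x := by
  simp [semiConn]

lemma semiConn_smul {X : Type*} (l : L) (W : X → X →₀ A) (a : A) (v : X →₀ A) :
    semiConn k l W (a • v) = ⁅l, a⁆ • v + a • semiConn k l W v := by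
  induction v using Finsupp.induction_linear with
  | zero => simp
  | add x y hx hy => simp only [smul_add, map_add, hx, hy]; abel
  | single x c =>
    rw [Finsupp.smul_single, semiConn_single, semiConn_single, smul_eq_mul,
      LieRinehartRing.leibniz_mul_right]
    simp only [Finsupp.single_add, smul_add, Finsupp.smul_single, smul_eq_mul, mul_smul]
    abel

variable {ι : Type*} [Fintype ι] (b : Module.Basis ι A L)

lemma basis_induction {p : L → Prop} (zero : p 0) (add : ∀ l m, p l → p m → p (l + m))
    (smul : ∀ (a : A) l, p l → p (a • l)) (basis : ∀ i, p (b i)) (l : L) : p l := by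
  rw [← b.sum_repr l]
  exact Finset.sum_induction _ p add zero fun i _ ↦ smul _ _ (basis i)

/-- The connection on the free module on the multisets of indices for which the basis element
`b i` maps `M` to `{i} + M` plus a correction `w i M`. -/
def rep (w : ι → Multiset ι → Multiset ι →₀ A) (l : L) :
    (Multiset ι →₀ A) →ₗ[k] (Multiset ι →₀ A) :=
  semiConn k l (fun M ↦ ∑ i, b.repr l i • (Finsupp.single (i ::ₘ M) 1 + w i M))

variable (w : ι → Multiset ι → Multiset ι →₀ A)

lemma rep_smul (l : L) (a : A) (v : Multiset ι →₀ A) :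
    rep k b w l (a • v) = ⁅l, a⁆ • v + a • rep k b w l v := semiConn_smul ..

lemma rep_single_one (l : L) (M : Multiset ι) : rep k b w l (Finsupp.single M 1) =
    ∑ i, b.repr l i • (Finsupp.single (i ::ₘ M) 1 + w i M) := by
  rw [rep, semiConn_single, lie_one, Finsupp.single_zero, zero_add, one_smul]

lemma rep_basis_single (i : ι) (M : Multiset ι) :
    rep k b w (b i) (Finsupp.single M 1) = Finsupp.single (i ::ₘ M) 1 + w i M := by
  classical
  rw [rep_single_one, Finset.sum_eq_single i]
  · simp
  · intro j _ hj
    simp [Ne.symm hj]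
  · simp

lemma rep_add_left (l m : L) (v : Multiset ι →₀ A) :
    rep k b w (l + m) v = rep k b w l v + rep k b w m v := by
  induction v using Finsupp.induction_linear with
  | zero => simp
  | add x y hx hy => simp only [map_add, hx, hy]; abel
  | single M c =>
    simp only [rep, semiConn_single, add_lie, map_add, Finsupp.add_apply, add_smul,
      Finset.sum_add_distrib, Finsupp.single_add, smul_add]
    abel

lemma rep_smul_left (a : A) (l : L) (v : Multiset ι →₀ A) :
    rep k b w (a • l) v = a • rep k b w l v := by
  induction v using Finsupp.induction_linear with
  | zero => simp
  | add x y hx hy => simp only [map_add, hx, hy, smul_add]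
  | single M c =>
    have e : ∑ i, b.repr (a • l) i • (Finsupp.single (i ::ₘ M) 1 + w i M) =
        a • ∑ i, b.repr l i • (Finsupp.single (i ::ₘ M) 1 + w i M) := by
      rw [Finset.smul_sum]
      exact Finset.sum_congr rfl fun i _ ↦ by
        rw [map_smul, Finsupp.smul_apply, smul_eq_mul, mul_smul]
    rw [rep, rep, semiConn_single, semiConn_single, e, LieRinehartRing.lie_smul_eq_mul, smul_add,
      Finsupp.smul_single, smul_comm a c, smul_eq_mul]

/-- `rep` as a linear map in the section of `L`. -/
def repHom : L →ₗ[A] Module.End k (Multiset ι →₀ A) where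
  toFun l := rep k b w l
  map_add' l m := LinearMap.ext (rep_add_left k b w l m)
  map_smul' a l := LinearMap.ext (rep_smul_left k b w a l)

lemma repHom_apply (l : L) : repHom k b w l = rep k b w l := rfl

/-- The combinations of multisets of at most `n` elements. -/
def deg (A : Type v) [CommRing A] (ι : Type*) (n : ℕ) : Submodule A (Multiset ι →₀ A) :=
  Finsupp.supported A A {M | Multiset.card M ≤ n}

lemma single_mem_deg {n : ℕ} {M : Multiset ι} (h : Multiset.card M ≤ n) (a : A) :
    Finsupp.single M a ∈ deg A ι n := Finsupp.single_mem_supported A a h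

lemma deg_mono {m n : ℕ} (h : m ≤ n) : deg A ι m ≤ deg A ι n :=
  Finsupp.supported_mono fun _ hM ↦ le_trans hM h

lemma deg_induction {n : ℕ} {p : (Multiset ι →₀ A) → Prop} (h0 : p 0)
    (hadd : ∀ x y, p x → p y → p (x + y)) (hsmul : ∀ (a : A) x, x ∈ deg A ι n → p x → p (a • x))
    (hs : ∀ M, Multiset.card M ≤ n → p (Finsupp.single M 1))
    {v : Multiset ι →₀ A} (hv : v ∈ deg A ι n) : p v := by
  rw [← Finsupp.sum_single v, Finsupp.sum]
  refine Finset.sum_induction _ p hadd h0 fun M hM ↦ ?_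
  have hM' : Multiset.card M ≤ n := hv hM
  have := hsmul (v M) _ (single_mem_deg hM' 1) (hs M hM')
  rwa [Finsupp.smul_single, smul_eq_mul, mul_one] at this

/-- Corrections that do not exceed the degree of `M` leave the action raising degrees by at most
one. Together with `rep_congr` this lets the corrections be defined by recursion on the cardinality.
-/
lemma rep_mem_deg {w : ι → Multiset ι → Multiset ι →₀ A}
    (hw : ∀ i M, w i M ∈ deg A ι (Multiset.card M)) (l : L) {n : ℕ}
    {v : Multiset ι →₀ A} (hv : v ∈ deg A ι n) : rep k b w l v ∈ deg A ι (n + 1) := by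
  refine deg_induction (p := fun v ↦ rep k b w l v ∈ deg A ι (n + 1)) (by simp)
    (fun x y hx hy ↦ ?_) (fun a x hx h ↦ ?_) (fun M hM ↦ ?_) hv
  · rw [map_add]; exact add_mem hx hy
  · rw [rep_smul]
    exact add_mem (Submodule.smul_mem _ _ (deg_mono n.le_succ hx)) (Submodule.smul_mem _ _ h)
  · rw [rep_single_one]
    refine Submodule.sum_mem _ fun i _ ↦ Submodule.smul_mem _ _ (add_mem ?_ ?_)
    · exact single_mem_deg (by simpa using hM) 1
    · exact deg_mono (by omega) (hw i M)

lemma rep_congr {w w' : ι → Multiset ι → Multiset ι →₀ A} {n : ℕ}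
    (h : ∀ i M, Multiset.card M ≤ n → w i M = w' i M) (l : L)
    {v : Multiset ι →₀ A} (hv : v ∈ deg A ι n) : rep k b w l v = rep k b w' l v := by
  refine deg_induction (p := fun v ↦ rep k b w l v = rep k b w' l v) (by simp)
    (fun x y hx hy ↦ ?_) (fun a x hx h' ↦ ?_) (fun M hM ↦ ?_) hv
  · rw [map_add, map_add, hx, hy]
  · rw [rep_smul, rep_smul, h']
  · simp only [rep_single_one, h _ _ hM]

/-! ### The correction terms, by recursion on the cardinality. -/

variable [LinearOrder ι]

lemma multiset_cases (M : Multiset ι) :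
    M = 0 ∨ ∃ (j : ι) (N : Multiset ι), (∀ a ∈ N, j ≤ a) ∧ M = j ::ₘ N := by
  rcases h : M.sort with _ | ⟨j, t⟩
  · left
    rw [← M.sort_eq (· ≤ ·), h]; rfl
  · right
    have hp := M.pairwise_sort (· ≤ ·)
    rw [h, List.pairwise_cons] at hp
    exact ⟨j, t, fun a ha ↦ hp.1 a (by simpa using ha), by rw [← M.sort_eq (· ≤ ·), h]; rfl⟩

/-- The recursion for the correction terms which makes the connection flat. -/
def corrStep (w : ι → Multiset ι → Multiset ι →₀ A) (i : ι) (M : Multiset ι) : Multiset ι →₀ A :=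
  match M.sort with
  | [] => 0
  -- Here `j ::ₘ t` should be `b j` applied to `t`, and `b i · b j` should be `b j · b i + ⁅b i, b
  -- j⁆`. As `b i` sends `t` to `i ::ₘ t + w i t`, and `b j` sends `i ::ₘ t` to `j ::ₘ i ::ₘ t`
  -- without correction, these two summands are what remains. If `i ≤ j`, prepending `i` keeps the
  -- monomial ordered and nothing is to be corrected.
  | j :: t => if j < i then
      rep k b w (b j) (w i (t : Multiset ι)) +
        rep k b w ⁅b i, b j⁆ (Finsupp.single (t : Multiset ι) 1) else 0

lemma corrStep_zero (i : ι) : corrStep k b w i 0 = 0 := by simp [corrStep]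

lemma corrStep_cons (i j : ι) {N : Multiset ι} (hN : ∀ a ∈ N, j ≤ a) :
    corrStep k b w i (j ::ₘ N) = if j < i then rep k b w (b j) (w i N) +
        rep k b w ⁅b i, b j⁆ (Finsupp.single N 1) else 0 := by
  rw [corrStep, Multiset.sort_cons _ _ _ hN]
  simp only [Multiset.sort_eq]

/-- The correction terms for multisets of at most `n` elements. -/
def corrAux : ℕ → ι → Multiset ι → Multiset ι →₀ A
  | 0 => fun _ _ ↦ 0
  | n + 1 => corrStep k b (corrAux n)

lemma corrAux_mem (n : ℕ) (i : ι) (M : Multiset ι) :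
    corrAux k b n i M ∈ deg A ι (Multiset.card M) := by
  induction n generalizing i M with
  | zero => exact zero_mem _
  | succ n ih =>
    rw [corrAux]
    rcases multiset_cases M with rfl | ⟨j, N, hN, rfl⟩
    · rw [corrStep_zero]; exact zero_mem _
    · rw [corrStep_cons k b _ i j hN]
      split_ifs
      · rw [Multiset.card_cons]
        exact add_mem (rep_mem_deg k b ih _ (ih _ _))
          (rep_mem_deg k b ih _ (single_mem_deg le_rfl 1))
      · exact zero_mem _

lemma corrStep_congr {w w' : ι → Multiset ι → Multiset ι →₀ A} {n : ℕ}
    (hw : ∀ i M, w i M ∈ deg A ι (Multiset.card M))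
    (h : ∀ i M, Multiset.card M ≤ n → w i M = w' i M) (i : ι) (M : Multiset ι)
    (hM : Multiset.card M ≤ n + 1) : corrStep k b w i M = corrStep k b w' i M := by
  rcases multiset_cases M with rfl | ⟨j, N, hN, rfl⟩
  · rw [corrStep_zero, corrStep_zero]
  · have hc : Multiset.card N ≤ n := by simpa using hM
    rw [corrStep_cons k b _ i j hN, corrStep_cons k b _ i j hN, ← h i N hc,
      rep_congr k b h _ (deg_mono hc (hw i N)), rep_congr k b h _ (single_mem_deg hc 1)]

/-- One step of the recursion at `M` only consults corrections of strictly smaller multisets, so the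
values on multisets of at most `n` elements are stable from stage `n` on. At stage `0` the value `0`
is right, since the empty multiset needs no correction. -/
lemma corrAux_succ (n : ℕ) (i : ι) (M : Multiset ι) (hM : Multiset.card M ≤ n) :
    corrAux k b (n + 1) i M = corrAux k b n i M := by
  induction n generalizing i M with
  | zero =>
    obtain rfl : M = 0 := by simpa using hM
    exact corrStep_zero k b _ i
  | succ n ih =>
    rw [corrAux, corrAux]
    exact corrStep_congr k b (corrAux_mem k b (n + 1)) ih i M hM

/-- The correction terms. -/
def corr (i : ι) (M : Multiset ι) : Multiset ι →₀ A := corrAux k b (Multiset.card M) i M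

lemma corr_mem (i : ι) (M : Multiset ι) : corr k b i M ∈ deg A ι (Multiset.card M) :=
  corrAux_mem ..

lemma corrAux_eq_corr (n : ℕ) (i : ι) (M : Multiset ι) (hM : Multiset.card M ≤ n) :
    corrAux k b n i M = corr k b i M := by
  induction n, hM using Nat.le_induction with
  | base => rfl
  | succ n hn ih => rw [corrAux_succ k b n i M hn, ih]

/-- The diagonal `corr` of the stable stages is a fixed point of the recursion; from here on only
this equation and the degree bound matter. -/
lemma corr_eq_corrStep (i : ι) (M : Multiset ι) : corr k b i M = corrStep k b (corr k b) i M := by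
  rw [← corrAux_eq_corr k b (Multiset.card M + 1) i M (Nat.le_succ _), corrAux]
  exact corrStep_congr k b (corrAux_mem k b _) (corrAux_eq_corr k b _) i M (Nat.le_succ _)

lemma corr_eq_zero (i : ι) {M : Multiset ι} (hM : ∀ a ∈ M, i ≤ a) : corr k b i M = 0 := by
  rw [corr_eq_corrStep]
  rcases multiset_cases M with rfl | ⟨j, N, hN, rfl⟩
  · rw [corrStep_zero]
  · rw [corrStep_cons k b _ i j hN, if_neg (not_lt.mpr (hM j (by simp)))]

lemma corr_cons {i j : ι} (hij : j < i) {N : Multiset ι} (hN : ∀ a ∈ N, j ≤ a) :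
    corr k b i (j ::ₘ N) = rep k b (corr k b) (b j) (corr k b i N) +
      rep k b (corr k b) ⁅b i, b j⁆ (Finsupp.single N 1) := by
  rw [corr_eq_corrStep, corrStep_cons k b _ i j hN, if_pos hij]

lemma rep_single_of_le (i : ι) {M : Multiset ι} (hM : ∀ a ∈ M, i ≤ a) :
    rep k b (corr k b) (b i) (Finsupp.single M 1) = Finsupp.single (i ::ₘ M) 1 := by
  rw [rep_basis_single, corr_eq_zero k b i hM, add_zero]

/-- Flatness of the connection at a vector. -/
def Flat (l m : L) (v : Multiset ι →₀ A) : Prop :=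
  rep k b (corr k b) l (rep k b (corr k b) m v) =
    rep k b (corr k b) m (rep k b (corr k b) l v) + rep k b (corr k b) ⁅l, m⁆ v

/-! ### Vanishing of the curvature. -/

variable {k b}

lemma Flat.add {l m : L} {x y : Multiset ι →₀ A} (hx : Flat k b l m x) (hy : Flat k b l m y) :
    Flat k b l m (x + y) := by
  unfold Flat at *
  simp only [map_add, hx, hy]
  abel

/-- Curvature is `A`-linear in the vector: the mixed terms `l(a) ∇_m x` and `m(a) ∇_l x` are
symmetric in `l` and `m`, and `l(m(a)) - m(l(a))` is `⁅l, m⁆(a)`. -/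
lemma Flat.smul {l m : L} {x : Multiset ι →₀ A} (hx : Flat k b l m x) (a : A) :
    Flat k b l m (a • x) := by
  unfold Flat at *
  simp only [rep_smul, map_add, hx, smul_add, lie_lie, sub_smul]
  abel

lemma Flat.symm {l m : L} {x : Multiset ι →₀ A} (hx : Flat k b l m x) : Flat k b m l x := by
  unfold Flat at *
  rw [hx, ← lie_skew m l, ← repHom_apply k b _ (-_), map_neg]
  simp [repHom_apply]

lemma flat_self (l : L) (x : Multiset ι →₀ A) : Flat k b l l x := by
  unfold Flat
  rw [lie_self, ← repHom_apply, ← repHom_apply, map_zero]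
  simp

lemma Flat.add_left {l m m' : L} {x : Multiset ι →₀ A} (h : Flat k b l m x)
    (h' : Flat k b l m' x) : Flat k b l (m + m') x := by
  unfold Flat at *
  simp only [rep_add_left, map_add, h, h', lie_add]
  abel

/-- Curvature is `A`-linear in the section as well: the derivative `l(a) ∇_m x` is absorbed by `⁅l,
a m⁆ = l(a) m + a ⁅l, m⁆`. With `Flat.symm` this leaves only pairs of basis elements with `j < i` to
check. -/
lemma Flat.smul_left {l m : L} {x : Multiset ι →₀ A} (h : Flat k b l m x) (a : A) :
    Flat k b l (a • m) x := by
  unfold Flat at *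
  simp only [rep_smul_left, rep_smul, h, LieRinehartRing.leibniz_smul_right, rep_add_left,
    smul_add]
  abel

lemma flat_of_basis_right {l : L} {x : Multiset ι →₀ A} (h : ∀ j, Flat k b l (b j) x) (m : L) :
    Flat k b l m x := by
  induction m using basis_induction b with
  | zero => simp [Flat, ← repHom_apply]
  | add m m' h h' => exact h.add_left h'
  | smul a m h => exact h.smul_left a
  | basis j => exact h j

lemma flat_of_basis {x : Multiset ι →₀ A} (h : ∀ i j, j < i → Flat k b (b i) (b j) x) (l m : L) :
    Flat k b l m x := by
  refine flat_of_basis_right (fun j ↦ (flat_of_basis_right (fun i ↦ ?_) l).symm) m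
  rcases lt_trichotomy i j with hij | rfl | hij
  · exact h j i hij
  · exact flat_self _ _
  · exact (h i j hij).symm

lemma flat_of_forall_single {l m : L} {n : ℕ}
    (h : ∀ M : Multiset ι, Multiset.card M ≤ n → Flat k b l m (Finsupp.single M 1))
    {v : Multiset ι →₀ A} (hv : v ∈ deg A ι n) : Flat k b l m v :=
  deg_induction (by simp [Flat]) (fun _ _ hx hy ↦ hx.add hy) (fun a _ _ hx ↦ hx.smul a) h hv

variable (k b)

/-- This is the case for which the corrections were chosen: unfolded, it is the recursion
`corr_cons`. -/
lemma flat_single_of_le {i j : ι} (hij : j < i) {N : Multiset ι} (hN : ∀ a ∈ N, j ≤ a) :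
    Flat k b (b i) (b j) (Finsupp.single N 1) := by
  have h' : ∀ a ∈ i ::ₘ N, j ≤ a := by
    intro a ha
    rcases Multiset.mem_cons.mp ha with rfl | ha
    · exact hij.le
    · exact hN a ha
  rw [Flat, rep_single_of_le k b j hN, rep_basis_single, corr_cons k b hij hN, rep_basis_single,
    map_add, rep_single_of_le k b j h', Multiset.cons_swap]
  abel

/-- The remaining case is `N = p ::ₘ Q` with `p < j < i`. There `N` is `b p` applied to `Q`; `b p`
is moved to the left past `b i` and `b j`, and the assertion reduces to flatness at `Q` and the
Jacobi identity. -/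
lemma flat_single (n : ℕ) (N : Multiset ι) (hn : Multiset.card N ≤ n) (l m : L) :
    Flat k b l m (Finsupp.single N 1) := by
  induction n generalizing N l m with
  | zero =>
    obtain rfl : N = 0 := by simpa using hn
    exact flat_of_basis (fun i j hij ↦ flat_single_of_le k b hij (by simp)) l m
  | succ n ih =>
    refine flat_of_basis (fun i j hij ↦ ?_) l m
    rcases multiset_cases N with rfl | ⟨p, Q, hQ, rfl⟩
    · exact flat_single_of_le k b hij (by simp)
    by_cases hjp : j ≤ p
    · refine flat_single_of_le k b hij fun a ha ↦ ?_
      rcases Multiset.mem_cons.mp ha with rfl | ha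
      · exact hjp
      · exact hjp.trans (hQ a ha)
    have hpj : p < j := not_le.mp hjp
    have hc : Multiset.card Q ≤ n := by simpa using hn
    have ih' (l m : L) {v} (hv : v ∈ deg A ι n) : Flat k b l m v :=
      flat_of_forall_single (fun M hM ↦ ih M hM l m) hv
    -- The vector `b j · Q` has the same degree as `N`, beyond the induction hypothesis. Its leading
    -- term `j ::ₘ Q` has no entry below `p`, so `flat_single_of_le` applies to it; only the
    -- correction, of degree at most that of `Q`, needs the hypothesis.
    have key (i j : ι) (hi : p < i) (hj : p < j) :
        Flat k b (b i) (b p) (rep k b (corr k b) (b j) (Finsupp.single Q 1)) := by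
      rw [rep_basis_single]
      refine Flat.add (flat_single_of_le k b hi fun a ha ↦ ?_) (ih' _ _ (deg_mono hc (corr_mem ..)))
      rcases Multiset.mem_cons.mp ha with rfl | ha
      · exact hj.le
      · exact hQ a ha
    have e (l m : L) := ih Q hc l m
    have half (i j : ι) (hi : p < i) (hj : p < j) :
        rep k b (corr k b) (b i) (rep k b (corr k b) (b j) (Finsupp.single (p ::ₘ Q) 1)) =
        rep k b (corr k b) (b p) (rep k b (corr k b) (b i) (rep k b (corr k b) (b j)
          (Finsupp.single Q 1))) +
        rep k b (corr k b) ⁅b i, b p⁆ (rep k b (corr k b) (b j) (Finsupp.single Q 1)) +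
        rep k b (corr k b) ⁅b j, b p⁆ (rep k b (corr k b) (b i) (Finsupp.single Q 1)) +
        rep k b (corr k b) ⁅b i, ⁅b j, b p⁆⁆ (Finsupp.single Q 1) := by
      rw [← rep_single_of_le k b p hQ, e (b j) (b p), map_add, key i j hi hj, e (b i) ⁅b j, b p⁆]
      abel
    -- In the difference of `half i j` and `half j i` the middle terms cancel. What remains is `b p
    -- · ⁅b i, b j⁆ Q` together with the double brackets, which the Jacobi identity turns into `⁅⁅b
    -- i, b j⁆, b p⁆`; flatness for `⁅b i, b j⁆` and `b p` then gives `⁅b i, b j⁆ · b p Q`.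
    have hp := e ⁅b i, b j⁆ (b p)
    rw [Flat] at hp ⊢
    rw [half i j (hpj.trans hij) hpj, half j i hpj (hpj.trans hij), ← rep_single_of_le k b p hQ, hp,
      e (b i) (b j), map_add, leibniz_lie (b i) (b j) (b p), rep_add_left]
    abel

lemma flat (l m : L) (v : Multiset ι →₀ A) : Flat k b l m v := by
  induction v using Finsupp.induction_linear with
  | zero => simp [Flat]
  | add x y hx hy => exact hx.add hy
  | single M a =>
    have := (flat_single k b _ M le_rfl l m).smul a
    rwa [Finsupp.smul_single, smul_eq_mul, mul_one] at this

/-- `rep` with the flat correction terms, as a `k`-linear map. -/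
def flatRep : L →ₗ[k] Module.End k (Multiset ι →₀ A) where
  toFun l := rep k b (corr k b) l
  map_add' l m := LinearMap.ext (rep_add_left k b _ l m)
  map_smul' r l := LinearMap.ext fun v ↦ by
    rw [← algebraMap_smul A r l, rep_smul_left, algebraMap_smul]
    rfl

lemma flatRep_apply (l : L) (v : Multiset ι →₀ A) :
    flatRep k b l v = rep k b (corr k b) l v := rfl

/-- The representation of the enveloping algebra on the free module on the multisets. -/
def envRep : Env k A L →ₐ[k] Module.End k (Multiset ι →₀ A) :=
  Env.lift (B := Module.End k (Multiset ι →₀ A)) (Algebra.lsmul k k (Multiset ι →₀ A))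
    (flatRep k b)
    (fun a l ↦ LinearMap.ext fun v ↦ by
      rw [Module.End.mul_apply, Algebra.lsmul_coe, flatRep_apply, flatRep_apply, rep_smul_left])
    (fun l a ↦ LinearMap.ext fun v ↦ by
      rw [Module.End.mul_apply, LinearMap.add_apply, Module.End.mul_apply]
      simp only [Algebra.lsmul_coe, flatRep_apply, rep_smul, add_comm])
    (fun l m ↦ LinearMap.ext fun v ↦ by
      rw [LinearMap.sub_apply, Module.End.mul_apply, Module.End.mul_apply]
      simp only [flatRep_apply]
      rw [show _ = _ from flat k b l m v, add_sub_cancel_left])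

lemma envRep_fn (a : A) (v : Multiset ι →₀ A) : envRep k b (Env.fn k A L a) v = a • v := by
  rw [envRep, Env.lift_fn, Algebra.lsmul_coe]

lemma envRep_vf (l : L) (v : Multiset ι →₀ A) :
    envRep k b (Env.vf k A L l) v = rep k b (corr k b) l v := by
  rw [envRep, Env.lift_vf, flatRep_apply]

/-! ### The ordered monomials: independence, spanning and coproduct. -/

/-- The ordered monomial in the basis elements given by a multiset of indices. -/
def mono (M : Multiset ι) : Env k A L := (M.sort.map fun i ↦ Env.vf k A L (b i)).prod

lemma mono_zero : mono k b 0 = 1 := by simp [mono]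

lemma mono_cons {i : ι} {M : Multiset ι} (hM : ∀ a ∈ M, i ≤ a) :
    mono k b (i ::ₘ M) = Env.vf k A L (b i) * mono k b M := by
  rw [mono, Multiset.sort_cons _ _ _ hM, List.map_cons, List.prod_cons, mono]

lemma mono_singleton (i : ι) : mono k b {i} = Env.vf k A L (b i) := by
  rw [← Multiset.cons_zero, mono_cons k b (by simp), mono_zero, mul_one]

lemma mono_induction {p : Multiset ι → Prop} (h0 : p 0)
    (hcons : ∀ i M, (∀ a ∈ M, i ≤ a) → p M → p (i ::ₘ M)) (M : Multiset ι) : p M := by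
  induction h : Multiset.card M generalizing M with
  | zero =>
    obtain rfl : M = 0 := by simpa using h
    exact h0
  | succ n ih =>
    rcases multiset_cases M with rfl | ⟨j, N, hN, rfl⟩
    · exact h0
    · exact hcons j N hN (ih N (by simpa using h))

/-- The coordinates of an element of the enveloping algebra in the basis of ordered monomials. -/
def coord : Env k A L →ₗ[A] Multiset ι →₀ A where
  toFun D := envRep k b D (Finsupp.single 0 1)
  map_add' D E := by simp
  map_smul' a D := by simp [Env.smul_def, envRep_fn]

/-- An ordered monomial acts on the empty multiset by prepending ever smaller indices, where no
correction occurs. This is the independence half of the theorem and allows functionals with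
arbitrary values on monomials. -/
lemma coord_mono (M : Multiset ι) : coord k b (mono k b M) = Finsupp.single M 1 := by
  change envRep k b (mono k b M) (Finsupp.single 0 1) = _
  induction M using mono_induction with
  | h0 => simp [mono_zero]
  | hcons i M hM ih =>
    rw [mono_cons k b hM, map_mul, Module.End.mul_apply, ih, envRep_vf,
      rep_single_of_le k b i hM]

/-- The span of the ordered monomials of degree at most `n`. -/
def monoSpan (n : ℕ) : Submodule A (Env k A L) :=
  Submodule.span A (mono k b '' {M | Multiset.card M ≤ n})

lemma mono_mem_monoSpan {n : ℕ} {M : Multiset ι} (hM : Multiset.card M ≤ n) :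
    mono k b M ∈ monoSpan k b n := Submodule.subset_span ⟨M, hM, rfl⟩

lemma monoSpan_mono {m n : ℕ} (h : m ≤ n) : monoSpan k b m ≤ monoSpan k b n :=
  Submodule.span_mono (Set.image_mono fun _ hM ↦ le_trans hM h)

lemma vf_mul_mem_of_basis {S S' : Submodule A (Env k A L)} (l : L)
    (h : ∀ i, ∀ x ∈ S, Env.vf k A L (b i) * x ∈ S') {x : Env k A L} (hx : x ∈ S) :
    Env.vf k A L l * x ∈ S' := by
  induction l using basis_induction b with
  | zero => simp
  | add l m hl hm => rw [map_add, add_mul]; exact add_mem hl hm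
  | smul a l hl =>
    rw [← Env.fn_mul_vf, mul_assoc, ← Env.smul_def]
    exact Submodule.smul_mem _ _ hl
  | basis i => exact h i x hx

lemma vf_mul_mem_monoSpan_of_mono {n : ℕ} (i : ι)
    (h : ∀ M : Multiset ι, Multiset.card M ≤ n →
      Env.vf k A L (b i) * mono k b M ∈ monoSpan k b (n + 1))
    {x : Env k A L} (hx : x ∈ monoSpan k b n) :
    Env.vf k A L (b i) * x ∈ monoSpan k b (n + 1) := by
  refine Submodule.span_induction (p := fun x _ ↦ Env.vf k A L (b i) * x ∈ monoSpan k b (n + 1))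
    ?_ (by simp) (fun x y _ _ hx hy ↦ ?_) (fun a x hx h ↦ ?_) hx
  · rintro _ ⟨M, hM, rfl⟩
    exact h M hM
  · rw [mul_add]; exact add_mem hx hy
  · rw [Env.vf_mul_smul]
    exact add_mem (Submodule.smul_mem _ _ (monoSpan_mono k b n.le_succ hx))
      (Submodule.smul_mem _ _ h)

/-- Straightening, by induction on the degree and then on `i`. If the least index `j` of `M = j ::ₘ
N` is below `i`, then `b i` is moved past `b j`: the product `b i · N` is known in lower degree and
is multiplied by `b j` with `j < i`, while the commutator term has smaller degree. -/
lemma vf_mul_mono_mem (n : ℕ) (i : ι) (M : Multiset ι) (hM : Multiset.card M ≤ n) :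
    Env.vf k A L (b i) * mono k b M ∈ monoSpan k b (n + 1) := by
  induction n generalizing i M with
  | zero =>
    obtain rfl : M = 0 := by simpa using hM
    rw [← mono_cons k b (by simp)]
    exact mono_mem_monoSpan k b (by simp)
  | succ n ih =>
    induction i using WellFoundedLT.induction generalizing M with
    | ind i ihi =>
    rcases multiset_cases M with rfl | ⟨j, N, hN, rfl⟩
    · rw [← mono_cons k b (by simp)]
      exact mono_mem_monoSpan k b (by simp)
    have hc : Multiset.card N ≤ n := by simpa using hM
    by_cases hij : i ≤ j
    · rw [← mono_cons k b fun a ha ↦ ?_]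
      · exact mono_mem_monoSpan k b (by simpa using hM)
      · rcases Multiset.mem_cons.mp ha with rfl | ha
        · exact hij
        · exact hij.trans (hN a ha)
    · have e : Env.vf k A L (b i) * mono k b (j ::ₘ N) =
          Env.vf k A L (b j) * (Env.vf k A L (b i) * mono k b N) +
            Env.vf k A L ⁅b i, b j⁆ * mono k b N := by
        rw [mono_cons k b hN, Env.vf_lie]
        noncomm_ring
      rw [e]
      refine add_mem (vf_mul_mem_monoSpan_of_mono k b j (ihi j (not_le.mp hij)) (ih i N hc)) ?_
      -- The bracket `⁅b i, b j⁆` is an `A`-combination of basis elements, and `N` is short enough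
      -- for the outer induction hypothesis to apply to each of them.
      exact monoSpan_mono k b (by omega) (vf_mul_mem_of_basis k b _
        (S := Submodule.span A {mono k b N}) (S' := monoSpan k b (n + 1))
        (fun i x hx ↦ vf_mul_mem_monoSpan_of_mono k b i (fun M hM ↦ ih i M hM)
          (Submodule.span_mono (by simpa using ⟨N, hc, rfl⟩) hx)) (by simp))

lemma span_mono_eq_top : Submodule.span A (Set.range (mono k b)) = ⊤ := by
  rw [eq_top_iff]
  rintro x -
  have hle (n : ℕ) : monoSpan k b n ≤ Submodule.span A (Set.range (mono k b)) :=
    Submodule.span_mono (Set.image_subset_range _ _)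
  induction x using Env.induction with
  | h1 => exact Submodule.subset_span ⟨0, mono_zero k b⟩
  | hadd x y hx hy => exact add_mem hx hy
  | hfn a x hx => exact Submodule.smul_mem _ a hx
  | hvf l x hx =>
    refine vf_mul_mem_of_basis k b l (fun i x hx ↦ ?_) hx
    refine Submodule.span_induction
      (p := fun x _ ↦ Env.vf k A L (b i) * x ∈ Submodule.span A (Set.range (mono k b)))
      ?_ (by simp) (fun x y _ _ hx hy ↦ ?_) (fun a x hx h ↦ ?_) hx
    · rintro _ ⟨M, rfl⟩
      exact hle _ (vf_mul_mono_mem k b _ i M le_rfl)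
    · rw [mul_add]; exact add_mem hx hy
    · rw [Env.vf_mul_smul]
      exact add_mem (Submodule.smul_mem _ _ hx) (Submodule.smul_mem _ _ h)

/-- Additive maps out of the enveloping algebra which are semilinear over `A` agree if they agree
on the ordered monomials. -/
lemma ext_mono {N : Type*} [AddCommMonoid N] {f g : Env k A L → N} (s : A → N → N)
    (hf : ∀ x y, f (x + y) = f x + f y) (hg : ∀ x y, g (x + y) = g x + g y)
    (hf0 : f 0 = 0) (hg0 : g 0 = 0)
    (hfs : ∀ a x, f (a • x) = s a (f x)) (hgs : ∀ a x, g (a • x) = s a (g x))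
    (h : ∀ M, f (mono k b M) = g (mono k b M)) (x : Env k A L) : f x = g x := by
  have hx : x ∈ Submodule.span A (Set.range (mono k b)) := by
    rw [span_mono_eq_top]; trivial
  refine Submodule.span_induction (p := fun x _ ↦ f x = g x) ?_ (by rw [hf0, hg0])
    (fun x y _ _ hx hy ↦ by rw [hf, hg, hx, hy]) (fun a x _ h ↦ by rw [hfs, hgs, h]) hx
  rintro _ ⟨M, rfl⟩
  exact h M

/-- The linear functional on the enveloping algebra with given values on the ordered monomials. -/
def functional (g : Multiset ι → A) : Env k A L →ₗ[A] A :=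
  Finsupp.linearCombination A g ∘ₗ coord k b

lemma functional_mono (g : Multiset ι → A) (M : Multiset ι) :
    functional k b g (mono k b M) = g M := by
  simp [functional, coord_mono]

/-- Basis elements are primitive, so the coproduct distributes the factors over the two sides.
Prepending the least index to either part of a splitting keeps that part ordered, so no
straightening is needed. -/
lemma comul_mono (M : Multiset ι) : Env.comul k A L (mono k b M) =
    (M.antidiagonal.map fun p ↦ mono k b p.1 ⊗ₜ[A] mono k b p.2).sum := by
  induction M using mono_induction with
  | h0 => simp [mono_zero, Env.comul_one]
  | hcons i M hM ih =>
    rw [mono_cons k b hM, Env.comul_vf_mul, ih, Multiset.antidiagonal_cons, Multiset.map_add,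
      Multiset.map_map, Multiset.map_map, Multiset.sum_add, map_multiset_sum, Multiset.map_map,
      ← Multiset.sum_map_add]
    congr 1
    refine Multiset.map_congr rfl fun p hp ↦ ?_
    have hp' := Multiset.mem_antidiagonal.mp hp
    have h₁ : ∀ a ∈ p.1, i ≤ a := fun a ha ↦ hM a (hp' ▸ Multiset.mem_add.mpr (.inl ha))
    have h₂ : ∀ a ∈ p.2, i ≤ a := fun a ha ↦ hM a (hp' ▸ Multiset.mem_add.mpr (.inr ha))
    simp only [Function.comp_apply, Env.conn₂_tmul, Prod.map_fst, Prod.map_snd, id_eq,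
      mono_cons k b h₁, mono_cons k b h₂]
    exact add_comm _ _

end Representation

end PBW

end LieJets

/-! ### Jets over a frame: values on monomials, and coordinates. -/

namespace LieJets

lemma PBW.map_mono {k : Type u} [CommRing k] {A A' : Type v} {L L' : Type w} [CommRing A]
    [Algebra k A] [LieRing L] [LieAlgebra k L] [Module A L] [LieRingModule L A]
    [LieRinehartRing A L] [LieRinehartAlgebra k A L] [CommRing A'] [Algebra k A']
    [LieRing L'] [LieAlgebra k L'] [Module A' L'] [LieRingModule L' A'] [LieRinehartRing A' L']
    [LieRinehartAlgebra k A' L'] {φ : A →ₐ[k] A'} (F : LieRinehartAlgebra.Hom φ L L')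
    {ι : Type*} [Fintype ι] [LinearOrder ι] (b : Module.Basis ι A L) (b' : Module.Basis ι A' L')
    (h : ∀ i, F (b i) = b' i) (M : Multiset ι) :
    Env.map F (PBW.mono k b M) = PBW.mono k b' M := by
  simp only [PBW.mono, map_list_prod, List.map_map]
  congr 2
  funext i
  simp [h]

lemma sum_antidiagonal_card_zero {ι B : Type*} [AddCommMonoid B] (M : Multiset ι) (v : B) :
    (M.antidiagonal.map fun p ↦ if Multiset.card p.1 = 0 then v else 0).sum = v := by
  induction M using Multiset.induction with
  | empty => simp
  | cons i M ih =>
    rw [Multiset.antidiagonal_cons, Multiset.map_add, Multiset.sum_add, Multiset.map_map,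
      Multiset.map_map]
    simpa using ih

/-- Splittings are counted with multiplicity, so there are as many one-element first parts as
elements of `M`. This is the integer that has to be inverted to divide a jet by the coordinates. -/
lemma sum_antidiagonal_card_one {ι B : Type*} [AddCommMonoid B] (M : Multiset ι) (v : B) :
    (M.antidiagonal.map fun p ↦ if Multiset.card p.1 = 1 then v else 0).sum =
      Multiset.card M • v := by
  induction M using Multiset.induction with
  | empty => simp
  | cons i M ih =>
    rw [Multiset.antidiagonal_cons, Multiset.map_add, Multiset.sum_add, Multiset.map_map,
      Multiset.map_map, Multiset.card_cons, add_smul, one_smul, ← ih]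
    refine congrArg₂ _ rfl (Eq.trans ?_ (sum_antidiagonal_card_zero M v))
    exact congrArg _ (Multiset.map_congr rfl fun p _ ↦
      if_congr (by simp) rfl rfl)

namespace LieAlgebroidPresheaf

variable {k : Type u} [Field k] {C : Type u} [SmallCategory C]
  {O : Cᵒᵖ ⥤ CommAlgCat.{u} k} (P : LieAlgebroidPresheaf O) {U V W : Cᵒᵖ} {ι : Type u}

/-- A family of sections over `U` whose restrictions to every object over `U` form a basis. -/
def IsFrame {ι : Type*} (e : ι → P.sec U) : Prop :=
  ∀ ⦃V : Cᵒᵖ⦄ (f : U ⟶ V), LinearIndependent (O.obj V) (fun i ↦ P.res f (e i)) ∧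
    Submodule.span (O.obj V) (Set.range fun i ↦ P.res f (e i)) = ⊤

namespace IsFrame

variable {P} {ι : Type*} {e : ι → P.sec U} (h : P.IsFrame e)

include h in
lemma res (f : U ⟶ V) : P.IsFrame (fun i ↦ P.res f (e i)) := fun W g ↦ by
  have := h (f ≫ g)
  simp only [P.res_comp] at this
  exact this

/-- The basis over an object over `U` given by a frame over `U`. -/
def basis (f : U ⟶ V) : Module.Basis ι (O.obj V) (P.sec V) := Module.Basis.mk (h f).1 (h f).2.ge

lemma basis_apply (f : U ⟶ V) (i : ι) : h.basis f i = P.res f (e i) := by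
  rw [basis, Module.Basis.mk_apply]

lemma res_basis (f : U ⟶ V) (g : V ⟶ W) (i : ι) :
    P.res g (h.basis f i) = h.basis (f ≫ g) i := by
  rw [basis_apply, basis_apply, P.res_comp]

variable [Fintype ι] [LinearOrder ι]

/-- The ordered monomials in a frame. -/
def mono (f : U ⟶ V) (M : Multiset ι) : Env k (O.obj V) (P.sec V) := PBW.mono k (h.basis f) M

lemma map_mono (f : U ⟶ V) (g : V ⟶ W) (M : Multiset ι) :
    Env.map (P.res g) (h.mono f M) = h.mono (f ≫ g) M :=
  PBW.map_mono _ _ _ (h.res_basis f g) M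

/-- The jet over `U` with given values on the ordered monomials. -/
def jet (g : Multiset ι → O.obj U) : P.Jets U :=
  ⟨fun _ f ↦ .toConv (PBW.functional k (h.basis f) fun M ↦ (O.map f).hom (g M)), by
    intro V W f f' D
    refine PBW.ext_mono k (h.basis f) (f := fun D ↦ (O.map f').hom
        (PBW.functional k (h.basis f) (fun M ↦ (O.map f).hom (g M)) D))
      (g := fun D ↦ PBW.functional k (h.basis (f ≫ f')) (fun M ↦ (O.map (f ≫ f')).hom (g M))
        (Env.map (P.res f') D)) (fun a b ↦ (O.map f').hom a * b) (fun x y ↦ ?_)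
      (fun x y ↦ ?_) ?_ ?_ (fun a x ↦ ?_) (fun a x ↦ ?_) (fun M ↦ ?_) D
    · simp only [map_add]
    · simp only [map_add]
    · simp only [map_zero]
    · simp only [map_zero]
    · simp only [map_smul, smul_eq_mul, map_mul]
    · simp only [Env.smul_def, map_mul, Env.map_fn]
      rw [← Env.smul_def, map_smul, smul_eq_mul]
    · change (O.map f').hom (PBW.functional k (h.basis f) _ _) =
        PBW.functional k (h.basis (f ≫ f')) _ (Env.map (P.res f') (h.mono f M))
      rw [map_mono, mono, PBW.functional_mono, PBW.functional_mono, CategoryTheory.Functor.map_comp]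
      rfl⟩

/-- The values of a jet on the ordered monomials. -/
def value (α : P.Jets U) (M : Multiset ι) : O.obj U := (α.comp (𝟙 U)).ofConv (h.mono (𝟙 U) M)

lemma value_jet (g : Multiset ι → O.obj U) (M : Multiset ι) : h.value (h.jet g) M = g M := by
  refine (PBW.functional_mono k (h.basis (𝟙 U)) _ M).trans ?_
  rw [CategoryTheory.Functor.map_id]
  rfl

include h in
-- Monomials in the frame restrict to monomials and span over every object, so by compatibility the
-- values over `U` itself determine all components.
lemma jets_ext {α β : P.Jets U} (hαβ : ∀ M, h.value α M = h.value β M) : α = β := by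
  refine Jets.ext fun V f ↦ ?_
  refine WithConv.ext (LinearMap.ext fun D ↦ ?_)
  refine PBW.ext_mono k (h.basis f) (fun a b ↦ a * b) (map_add _)
      (map_add _) (map_zero _) (map_zero _) (map_smul _) (map_smul _) (fun M ↦ ?_) D
  have e₁ (α : P.Jets U) : (α.comp f).ofConv (h.mono f M) = (O.map f).hom (h.value α M) := by
    have := α.compat (𝟙 U) f (h.mono (𝟙 U) M)
    rw [map_mono, Category.id_comp] at this
    exact this.symm
  exact (e₁ α).trans ((congrArg _ (hαβ M)).trans (e₁ β).symm)

lemma value_add (α β : P.Jets U) (M : Multiset ι) :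
    h.value (α + β) M = h.value α M + h.value β M := rfl

lemma value_sum {κ : Type*} (s : Finset κ) (α : κ → P.Jets U) (M : Multiset ι) :
    h.value (∑ i ∈ s, α i) M = ∑ i ∈ s, h.value (α i) M :=
  map_sum (AddMonoidHom.mk' (fun α ↦ h.value α M) (fun α β ↦ h.value_add α β M)) α s

lemma value_mul (α β : P.Jets U) (M : Multiset ι) : h.value (α * β) M =
    (M.antidiagonal.map fun p ↦ h.value α p.1 * h.value β p.2).sum := by
  refine (congrArg (Jet.pair _ _) (PBW.comul_mono k (h.basis (𝟙 U)) M)).trans ?_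
  rw [map_multiset_sum, Multiset.map_map]
  rfl

lemma counit_eq_value (α : P.Jets U) : Jets.counit P U α = h.value α 0 := by
  rw [Jets.counit_apply, value, mono, PBW.mono_zero]

lemma counit_conn (j : ι) (α : P.Jets U) : Jets.counit P U (Jets.conn (e j) α) =
    ⁅e j, Jets.counit P U α⁆ - h.value α {j} := by
  rw [Jets.counit_apply, Jets.comp_conn, Jet.conn_apply, mul_one, P.res_id, value, mono,
    PBW.mono_singleton, basis_apply, P.res_id, Jets.counit_apply]

/-- The coordinates of the formal neighbourhood of the unit given by a frame. -/
def coordinate (i : ι) : P.Jets U := h.jet fun M ↦ if M = {i} then 1 else 0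

lemma counit_coordinate (i : ι) : Jets.counit P U (h.coordinate i) = 0 := by
  rw [h.counit_eq_value, coordinate, value_jet, if_neg (Multiset.singleton_ne_zero i).symm]

/-- The sign comes from the term `-α(l D)` of the Grothendieck connection, and is the reason for the
sign in `euler`. -/
lemma counit_conn_coordinate (i j : ι) :
    Jets.counit P U (Jets.conn (e j) (h.coordinate i)) = - if j = i then 1 else 0 := by
  rw [h.counit_conn, counit_coordinate, lie_zero, zero_sub, coordinate, value_jet]
  simp only [Multiset.singleton_inj]

include h in
/-- The coordinates generate the kernel of the counit. -/
lemma exists_eq_sum_coordinate_mul [CharZero k] {α : P.Jets U} (hα : Jets.counit P U α = 0) :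
    ∃ β : ι → P.Jets U, α = ∑ i, h.coordinate i * β i := by
  -- At `M` the product of the `i`-th coordinate with `β i` sums `β i T` over the splittings `M =
  -- {i} + T`. With this choice every splitting contributes the value of `α` at `M` divided by the
  -- cardinality of `M`, and that cardinality is the number of splittings.
  refine ⟨fun i ↦ h.jet fun T ↦ ((Multiset.card T + 1 : ℕ) : k)⁻¹ • h.value α (i ::ₘ T),
    h.jets_ext fun M ↦ ?_⟩
  have key : ∀ p ∈ M.antidiagonal, (∑ i, h.value (h.coordinate i) p.1 * h.value (h.jet fun T ↦
      ((Multiset.card T + 1 : ℕ) : k)⁻¹ • h.value α (i ::ₘ T)) p.2) =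
      if Multiset.card p.1 = 1 then ((Multiset.card M : ℕ) : k)⁻¹ • h.value α M else 0 := by
    rintro ⟨S, T⟩ hp
    replace hp : S + T = M := Multiset.mem_antidiagonal.mp hp
    simp only [coordinate, value_jet]
    split_ifs with hS
    · obtain ⟨i, rfl⟩ := Multiset.card_eq_one.mp hS
      rw [Finset.sum_eq_single i]
      · rw [if_pos rfl, one_mul, ← hp, Multiset.card_add, Multiset.card_singleton, add_comm 1,
          Multiset.singleton_add]
      · intro j _ hj
        rw [if_neg (fun hij ↦ hj (Multiset.singleton_inj.mp hij).symm), zero_mul]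
      · simp
    · refine Finset.sum_eq_zero fun i _ ↦ ?_
      rw [if_neg (fun hS' ↦ hS (by rw [hS', Multiset.card_singleton])), zero_mul]
  simp only [value_sum, value_mul]
  have swap (F : ι → Multiset ι × Multiset ι → O.obj U) :
      ∑ i, (M.antidiagonal.map (F i)).sum = (M.antidiagonal.map fun p ↦ ∑ i, F i p).sum :=
    Multiset.sum_map_sum_map _ _
  rw [swap, Multiset.map_congr rfl key, sum_antidiagonal_card_one]
  -- The empty multiset has no such splitting; there the value of `α` is `ε(α) = 0`. This is the
  -- only use of the hypothesis on `α`.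
  rcases eq_or_ne M 0 with rfl | hM
  · rw [← h.counit_eq_value, hα, smul_zero, smul_zero]
  · have hc : ((Multiset.card M : ℕ) : k) ≠ 0 := by simpa using hM
    rw [← Nat.cast_smul_eq_nsmul k, smul_inv_smul₀ hc]

end IsFrame

end LieAlgebroidPresheaf

end LieJets

/-! ### The Euler derivation in a ring with derivations dual to coordinates. -/

namespace LieJets

section EulerField

variable {T ι : Type*} [CommRing T] [Fintype ι] (D : ι → T →+ T) (x : ι → T)

/-- The derivation `-∑ xⱼ Dⱼ`. -/
def euler : T →+ T := -∑ j, (AddMonoidHom.mulLeft (x j)).comp (D j)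

lemma euler_apply (t : T) : euler D x t = -∑ j, x j * D j t := by simp [euler]

variable {D x}

lemma euler_mem (t : T) : euler D x t ∈ Ideal.span (Set.range x) := by
  rw [euler_apply]
  exact neg_mem (Submodule.sum_mem _ fun j _ ↦ Ideal.mul_mem_right _ _
    (Ideal.subset_span ⟨j, rfl⟩))

/-- By the Leibniz rule a derivation lowers the order along an ideal by at most one. -/
lemma mem_pow_of_leibniz {δ : T →+ T} (hδ : ∀ s t, δ (s * t) = δ s * t + s * δ t) (I : Ideal T)
    {m : ℕ} {t : T} (ht : t ∈ I ^ (m + 1)) : δ t ∈ I ^ m := by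
  induction m generalizing t with
  | zero => simp
  | succ m ih =>
    rw [pow_succ] at ht
    refine Submodule.mul_induction_on ht (fun a ha b hb ↦ ?_) (fun a b ha hb ↦ ?_)
    · rw [hδ]
      refine Ideal.add_mem _ ?_ (Ideal.mul_mem_right _ _ ha)
      rw [pow_succ]
      exact Ideal.mul_mem_mul (ih ha) hb
    · rw [map_add]
      exact Ideal.add_mem _ ha hb

lemma cast_mem_cancel {N : Ideal T} {r : ℕ} (k : Type*) [Field k] [CharZero k] [Algebra k T]
    (hr : r ≠ 0) {t : T} (h : (r : T) * t ∈ N) : t ∈ N := by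
  have hr' : (r : k) ≠ 0 := by simpa using hr
  have : t = algebraMap k T (r : k)⁻¹ * (r * t) := by
    rw [← mul_assoc, ← map_natCast (algebraMap k T) r, ← map_mul, inv_mul_cancel₀ hr', map_one,
      one_mul]
  rw [this]
  exact Ideal.mul_mem_left _ _ h

section

variable (hD : ∀ j s t, D j (s * t) = D j s * t + s * D j t)

include hD

lemma euler_mul (s t : T) : euler D x (s * t) = euler D x s * t + s * euler D x t := by
  simp only [euler_apply, hD, mul_add, Finset.sum_add_distrib, neg_add, neg_mul, mul_neg,
    Finset.sum_mul, Finset.mul_sum]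
  congr 2 <;> refine Finset.sum_congr rfl fun j _ ↦ by ring

/-- The factor `x j` restores the order lost by `D j`. -/
lemma euler_mem_pow {I : Ideal T} (hI : Ideal.span (Set.range x) ≤ I) {m : ℕ} {t : T}
    (ht : t ∈ I ^ m) : euler D x t ∈ I ^ m := by
  cases m with
  | zero => simp
  | succ m =>
    rw [euler_apply, pow_succ']
    exact neg_mem (Submodule.sum_mem _ fun j _ ↦ Ideal.mul_mem_mul
      (hI (Ideal.subset_span ⟨j, rfl⟩)) (mem_pow_of_leibniz (hD j) I ht))

variable [DecidableEq ι]
  (hx : ∀ i j, D j (x i) + (if j = i then 1 else 0) ∈ Ideal.span (Set.range x))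

include hx

/-- On the coordinates the duality of `D` and `x` gives the claim; it extends to multiples because
`E a · t` already lies in the square of the ideal. -/
lemma euler_sub_self_mem {t : T} (ht : t ∈ Ideal.span (Set.range x)) :
    euler D x t - t ∈ Ideal.span (Set.range x) ^ 2 := by
  refine Submodule.span_induction
    (p := fun t _ ↦ euler D x t - t ∈ Ideal.span (Set.range x) ^ 2) ?_ (by simp)
    (fun s t _ _ hs ht ↦ ?_) (fun a t ht h ↦ ?_) ht
  · rintro _ ⟨i, rfl⟩
    have e : euler D x (x i) - x i = -∑ j, x j * (D j (x i) + if j = i then 1 else 0) := by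
      simp [euler_apply, mul_add, Finset.sum_add_distrib]
      ring
    rw [e, pow_two]
    exact neg_mem (Submodule.sum_mem _ fun j _ ↦ Ideal.mul_mem_mul
      (Ideal.subset_span ⟨j, rfl⟩) (hx i j))
  · rw [map_add, add_sub_add_comm]; exact add_mem hs ht
  · rw [smul_eq_mul, euler_mul hD, add_sub_assoc, ← mul_sub]
    refine add_mem ?_ (Ideal.mul_mem_left _ _ h)
    rw [pow_two]
    exact Ideal.mul_mem_mul (euler_mem _) ht

/-- Euler's formula for homogeneous elements of degree `r`: a derivation acting as `1` on the
degree-one part acts as `r` on products of `r` factors. -/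
lemma euler_sub_mem (r : ℕ) {t : T} (ht : t ∈ Ideal.span (Set.range x) ^ r) :
    euler D x t - r * t ∈ Ideal.span (Set.range x) ^ (r + 1) := by
  induction r generalizing t with
  | zero => simpa using euler_mem t
  | succ r ih =>
    rw [pow_succ] at ht
    refine Submodule.mul_induction_on ht (fun a ha b hb ↦ ?_) (fun a b ha hb ↦ ?_)
    · have e : euler D x (a * b) - ((r + 1 : ℕ) : T) * (a * b) =
          (euler D x a - r * a) * b + a * (euler D x b - b) := by
        rw [euler_mul hD]; push_cast; ring
      rw [e]
      refine add_mem ?_ ?_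
      · rw [pow_succ]
        exact Ideal.mul_mem_mul (ih ha) hb
      · rw [add_assoc, pow_add]
        exact Ideal.mul_mem_mul ha (euler_sub_self_mem hD hx hb)
    · rw [map_add, mul_add, add_sub_add_comm]; exact add_mem ha hb

variable {I : Ideal T}
  (hI : Ideal.span (Set.range x) ≤ I)

include hI

/-- An element of the ideal of the coordinates is small if its derivatives are. -/
lemma mem_pow_of_deriv_mem (k : Type*) [Field k] [CharZero k] [Algebra k T] {m : ℕ} {t : T}
    (ht : t ∈ Ideal.span (Set.range x) ⊔ I ^ (m + 1)) (hDt : ∀ j, D j t ∈ I ^ m) :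
    t ∈ I ^ (m + 1) := by
  have hE : euler D x t ∈ I ^ (m + 1) := by
    rw [euler_apply, pow_succ']
    exact neg_mem (Submodule.sum_mem _ fun j _ ↦ Ideal.mul_mem_mul
      (hI (Ideal.subset_span ⟨j, rfl⟩)) (hDt j))
  -- Writing `t = y + z`, the element `(r + 1) y` agrees with `E y = E t - E z` up to the next power
  -- of the coordinate ideal, and both `E t` and `E z` lie in `I ^ (m + 1)`. Division by `r + 1`
  -- gives the next stage; at `r = m` the first summand is itself inside `I ^ (m + 1)`.
  have key (r : ℕ) : t ∈ Ideal.span (Set.range x) ^ (r + 1) ⊔ I ^ (m + 1) := by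
    induction r with
    | zero => simpa using ht
    | succ r ih =>
      obtain ⟨y, hy, z, hz, rfl⟩ := Submodule.mem_sup.mp ih
      refine cast_mem_cancel k (r := r + 1) (by omega) ?_
      have e : ((r + 1 : ℕ) : T) * (y + z) = -(euler D x y - ((r + 1 : ℕ) : T) * y) +
          (euler D x (y + z) - euler D x z + ((r + 1 : ℕ) : T) * z) := by
        rw [map_add]; ring
      rw [e]
      exact Submodule.add_mem_sup (neg_mem (euler_sub_mem hD hx _ hy))
        (add_mem (sub_mem hE (euler_mem_pow hD hI hz)) (Ideal.mul_mem_left _ _ hz))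
  exact sup_le (Ideal.pow_right_mono hI _) le_rfl (key m)

/-- Every element can be made almost horizontal by a correction in the ideal of the
coordinates, if the connection is flat. -/
lemma exists_deriv_mem (k : Type*) [Field k] [CharZero k] [Algebra k T]
    (hflat : ∀ (N : Ideal T) t, (∀ p, D p t ∈ N) → ∀ i j, D i (D j t) - D j (D i t) ∈ N)
    (m : ℕ) (t₀ : T) : ∃ t, t - t₀ ∈ Ideal.span (Set.range x) ∧ ∀ j, D j t ∈ I ^ m := by
  suffices key : ∀ r : ℕ, ∃ t, t - t₀ ∈ Ideal.span (Set.range x) ∧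
      ∀ j, D j t ∈ Ideal.span (Set.range x) ^ r ⊔ I ^ m by
    obtain ⟨t, ht, h⟩ := key m
    exact ⟨t, ht, fun j ↦ sup_le (Ideal.pow_right_mono hI _) le_rfl (h j)⟩
  intro r
  induction r with
  | zero => exact ⟨t₀, by simp, fun j ↦ by simp⟩
  | succ r ih =>
    obtain ⟨t, ht, h⟩ := ih
    set X := Ideal.span (Set.range x) with hX
    obtain ⟨c, hc⟩ : ∃ c : T, ((r + 1 : ℕ) : T) * c = 1 := by
      refine ⟨algebraMap k T ((r + 1 : ℕ) : k)⁻¹, ?_⟩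
      rw [← map_natCast (algebraMap k T), ← map_mul, mul_inv_cancel₀
        (Nat.cast_ne_zero.mpr r.succ_ne_zero), map_one]
    -- The derivations are only additive, so constancy of `c = 1 / (r + 1)` has to be deduced from
    -- `(r + 1) c = 1`.
    have hDc (j : ι) : D j c = 0 := by
      have h1 : D j 1 = 0 := by simpa using hD j 1 1
      have h2 : ((r + 1 : ℕ) : T) * D j c = 0 := by
        rw [← nsmul_eq_mul, ← map_nsmul, nsmul_eq_mul, hc, h1]
      linear_combination c * h2 - D j c * hc
    have hmul {a b : T} (ha : a ∈ X) (hb : b ∈ X ^ r ⊔ I ^ m) : a * b ∈ X ^ (r + 1) ⊔ I ^ m := by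
      have := Ideal.mul_mem_mul ha hb
      rw [Ideal.mul_sup, ← pow_succ'] at this
      exact (sup_le_sup le_rfl Ideal.mul_le_right :
        X ^ (r + 1) ⊔ X * I ^ m ≤ X ^ (r + 1) ⊔ I ^ m) this
    -- Modulo `X ^ (r + 1) ⊔ I ^ m` one has `D j (E t) = D j t + E (D j t) = (1 + r) D j t`, by `h₁`
    -- and `h₂`; hence subtracting `E t / (r + 1)` cancels `D j t`.
    refine ⟨t - c * euler D x t, ?_, fun j ↦ cast_mem_cancel k (r := r + 1) (by omega) ?_⟩
    · rw [sub_right_comm]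
      exact sub_mem ht (Ideal.mul_mem_left _ _ (euler_mem t))
    -- Two error terms appear: the deviation of `D j (x i)` from `-δ`, and the commutators of the
    -- derivations. Flatness is needed for the second: it bounds `D j (D i t) - D i (D j t)` by any
    -- ideal containing all `D p t`, and the factor `x i` gains one order.
    have h₁ : D j (euler D x t) - euler D x (D j t) - D j t ∈ X ^ (r + 1) ⊔ I ^ m := by
      have e : D j (euler D x t) - euler D x (D j t) - D j t =
          -(∑ i, (D j (x i) + if j = i then 1 else 0) * D i t) -
            ∑ i, x i * (D j (D i t) - D i (D j t)) := by
        simp only [euler_apply, map_neg, map_sum, hD, add_mul, mul_sub, Finset.sum_add_distrib,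
          Finset.sum_sub_distrib, ite_mul, one_mul, zero_mul, Finset.sum_ite_eq, Finset.mem_univ,
          if_true]
        ring
      rw [e]
      exact sub_mem (neg_mem (Submodule.sum_mem _ fun i _ ↦ hmul (hx i j) (h i)))
        (Submodule.sum_mem _ fun i _ ↦ hmul (Ideal.subset_span ⟨i, rfl⟩) (hflat _ t h j i))
    have h₂ : euler D x (D j t) - r * D j t ∈ X ^ (r + 1) ⊔ I ^ m := by
      obtain ⟨y, hy, z, hz, hyz⟩ := Submodule.mem_sup.mp (h j)
      have e : euler D x (D j t) - r * D j t =
          (euler D x y - r * y) + (euler D x z - r * z) := by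
        rw [← hyz, map_add]; ring
      rw [e]
      exact Submodule.add_mem_sup (euler_sub_mem hD hx _ hy)
        (sub_mem (euler_mem_pow hD hI hz) (Ideal.mul_mem_left _ _ hz))
    have e : ((r + 1 : ℕ) : T) * D j (t - c * euler D x t) =
        -(D j (euler D x t) - euler D x (D j t) - D j t) - (euler D x (D j t) - r * D j t) := by
      rw [map_sub, hD, hDc]
      push_cast at hc ⊢
      linear_combination -(D j (euler D x t)) * hc
    rw [e]
    exact sub_mem (neg_mem h₁) h₂

end

end EulerField

end LieJets

/-! ### Horizontal elements of truncated tensor powers over a frame. -/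

namespace LieJets

/-- Flatness on jets: functions and the enveloping algebra both carry the bracket to the commutator,
and the mixed terms cancel. -/
lemma Jet.conn_lie {k : Type u} {A : Type v} {L : Type w} [CommRing k] [CommRing A] [Algebra k A]
    [LieRing L] [LieAlgebra k L] [Module A L] [LieRingModule L A] [LieRinehartRing A L]
    [LieRinehartAlgebra k A L] (l m : L) (α : Jet k A L) :
    Jet.conn ⁅l, m⁆ α = Jet.conn l (Jet.conn m α) - Jet.conn m (Jet.conn l α) := by
  refine WithConv.ext (LinearMap.ext fun D ↦ ?_)
  change (Jet.conn ⁅l, m⁆ α).ofConv D =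
    (Jet.conn l (Jet.conn m α)).ofConv D - (Jet.conn m (Jet.conn l α)).ofConv D
  simp only [Jet.conn_apply, Env.vf_lie, sub_mul, map_sub, lie_lie, mul_assoc, lie_sub]
  ring

lemma TPow.map_some {A R : Type u} [CommRing A] [CommRing R] [Algebra A R] (ε : R →ₐ[A] A) {n : ℕ}
    (x : TPow A R n) : TPow.map ε some x = x := by
  refine RingHom.congr_fun (g := RingHom.id _) (TPow.hom_ext (fun a ↦ ?_) fun i r ↦ ?_) x
  · exact TPow.map_algebraMap ..
  · exact TPow.map_single ..

namespace LieAlgebroidPresheaf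

variable {k : Type u} [Field k] {C : Type u} [SmallCategory C]
  {O : Cᵒᵖ ⥤ CommAlgCat.{u} k} (P : LieAlgebroidPresheaf O) {U V W : Cᵒᵖ}

namespace PolyJets

/-- Linearity over functions, and not only over `k`, is what makes it enough to test horizontality
on a frame and bounds the commutators of the frame derivations. -/
lemma conn_smul_left' (n : ℕ) (a : O.obj U) (l : P.sec U) (x : P.PolyJets n U) :
    conn P n (a • l) x = algebraMap (O.obj U) _ a * conn P n l x := by
  refine DFunLike.congr_fun (TPow.deriv_ext (RingHom.id _) (D := conn P n (a • l))
    (E := (AddMonoidHom.mulLeft (algebraMap (O.obj U) _ a)).comp (conn P n l))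
    (conn_mul P n (a • l)) (fun x y ↦ ?_) (fun a' ↦ ?_) fun i r ↦ ?_) x
  · simp only [AddMonoidHom.comp_apply, AddMonoidHom.coe_mulLeft, conn_mul, RingHom.id_apply]
    ring
  · simp only [AddMonoidHom.comp_apply, AddMonoidHom.coe_mulLeft, conn_algebraMap,
      LieRinehartRing.lie_smul_eq_mul, map_mul]
  · simp only [AddMonoidHom.comp_apply, AddMonoidHom.coe_mulLeft, conn_single,
      Jets.conn_smul_left, map_mul]
    congr 1
    exact (TPow.single i).commutes _

lemma conn_lie (n : ℕ) (l m : P.sec U) (x : P.PolyJets n U) :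
    conn P n ⁅l, m⁆ x = conn P n l (conn P n m x) - conn P n m (conn P n l x) := by
  refine DFunLike.congr_fun (TPow.deriv_ext (RingHom.id _) (D := conn P n ⁅l, m⁆)
    (E := (conn P n l).comp (conn P n m) - (conn P n m).comp (conn P n l))
    (conn_mul P n _) (fun x y ↦ ?_) (fun a' ↦ ?_) fun i r ↦ ?_) x
  · simp only [AddMonoidHom.sub_apply, AddMonoidHom.comp_apply, conn_mul, RingHom.id_apply,
      map_add]
    ring
  · simp only [AddMonoidHom.sub_apply, AddMonoidHom.comp_apply, conn_algebraMap, lie_lie, map_sub]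
  · simp only [AddMonoidHom.sub_apply, AddMonoidHom.comp_apply, conn_single, ← map_sub]
    congr 1
    exact Jets.ext fun V f ↦ by
      change Jet.conn (P.res f ⁅l, m⁆) (r.comp f) =
        Jet.conn (P.res f l) (Jet.conn (P.res f m) (r.comp f)) -
          Jet.conn (P.res f m) (Jet.conn (P.res f l) (r.comp f))
      rw [← Jet.conn_lie]
      congr 1
      exact LieHom.map_lie _ _ _

/-- The contraction that applies the counit to the first factor. -/
lemma contract_bind (n : ℕ) (x : P.PolyJets n U) :
    contract P (Fin.cases none some : Fin (n + 1) → Option (Fin n)) U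
      (contract P (fun i : Fin n ↦ some i.succ) U x) = x := by
  rw [contract_contract]
  exact TPow.map_some _ x

end PolyJets

variable {P} {ι : Type*} {e : ι → P.sec U} (h : P.IsFrame e)

namespace IsFrame

variable [Fintype ι]

include h

/-- A property of `∇_l x` which is linear in `l` may be checked on a frame. -/
lemma conn_mem {n : ℕ} (N : Ideal (P.PolyJets n U)) {x : P.PolyJets n U}
    (hx : ∀ i, PolyJets.conn P n (e i) x ∈ N) (l : P.sec U) : PolyJets.conn P n l x ∈ N := by
  induction l using PBW.basis_induction (h.basis (𝟙 U)) with
  | zero =>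
    rw [← zero_smul (O.obj U) (0 : P.sec U), PolyJets.conn_smul_left', map_zero, zero_mul]
    exact zero_mem _
  | add l m hl hm => rw [PolyJets.conn_add_left]; exact add_mem hl hm
  | smul a l hl => rw [PolyJets.conn_smul_left']; exact Ideal.mul_mem_left _ _ hl
  | basis i => rw [basis_apply, P.res_id]; exact hx i

lemma conn_eq_zero {n m : ℕ} {x : P.TruncJets n (m + 1) U}
    (hx : ∀ i, TruncJets.conn P n m U (e i) x = 0) (l : P.sec U) :
    TruncJets.conn P n m U l x = 0 := by
  obtain ⟨x, rfl⟩ := TruncJets.mk_surjective P n (m + 1) U x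
  exact Ideal.Quotient.eq_zero_iff_mem.mpr
    (h.conn_mem _ (fun i ↦ Ideal.Quotient.eq_zero_iff_mem.mp (hx i)) l)

variable [LinearOrder ι]

omit h in
/-- The coordinates in the first factor of a tensor power. -/
def polyCoordinate (h : P.IsFrame e) (n : ℕ) (i : ι) : P.PolyJets (n + 1) U :=
  TPow.single (A := O.obj U) 0 (h.coordinate i)

lemma single_mem_span [CharZero k] {n : ℕ} {α : P.Jets U} (hα : Jets.counit P U α = 0) :
    (TPow.single (A := O.obj U) 0 α : P.PolyJets (n + 1) U) ∈
      Ideal.span (Set.range (h.polyCoordinate n)) := by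
  obtain ⟨β, rfl⟩ := h.exists_eq_sum_coordinate_mul hα
  rw [map_sum]
  refine Submodule.sum_mem _ fun i _ ↦ ?_
  rw [map_mul]
  exact Ideal.mul_mem_right _ _ (Ideal.subset_span ⟨i, rfl⟩)

lemma span_le_ideal (n : ℕ) :
    Ideal.span (Set.range (h.polyCoordinate n)) ≤ PolyJets.ideal P (n + 1) U := by
  rw [Ideal.span_le]
  rintro _ ⟨i, rfl⟩
  refine (RingHom.mem_ker).mpr ?_
  rw [polyCoordinate, TPow.aug_single, counit_coordinate]

/-- This is the duality hypothesis of the Euler argument. It holds only modulo the coordinate ideal,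
because just the counit of the derivative is known. -/
lemma conn_polyCoordinate [CharZero k] (n : ℕ) (i j : ι) :
    PolyJets.conn P (n + 1) (e j) (h.polyCoordinate n i) + (if j = i then 1 else 0) ∈
      Ideal.span (Set.range (h.polyCoordinate n)) := by
  have hs : (if j = i then 1 else 0 : P.PolyJets (n + 1) U) =
      TPow.single (A := O.obj U) 0 (if j = i then 1 else 0) := by
    split_ifs <;> simp
  rw [hs, polyCoordinate, PolyJets.conn_single, ← map_add]
  apply h.single_mem_span
  rw [map_add, counit_conn_coordinate]
  split_ifs <;> simp

/-- Two ring homomorphisms to the quotient are compared on generators: they agree on the later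
factors, and in the first factor `α - ε(α)` lies in the coordinate ideal. Together with
`contract_eq_zero_of_mem_span` this identifies that ideal with the kernel of `ε ⊗ id`. -/
lemma sub_contract_mem [CharZero k] (n : ℕ) (x : P.PolyJets (n + 1) U) :
    x - PolyJets.contract P (fun i : Fin n ↦ some i.succ) U
      (PolyJets.contract P (Fin.cases none some : Fin (n + 1) → Option (Fin n)) U x) ∈
      Ideal.span (Set.range (h.polyCoordinate n)) := by
  rw [PolyJets.contract_contract, ← Ideal.Quotient.eq]
  set X := Ideal.span (Set.range (h.polyCoordinate n)) with hX
  set σ : Fin (n + 1) → Option (Fin (n + 1)) :=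
    fun i ↦ (Fin.cases none some i : Option (Fin n)).bind fun i ↦ some i.succ
  refine RingHom.congr_fun (f := Ideal.Quotient.mk X)
    (g := (Ideal.Quotient.mk X).comp (TPow.map (Jets.counit P U) σ))
    (TPow.hom_ext (fun a ↦ ?_) fun i r ↦ ?_) x
  · rw [RingHom.comp_apply, TPow.map_algebraMap]
  · rw [RingHom.comp_apply, TPow.map_single]
    cases i using Fin.cases with
    | zero =>
      change _ = Ideal.Quotient.mk X (algebraMap _ _ _)
      rw [Ideal.Quotient.eq, ← (TPow.single (A := O.obj U) (0 : Fin (n + 1))).commutes, ← map_sub]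
      apply h.single_mem_span
      rw [map_sub, AlgHom.commutes, Algebra.algebraMap_self_apply, sub_self]
    | succ i => rfl

lemma contract_eq_zero_of_mem_span (n : ℕ) {x : P.PolyJets (n + 1) U}
    (hx : x ∈ Ideal.span (Set.range (h.polyCoordinate n))) :
    PolyJets.contract P (Fin.cases none some : Fin (n + 1) → Option (Fin n)) U x = 0 := by
  suffices hle : Ideal.span (Set.range (h.polyCoordinate n)) ≤
      RingHom.ker (PolyJets.contract P (Fin.cases none some : Fin (n + 1) → Option (Fin n)) U) from
    hle hx
  rw [Ideal.span_le]
  rintro _ ⟨i, rfl⟩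
  refine (RingHom.mem_ker).mpr ?_
  have e₁ := TPow.map_single (Jets.counit P U) (Fin.cases none some : Fin (n + 1) → Option (Fin n))
    0 (h.coordinate i)
  rw [counit_coordinate, Fin.cases_zero, Option.elim_none, map_zero] at e₁
  exact e₁

/-- Uniqueness of horizontal extension. A representative `x` is the sum of an element of the
coordinate ideal and of `1 ⊗ (ε ⊗ id)(x)`; the latter is in `I ^ (m + 1)` by hypothesis, so
`mem_pow_of_deriv_mem` applies. -/
lemma contract_injective [CharZero k] (n m : ℕ) {x : P.TruncJets (n + 1) (m + 1) U}
    (hx : ∀ i, TruncJets.conn P (n + 1) m U (e i) x = 0)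
    (hx' : TruncJets.contract P (m + 1) (Fin.cases none some : Fin (n + 1) → Option (Fin n)) U x =
      0) : x = 0 := by
  obtain ⟨x, rfl⟩ := TruncJets.mk_surjective P (n + 1) (m + 1) U x
  have hz {n m : ℕ} {y : P.PolyJets n U} : TruncJets.mk P n m U y = 0 ↔
      y ∈ PolyJets.ideal P n U ^ m := Ideal.Quotient.eq_zero_iff_mem
  simp only [TruncJets.conn_mk, TruncJets.contract_mk, hz] at hx hx' ⊢
  refine mem_pow_of_deriv_mem (D := fun i ↦ PolyJets.conn P (n + 1) (e i))
    (x := h.polyCoordinate n) (fun i ↦ PolyJets.conn_mul P _ _) (h.conn_polyCoordinate n)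
    (h.span_le_ideal n) k ?_ hx
  have h₁ := h.sub_contract_mem n x
  have h₂ := Ideal.le_comap_pow _ _ (Ideal.pow_right_mono
    (PolyJets.ideal_le_contract P (fun i : Fin n ↦ some i.succ) U) (m + 1) hx')
  rw [← sub_add_cancel x (PolyJets.contract P (fun i : Fin n ↦ some i.succ) U
      (PolyJets.contract P (Fin.cases none some : Fin (n + 1) → Option (Fin n)) U x))]
  exact Submodule.add_mem_sup h₁ h₂

/-- Existence of horizontal extension: `1 ⊗ y` is made horizontal modulo `I ^ m` by a correction in
the coordinate ideal, which `ε ⊗ id` does not see. -/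
lemma exists_contract_eq [CharZero k] (n m : ℕ) (y : P.TruncJets n (m + 1) U) :
    ∃ x : P.TruncJets (n + 1) (m + 1) U, (∀ i, TruncJets.conn P (n + 1) m U (e i) x = 0) ∧
      TruncJets.contract P (m + 1) (Fin.cases none some : Fin (n + 1) → Option (Fin n)) U x = y := by
  obtain ⟨y, rfl⟩ := TruncJets.mk_surjective P n (m + 1) U y
  obtain ⟨x, hx, hx'⟩ := exists_deriv_mem (D := fun i ↦ PolyJets.conn P (n + 1) (e i))
    (x := h.polyCoordinate n) (fun i ↦ PolyJets.conn_mul P _ _) (h.conn_polyCoordinate n)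
    (h.span_le_ideal n) k (fun N t ht i j ↦ by
      rw [← PolyJets.conn_lie]; exact h.conn_mem N ht _) m
    (PolyJets.contract P (fun i : Fin n ↦ some i.succ) U y)
  refine ⟨TruncJets.mk P _ _ U x, fun i ↦ Ideal.Quotient.eq_zero_iff_mem.mpr (hx' i), ?_⟩
  rw [TruncJets.contract_mk]
  congr 1
  have := h.contract_eq_zero_of_mem_span n hx
  rwa [map_sub, PolyJets.contract_bind, sub_eq_zero] at this

end IsFrame

end LieAlgebroidPresheaf

end LieJets

/-! ### From frames to sheaves, at a fixed truncation level. -/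

namespace LieJets

section SheafSections

variable {k : Type u} [Field k] {C : Type u} [SmallCategory C] {J : GrothendieckTopology C}

lemma Sheaf.section_ext (F : Sheaf J (ModuleCat.{u} k)) {X : C} {x y : F.obj.obj (op X)}
    {S : Sieve X} (hS : S ∈ J X)
    (h : ∀ ⦃Y : C⦄ (f : Y ⟶ X), S f → F.obj.map f.op x = F.obj.map f.op y) : x = y := by
  have hsep : Presieve.IsSeparated J (F.obj ⋙ forget (ModuleCat.{u} k)) := by
    apply Presieve.IsSheaf.isSeparated
    rw [← isSheaf_iff_isSheaf_of_type]
    exact ((sheafCompose J (forget (ModuleCat.{u} k))).obj F).2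
  exact (hsep S hS).ext h

/-- Kernels of sheaves are computed on sections: evaluation at `X` preserves them. -/
lemma Sheaf.exists_kernel_section {F G : Sheaf J (ModuleCat.{u} k)} (φ : F ⟶ G) {X : Cᵒᵖ}
    {x : F.obj.obj X} (hx : φ.hom.app X x = 0) :
    ∃ y : (kernel φ).obj.obj X, (kernel.ι φ).hom.app X y = x := by
  let S : ShortComplex (Sheaf J (ModuleCat.{u} k)) := .mk (kernel.ι φ) φ (kernel.condition φ)
  have hS : S.Exact := S.exact_of_f_is_kernel (kernelIsKernel φ)
  let E := sheafToPresheaf J (ModuleCat.{u} k) ⋙ (evaluation Cᵒᵖ (ModuleCat.{u} k)).obj X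
  have hm : Mono S.f := inferInstanceAs (Mono (kernel.ι φ))
  have : (S.map E).Exact := hS.map_of_mono_of_preservesKernel E hm inferInstance
  exact (ShortComplex.moduleCat_exact_iff _).mp this x hx

lemma exists_covering_le_finset {ι : Type*} {X : C} (S : ι → Sieve X) (hS : ∀ i, S i ∈ J X)
    (s : Finset ι) : ∃ T ∈ J X, ∀ i ∈ s, T ≤ S i := by
  classical
  induction s using Finset.induction_on with
  | empty => exact ⟨⊤, J.top_mem X, by simp⟩
  | insert a s _ ih =>
    obtain ⟨T, hT, h⟩ := ih
    refine ⟨T ⊓ S a, J.intersection_covering hT (hS a), fun i hi ↦ ?_⟩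
    rcases Finset.mem_insert.mp hi with rfl | hi
    · exact inf_le_right
    · exact inf_le_left.trans (h i hi)

end SheafSections

namespace LieAlgebroid

variable {k : Type u} [Field k] {C : Type u} [SmallCategory C] {J : GrothendieckTopology C}
  {O : Sheaf J (CommAlgCat.{u} k)} (L : LieAlgebroid O)

/-- The sieve of the morphisms whose source has a frame of `d` sections. -/
def frameSieve (d : ℕ) (X : C) : Sieve X where
  arrows Y _ := ∃ e : Fin d → L.sec (op Y), L.IsFrame e
  downward_closed := by
    rintro Y Z f ⟨e, he⟩ g
    exact ⟨_, he.res g.op⟩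

lemma frameSieve_mem {d : ℕ} (hL : L.IsLocallyFree d) (X : C) : L.frameSieve d X ∈ J X := by
  obtain ⟨S, hS, h⟩ := hL X
  refine J.superset_covering (fun Y f hf ↦ ?_) hS
  obtain ⟨e, he⟩ := h f hf
  exact ⟨e, fun V g ↦ he g.unop⟩

/-- The sheafification map of `J^{⊗ n} / I^m`. -/
def toTower (n m : ℕ) : L.trunc n m ⟶ ((L.sheafTower n).obj (op m)).obj :=
  toSheafify J (L.trunc n m)

instance (n m : ℕ) : Presheaf.IsLocallyInjective J (L.toTower n m) :=
  inferInstanceAs (Presheaf.IsLocallyInjective J (toSheafify J (L.trunc n m)))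

instance (n m : ℕ) : Presheaf.IsLocallySurjective J (L.toTower n m) :=
  inferInstanceAs (Presheaf.IsLocallySurjective J (toSheafify J (L.trunc n m)))

lemma toTower_nablaSheaf (n m : ℕ) : L.toTower n (m + 1) ≫ (L.nablaSheaf n m).hom =
    L.nabla n m ≫ ihomMap L.toPresheaf (L.toTower n m) :=
  ((sheafificationAdjunction J (ModuleCat.{u} k)).homEquiv (L.trunc n (m + 1))
    (sheafIhom J L.toPresheaf ((L.sheafTower n).obj (op m)))).apply_symm_apply _

lemma toTower_sheafTowerMap {a b : ℕ} (σ : Fin a → Option (Fin b)) (m : ℕ) :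
    L.toTower a m ≫ ((L.sheafTowerMap σ).app (op m)).hom =
      (L.towerMap σ).app (op m) ≫ L.toTower b m :=
  ((sheafificationAdjunction J (ModuleCat.{u} k)).unit.naturality
    ((L.towerMap σ).app (op m))).symm

lemma nablaSheaf_toTower_apply (n m : ℕ) {U : Cᵒᵖ} (x : L.TruncJets n (m + 1) U) :
    (L.nablaSheaf n m).hom.app U ((L.toTower n (m + 1)).app U x) =
      (ihomMap L.toPresheaf (L.toTower n m)).app U ((L.nabla n m).app U x) :=
  ConcreteCategory.congr_hom (NatTrans.congr_app (L.toTower_nablaSheaf n m) U) x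

lemma sheafTowerMap_toTower_apply {a b : ℕ} (σ : Fin a → Option (Fin b)) (m : ℕ) {U : Cᵒᵖ}
    (x : L.TruncJets a m U) : ((L.sheafTowerMap σ).app (op m)).hom.app U ((L.toTower a m).app U x) =
      (L.toTower b m).app U (LieAlgebroidPresheaf.TruncJets.contract _ m σ U x) :=
  ConcreteCategory.congr_hom (NatTrans.congr_app (L.toTower_sheafTowerMap σ m) U) x

lemma toTower_res (n m : ℕ) {U V : Cᵒᵖ} (f : U ⟶ V) (x : L.TruncJets n m U) :
    ((L.sheafTower n).obj (op m)).obj.map f ((L.toTower n m).app U x) =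
      (L.toTower n m).app V (LieAlgebroidPresheaf.TruncJets.res _ n m f x) :=
  (NatTrans.naturality_apply (L.toTower n m) f x).symm

/-- A section of the sheaf of morphisms is evaluated at the identity of `U`. The conclusion holds
only after sheafification, so `∇_l x` itself vanishes only on a cover. -/
lemma toTower_conn_eq_zero (n m : ℕ) {U : Cᵒᵖ} (x : L.TruncJets n (m + 1) U)
    (h : (L.nablaSheaf n m).hom.app U ((L.toTower n (m + 1)).app U x) = 0) (l : L.sec U) :
    (L.toTower n m).app U (LieAlgebroidPresheaf.TruncJets.conn _ n m U l x) = 0 := by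
  rw [nablaSheaf_toTower_apply] at h
  have h' := ConcreteCategory.congr_hom (NatTrans.congr_app h (op (Over.mk (𝟙 U.unop)))) l
  have e : LieAlgebroidPresheaf.TruncJets.res _ n (m + 1) (𝟙 U) x = x :=
    LieAlgebroidPresheaf.TruncJets.res_id _ n (m + 1) x
  refine Eq.trans ?_ h'
  exact congrArg (fun y ↦ (L.toTower n m).app U
    (LieAlgebroidPresheaf.TruncJets.conn _ n m U l y)) e.symm

lemma nabla_eq_zero {n m : ℕ} {U : Cᵒᵖ} {ι : Type*} [Fintype ι] {e : ι → L.sec U}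
    (he : L.IsFrame e) (x : L.TruncJets n (m + 1) U)
    (hx : ∀ i, LieAlgebroidPresheaf.TruncJets.conn _ n m U (e i) x = 0) :
    (L.nabla n m).app U x = 0 := by
  refine NatTrans.ext (funext fun V ↦ ModuleCat.hom_ext (LinearMap.ext fun l ↦ ?_))
  refine (he.res V.unop.hom.op).conn_eq_zero (fun i ↦ ?_) l
  rw [← LieAlgebroidPresheaf.TruncJets.res_conn, hx, map_zero]

section

variable [CharZero k] {d : ℕ} (hL : L.IsLocallyFree d)

/-- The map of towers that applies the counit to the first factor. -/
abbrev epsTower (n : ℕ) : L.sheafTower (n + 1) ⟶ L.sheafTower n :=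
  L.sheafTowerMap (Fin.cases none some)

include hL

/-- Locally `t` comes from an actual class `x` over an object with a frame. After a further
refinement both `ε ⊗ id` and the derivatives along the frame kill `x` before sheafification, and
`contract_injective` applies. -/
lemma section_eq_zero (n m : ℕ) {X : C} (t : ((L.sheafTower (n + 1)).obj (op (m + 1))).obj.obj (op X))
    (h : (L.nablaSheaf (n + 1) m).hom.app (op X) t = 0)
    (h' : ((L.epsTower n).app (op (m + 1))).hom.app (op X) t = 0) : t = 0 := by
  refine Sheaf.section_ext _ (J.intersection_covering (L.frameSieve_mem hL X)
    (Presheaf.imageSieve_mem J (L.toTower (n + 1) (m + 1)) t)) ?_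
  rintro Y f ⟨⟨e, he⟩, ⟨x, hx⟩⟩
  rw [map_zero, ← hx]
  have hn : (L.nablaSheaf (n + 1) m).hom.app (op Y) ((L.toTower (n + 1) (m + 1)).app (op Y) x) =
      0 := by
    rw [hx, NatTrans.naturality_apply, h, map_zero]
  have hε : ((L.epsTower n).app (op (m + 1))).hom.app (op Y)
      ((L.toTower (n + 1) (m + 1)).app (op Y) x) = 0 := by
    rw [hx, NatTrans.naturality_apply, h', map_zero]
  replace hε := (L.sheafTowerMap_toTower_apply (Fin.cases none some) (m + 1) x).symm.trans hε
  -- Each frame element has its own cover on which the derivative vanishes. Finiteness of the rank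
  -- gives a common one.
  obtain ⟨T, hT, hT'⟩ := exists_covering_le_finset (J := J)
    (fun i ↦ Presheaf.equalizerSieve (F := L.trunc (n + 1) m)
      (LieAlgebroidPresheaf.TruncJets.conn _ (n + 1) m (op Y) (e i) x) 0)
    (fun i ↦ Presheaf.equalizerSieve_mem J (L.toTower (n + 1) m) _ _ (by
      rw [map_zero]; exact L.toTower_conn_eq_zero _ _ x hn (e i))) Finset.univ
  refine Sheaf.section_ext _ (J.intersection_covering hT
    (Presheaf.equalizerSieve_mem J (L.toTower n (m + 1)) _ 0 (hε.trans (map_zero _).symm))) ?_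
  rintro Z g ⟨hg, hg'⟩
  rw [map_zero]
  refine (L.toTower_res (n + 1) (m + 1) g.op x).trans ?_
  have key : LieAlgebroidPresheaf.TruncJets.res _ (n + 1) (m + 1) g.op x = 0 := by
    refine (he.res g.op).contract_injective n m (fun i ↦ ?_) ?_
    · refine (LieAlgebroidPresheaf.TruncJets.res_conn _ (n + 1) m g.op (e i) x).symm.trans ?_
      exact Eq.trans (hT' i (Finset.mem_univ i) g hg) (map_zero _)
    · refine (LieAlgebroidPresheaf.TruncJets.res_contract _ (m + 1) _ g.op x).symm.trans ?_
      exact Eq.trans hg' (map_zero _)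
  rw [key]
  exact map_zero _

/-- The horizontal sections of `J^{⊗ (n+1)} / I^{m+1}` are identified with the sections of
`J^{⊗ n} / I^{m+1}`. -/
lemma isIso_kernel_epsTower (n m : ℕ) :
    IsIso (kernel.ι (L.nablaSheaf (n + 1) m) ≫ (L.epsTower n).app (op (m + 1))) := by
  set φ := kernel.ι (L.nablaSheaf (n + 1) m) ≫ (L.epsTower n).app (op (m + 1)) with hφ
  have hmono : Mono φ := by
    -- A morphism killed by `φ` takes values in sections that are both horizontal and killed by `ε ⊗
    -- id`.
    refine Preadditive.mono_of_cancel_zero _ fun {G} g hg ↦ ?_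
    rw [← cancel_mono (kernel.ι (L.nablaSheaf (n + 1) m)), zero_comp]
    refine Sheaf.hom_ext (NatTrans.ext (funext fun X ↦ ModuleCat.hom_ext
      (LinearMap.ext fun y ↦ ?_)))
    refine L.section_eq_zero hL n m (X := X.unop) _ ?_ ?_
    · have : (g ≫ kernel.ι (L.nablaSheaf (n + 1) m)) ≫ L.nablaSheaf (n + 1) m = 0 := by
        rw [Category.assoc, kernel.condition, comp_zero]
      exact ConcreteCategory.congr_hom
        (NatTrans.congr_app (congrArg (fun z ↦ z.hom) this) X) y
    · have : (g ≫ kernel.ι (L.nablaSheaf (n + 1) m)) ≫ (L.epsTower n).app (op (m + 1)) = 0 := by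
        rw [Category.assoc, hg]
      exact ConcreteCategory.congr_hom
        (NatTrans.congr_app (congrArg (fun z ↦ z.hom) this) X) y
  have hsurj : Sheaf.IsLocallySurjective φ := by
    refine ⟨fun {X} t ↦ ?_⟩
    refine J.superset_covering ?_ (J.intersection_covering (L.frameSieve_mem hL X)
      (Presheaf.imageSieve_mem J (L.toTower n (m + 1)) t))
    rintro Y f ⟨⟨e, he⟩, ⟨y, hy⟩⟩
    -- The extension exists as a class of the presheaf wherever there is a frame and `t` lifts to
    -- the presheaf. Being horizontal along the frame, its image is a section of the kernel sheaf.
    obtain ⟨x, hx, hx'⟩ := he.exists_contract_eq n m y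
    have hn : (L.nablaSheaf (n + 1) m).hom.app (op Y)
        ((L.toTower (n + 1) (m + 1)).app (op Y) x) = 0 := by
      rw [nablaSheaf_toTower_apply]
      exact (congrArg _ (L.nabla_eq_zero he x hx)).trans (map_zero _)
    obtain ⟨z, hz⟩ := Sheaf.exists_kernel_section _ hn
    refine ⟨z, ?_⟩
    refine Eq.trans ?_ hy
    refine (congrArg (((L.epsTower n).app (op (m + 1))).hom.app (op Y)) hz).trans ?_
    refine (L.sheafTowerMap_toTower_apply (Fin.cases none some) (m + 1) x).trans ?_
    exact congrArg _ hx'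
  have hepi : Epi φ := inferInstance
  exact isIso_of_mono_of_epi φ

end

end LieAlgebroid

end LieJets

/-! ### The chain map, and passage to the limit. -/

namespace LieJets

/-- Applying `ε` to the factor with number `0` turns a Hochschild face into a reduced face. The
first and the last Hochschild face multiply `α₁`, respectively the last factor, into `α₀`; since `ε`
is multiplicative, these become the faces that evaluate an end factor by `ε`. -/
lemma hochFace_bind_cases (p : ℕ) (i : Fin (p + 2)) (j : Fin (p + 2)) :
    (some (hochFace p i j)).bind (Fin.cases none some : Fin (p + 1) → Option (Fin p)) =
      (Fin.cases none some j : Option (Fin (p + 1))).bind (redFace p i) := by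
  have hc (x : Fin (p + 1)) (y : ℕ) (h : (x : ℕ) = y) (hy : y < p + 1) :
      (Fin.cases none some x : Option (Fin p)) =
        if h : y = 0 then none else some ⟨y - 1, by omega⟩ := by
    subst h
    cases x using Fin.cases <;> simp
  rw [Option.bind_some]
  cases j using Fin.cases with
  | zero => rw [hc _ 0 (by simp [hochFace]) p.succ_pos, dif_pos rfl]; rfl
  | succ j =>
    obtain ⟨j, hj⟩ := j
    obtain ⟨i, hi⟩ := i
    rw [Fin.cases_succ, Option.bind_some, redFace]
    simp only
    rcases Nat.lt_or_ge j i with h | h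
    · rw [dif_pos h]
      rcases Nat.lt_or_ge j p with h' | h'
      · rw [dif_pos h', hc _ (j + 1) (by
          simp only [hochFace, Fin.succ_mk]
          rw [if_pos (by omega), Nat.mod_eq_of_lt (by omega)]) (by omega),
          dif_neg (Nat.succ_ne_zero j)]
        rfl
      · rw [dif_neg (by omega), hc _ 0 (by
          simp only [hochFace, Fin.succ_mk]
          rw [if_pos (by omega), show j + 1 = p + 1 by omega, Nat.mod_self]) p.succ_pos,
          dif_pos rfl]
    · rw [dif_neg (by omega), hc _ j (by
          simp only [hochFace, Fin.succ_mk]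
          rw [if_neg (by omega), Nat.add_sub_cancel, Nat.mod_eq_of_lt hj]) hj]

namespace LieAlgebroid

variable {k : Type u} [Field k] {C : Type u} [SmallCategory C] {J : GrothendieckTopology C}
  {O : Sheaf J (CommAlgCat.{u} k)} (L : LieAlgebroid O)

/-- The chain map which applies the counit to the first factor. -/
def epsHom : L.hochschild ⟶ L.reduced where
  f p := L.epsMap p
  comm' := by
    rintro i p (rfl : p + 1 = i)
    simp only [hochschild, reduced, epsMap, faceComplex, ChainComplex.of_d, faceD,
      Preadditive.comp_sum, Preadditive.sum_comp, Preadditive.comp_zsmul, Preadditive.zsmul_comp]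
    refine Finset.sum_congr rfl fun i _ ↦ congrArg _ ?_
    rw [contractHat_comp, contractHat_comp]
    congr 1
    funext j
    exact (hochFace_bind_cases p i j).symm

/-- The projection `J^{⊗ n} / I^m ⟶ J^{⊗ n} / I^{m'}`. -/
def factor (n : ℕ) {m m' : ℕ} (h : m' ≤ m) : L.trunc n m ⟶ L.trunc n m' :=
  (L.tower n).map (homOfLE h).op

lemma toTower_map (n : ℕ) {m m' : ℕ} (h : m' ≤ m) :
    L.toTower n m ≫ ((L.sheafTower n).map (homOfLE h).op).hom =
      L.factor n h ≫ L.toTower n m' :=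
  ((sheafificationAdjunction J (ModuleCat.{u} k)).unit.naturality
    ((L.tower n).map (homOfLE h).op)).symm

lemma factor_nabla (n : ℕ) {m m' : ℕ} (h : m' ≤ m) :
    L.factor n (Nat.succ_le_succ h) ≫ L.nabla n m' =
      L.nabla n m ≫ ihomMap L.toPresheaf (L.factor n h) := by
  refine NatTrans.ext (funext fun U ↦ ModuleCat.hom_ext (LinearMap.ext fun x ↦
    NatTrans.ext (funext fun W ↦ ModuleCat.hom_ext (LinearMap.ext fun l ↦ ?_))))
  obtain ⟨x, rfl⟩ := LieAlgebroidPresheaf.TruncJets.mk_surjective _ n (m + 1) U x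
  rfl

lemma toTower_hom_ext {n m : ℕ} {G : Sheaf J (ModuleCat.{u} k)}
    {φ ψ : (L.sheafTower n).obj (op m) ⟶ G}
    (h : L.toTower n m ≫ φ.hom = L.toTower n m ≫ ψ.hom) : φ = ψ :=
  Sheaf.hom_ext (sheafify_hom_ext J _ _ G.property h)

/-- The diagram chase behind `nablaSheaf_map`: with `t` and `t'` the sheafification maps,
compatibility of the connection with the projections descends from presheaves (`h₃`) to sheaves. -/
lemma comp_eq_comp_of_squares {D : Type*} [Category D] {A A' B B' E E' F F' : D}
    {t : A ⟶ B} {s : B ⟶ B'} {f : A ⟶ A'} {t' : A' ⟶ B'} {N' : B' ⟶ E'} {ν' : A' ⟶ F'}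
    {q' : F' ⟶ E'} {ν : A ⟶ F} {r : F ⟶ F'} {N : B ⟶ E} {q : F ⟶ E} {q'' : E ⟶ E'}
    (h₁ : t ≫ s = f ≫ t') (h₂ : t' ≫ N' = ν' ≫ q') (h₃ : f ≫ ν' = ν ≫ r)
    (h₄ : t ≫ N = ν ≫ q) (h₅ : r ≫ q' = q ≫ q'') : t ≫ s ≫ N' = t ≫ N ≫ q'' := by
  rw [← Category.assoc, h₁, Category.assoc, h₂, ← Category.assoc, h₃, Category.assoc, h₅,
    ← Category.assoc, ← h₄, Category.assoc]

lemma nablaSheaf_map (n : ℕ) {m m' : ℕ} (h : m' ≤ m) :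
    (L.sheafTower n).map (homOfLE (Nat.succ_le_succ h)).op ≫ L.nablaSheaf n m' =
      L.nablaSheaf n m ≫ (ObjectProperty.homMk (ihomMap L.toPresheaf
        ((L.sheafTower n).map (homOfLE h).op).hom) :
          sheafIhom J L.toPresheaf _ ⟶ sheafIhom J L.toPresheaf _) :=
  L.toTower_hom_ext (comp_eq_comp_of_squares (L.toTower_map n (Nat.succ_le_succ h))
    (L.toTower_nablaSheaf n m') (L.factor_nabla n h) (L.toTower_nablaSheaf n m)
    (congrArg (ihomMap L.toPresheaf) (L.toTower_map n h).symm))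

lemma comp_map_nablaSheaf_eq_zero (n : ℕ) {m m' : ℕ} (h : m' ≤ m)
    {Z : Sheaf J (ModuleCat.{u} k)} {y : Z ⟶ (L.sheafTower n).obj (op (m + 1))}
    (hy : y ≫ L.nablaSheaf n m = 0) :
    (y ≫ (L.sheafTower n).map (homOfLE (Nat.succ_le_succ h)).op) ≫ L.nablaSheaf n m' = 0 := by
  rw [Category.assoc, L.nablaSheaf_map n h, ← Category.assoc, hy, zero_comp]

lemma proj_map (n : ℕ) {m m' : ℕ} (h : m' ≤ m) :
    L.proj n m ≫ (L.sheafTower n).map (homOfLE h).op = L.proj n m' :=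
  limit.w (L.sheafTower n) (homOfLE h).op

lemma epsTower_naturality (n : ℕ) {m m' : ℕ} (h : m' ≤ m) :
    (L.sheafTower (n + 1)).map (homOfLE h).op ≫ (L.epsTower n).app (op m') =
      (L.epsTower n).app (op m) ≫ (L.sheafTower n).map (homOfLE h).op :=
  (L.epsTower n).naturality (homOfLE h).op

variable [CharZero k] {d : ℕ} (hL : L.IsLocallyFree d)

include hL

/-- Classes in `J^{⊗ n} / I^{m+1}` extend uniquely to horizontal classes in
`J^{⊗ (n+1)} / I^{m+1}`. -/
lemma exists_horizontal_lift (n m : ℕ) :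
    ∃ s : (L.sheafTower n).obj (op (m + 1)) ⟶ (L.sheafTower (n + 1)).obj (op (m + 1)),
      s ≫ L.nablaSheaf (n + 1) m = 0 ∧ s ≫ (L.epsTower n).app (op (m + 1)) = 𝟙 _ ∧
      ∀ {Z : Sheaf J (ModuleCat.{u} k)} (y : Z ⟶ (L.sheafTower (n + 1)).obj (op (m + 1))),
        y ≫ L.nablaSheaf (n + 1) m = 0 → y ≫ (L.epsTower n).app (op (m + 1)) ≫ s = y := by
  have := L.isIso_kernel_epsTower hL n m
  set φ := kernel.ι (L.nablaSheaf (n + 1) m) ≫ (L.epsTower n).app (op (m + 1)) with hφ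
  refine ⟨inv φ ≫ kernel.ι _, ?_, ?_, fun y hy ↦ ?_⟩
  · rw [Category.assoc, kernel.condition, comp_zero]
  · rw [Category.assoc, ← hφ, IsIso.inv_hom_id]
  · obtain ⟨z, rfl⟩ : ∃ z, z ≫ kernel.ι (L.nablaSheaf (n + 1) m) = y :=
      ⟨kernel.lift _ y hy, kernel.lift_ι _ _ _⟩
    rw [Category.assoc, ← Category.assoc (kernel.ι _), ← hφ, IsIso.hom_inv_id_assoc]

/-- The inverse is built as a map into the limit from the level-wise inverses `s m`. Their
uniqueness among horizontal lifts makes them compatible, so the limit of isomorphisms is handled by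
explicit maps. -/
lemma exists_horizontal_lift_completed (n : ℕ) :
    ∃ s : L.completed n ⟶ L.completed (n + 1), s ≫ L.nablaHat (n + 1) = 0 ∧
      s ≫ L.contractHat (Fin.cases none some) = 𝟙 _ ∧
      L.inclusion (n + 1) ≫ L.contractHat (Fin.cases none some) ≫ s = L.inclusion (n + 1) := by
  choose s hs hs' huniq using L.exists_horizontal_lift hL n
  -- The projection of `s m` to the lower level is still horizontal, so it is recovered there from
  -- its image under `ε ⊗ id`, which is the projection on `J^{⊗ n}`.
  have hcomp {m m' : ℕ} (h : m' ≤ m) :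
      s m ≫ (L.sheafTower (n + 1)).map (homOfLE (Nat.succ_le_succ h)).op =
        (L.sheafTower n).map (homOfLE (Nat.succ_le_succ h)).op ≫ s m' := by
    rw [← huniq m' _ (L.comp_map_nablaSheaf_eq_zero (n + 1) h (hs m)), Category.assoc,
      ← Category.assoc ((L.sheafTower (n + 1)).map _), epsTower_naturality, Category.assoc,
      ← Category.assoc, hs', Category.id_comp]
  -- The lift `s m` lives at level `m + 1`, and level `0` has none of its own. Lifting one level
  -- higher and projecting down treats all levels uniformly.
  let leg (m : ℕ) : L.completed n ⟶ (L.sheafTower (n + 1)).obj (op m) :=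
    L.proj n (m + 1) ≫ s m ≫ (L.sheafTower (n + 1)).map (homOfLE m.le_succ).op
  have hleg {m m' : ℕ} (h : m' ≤ m) :
      leg m ≫ (L.sheafTower (n + 1)).map (homOfLE h).op = leg m' := by
    have e : (L.sheafTower (n + 1)).map (homOfLE m.le_succ).op ≫
        (L.sheafTower (n + 1)).map (homOfLE h).op =
        (L.sheafTower (n + 1)).map (homOfLE (Nat.succ_le_succ h)).op ≫
          (L.sheafTower (n + 1)).map (homOfLE m'.le_succ).op := by
      rw [← Functor.map_comp, ← Functor.map_comp]
      rfl
    simp only [leg, Category.assoc, e]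
    rw [← Category.assoc (s m), hcomp h, Category.assoc, ← Category.assoc, proj_map]
  let t : L.completed n ⟶ L.completed (n + 1) := limit.lift (L.sheafTower (n + 1))
    { pt := L.completed n
      π := { app := fun m ↦ leg m.unop
             naturality := fun m m' f ↦ (Category.id_comp _).trans (hleg (leOfHom f.unop)).symm } }
  have ht (m : ℕ) : t ≫ L.proj (n + 1) m = leg m := limit.lift_π _ _
  have ht' (m : ℕ) : t ≫ L.proj (n + 1) (m + 1) = L.proj n (m + 1) ≫ s m := by
    rw [ht]
    simp only [leg]
    rw [hcomp m.le_succ, ← Category.assoc, proj_map]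
  refine ⟨t, Pi.hom_ext _ _ fun m ↦ ?_, limit.hom_ext fun m ↦ ?_, limit.hom_ext fun m ↦ ?_⟩
  · have h : L.nablaHat (n + 1) ≫ Pi.π _ m = L.proj (n + 1) (m + 1) ≫ L.nablaSheaf (n + 1) m := by
      simp [nablaHat]
    rw [Category.assoc, h, ← Category.assoc, ht', Category.assoc, hs, comp_zero, zero_comp]
  · obtain ⟨m⟩ := m
    change (t ≫ L.contractHat _) ≫ L.proj n m = 𝟙 _ ≫ L.proj n m
    rw [Category.assoc, contractHat_proj, ← Category.assoc, ht, Category.id_comp]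
    simp only [leg, Category.assoc]
    rw [epsTower_naturality, ← Category.assoc (s m), hs', Category.id_comp, proj_map]
  · obtain ⟨m⟩ := m
    change (L.inclusion (n + 1) ≫ L.contractHat _ ≫ t) ≫ L.proj (n + 1) m =
      L.inclusion (n + 1) ≫ L.proj (n + 1) m
    rw [Category.assoc, Category.assoc, ht]
    simp only [leg]
    rw [← Category.assoc (L.contractHat _), contractHat_proj]
    -- Invariants are horizontal at level `m + 1`, where uniqueness is available; the resulting
    -- identity is then projected to level `m`.
    have h := huniq m (L.inclusion (n + 1) ≫ L.proj (n + 1) (m + 1))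
      (by rw [Category.assoc, inclusion_nabla])
    rw [← L.proj_map (n + 1) m.le_succ]
    simp only [← Category.assoc] at h ⊢
    rw [h]

/-- The lift is horizontal, so it factors through the kernel defining the invariants, and that
factorization is the inverse. Applied in each degree `p` with `n = p`, this gives the isomorphism of
complexes. -/
lemma isIso_inclusion_contractHat (n : ℕ) :
    IsIso (L.inclusion (n + 1) ≫ L.contractHat (a := n + 1) (b := n) (Fin.cases none some)) := by
  obtain ⟨s, hs, hs', hs''⟩ := L.exists_horizontal_lift_completed hL n
  obtain ⟨r, hr⟩ : ∃ r : L.completed n ⟶ L.invariants (n + 1), r ≫ L.inclusion (n + 1) = s :=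
    ⟨kernel.lift _ s hs, kernel.lift_ι _ _ _⟩
  refine ⟨r, ?_, ?_⟩
  · rw [← cancel_mono (L.inclusion (n + 1)), Category.id_comp, Category.assoc, Category.assoc,
      hr, hs'']
  · rw [← Category.assoc, hr, hs']

end LieAlgebroid

end LieJets

end

theorem proposition6p1 {k : Type u} [Field k] [CharZero k]
    {C : Type u} [SmallCategory C] {J : GrothendieckTopology C} (O : Sheaf J (CommAlgCat.{u} k))
    (L : LieJets.LieAlgebroid O) (d : ℕ) (hL : L.IsLocallyFree d) :
    ∃ φ : L.hochschild ⟶ L.reduced,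
      (∀ p : ℕ, φ.f p = L.epsMap p) ∧ IsIso (L.invInclusion ≫ φ) := by
  refine ⟨L.epsHom, fun _ ↦ rfl, ?_⟩
  have (p : ℕ) : IsIso ((L.invInclusion ≫ L.epsHom).f p) := L.isIso_inclusion_contractHat hL p
  exact HomologicalComplex.Hom.isIso_of_components _
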